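/- **Model.** There are $n$ parties, numbered $0,\dots,n-1$, with local clocks and authenticated point-to-point channels between every pair (including a channel from each party to itself); a fixed bound $\Delta>0$ is known to all. A set of at most $f$ parties is faulty (Byzantine): these behave arbitrarily, with no computational restriction; no cryptography and no setup besides the authenticated channels is used. All other (nonfaulty) parties run the protocol. There is a time GST, unknown to the parties, such that every nonfaulty party starts at the latest at GST, every message between nonfaulty parties sent at time $t$ arrives at the latest at time $\max(t,\mathrm{GST})+\Delta$, and from GST on all clocks run in step with real time; before GST delays (finite) and clocks are arbitrary. Local computation takes no time, each received message is processed atomically, and only finitely many events happen in bounded time. A *Byzantine Agreement protocol in partial synchrony resilient to $f$ Byzantine parties* is a protocol such that in every such execution (for every faulty set, behaviour of the faulty parties, message scheduling, clocks, GST and inputs): * **Termination.** All nonfaulty parties eventually decide on a value and terminate. * **Correctness.** If two nonfaulty parties decide on $val$ and $val'$, then $val=val'$. * **Validity.** If all parties are nonfaulty and have the same input $val$, then every party that decides, decides on $val$. **Protocol IT-HS**, with parameters $n,f,\Delta$; code of party $i$ with input $x_i$ (from an arbitrary set of values). Variables, with initial values: $lock=key3=key2=key1=0$; $lock\_val=key3\_val=key2\_val=key1\_val=x_i$;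 $prev\_key2=prev\_key1=-1$; $view=1$; arrays $highest\_request[j]=highest\_abort[j]=0$. The primary of view $v$ is the party $v \bmod n$. "Send to all" includes the sender. "*Send upon join*" a message $m$ (fixed at the time of the call) in view $v$ means: to each party $j$, send $m$ as soon as $highest\_request[j]=v$ while the sender is in view $v$. Records of received messages and pending actions of a view are dropped when the view is left, and messages tagged with a view other than the current one are ignored, except $request$ and $abort$. *At the start of each view* (initially and whenever $view$ changes): send $\langle request,view\rangle$ to all; as soon as $highest\_request[primary]=view$, send $\langle suggest,key3,key3\_val,key2,key2\_val,prev\_key2,view\rangle$ to the primary; send upon join $\langle proof,key1,key1\_val,prev\_key1,view\rangle$; and when $11\Delta$ has passed on the local clock in this view, send $\langle abort,view\rangle$ to all. *Primary of the view.* On the first $\langle suggest,k3,v3,k2,v2,pk2,view\rangle$ from $j$: if $pk2<k2<view$, add $(k2,v2,pk2)$ to the multiset $key2\_proofs$; if $k3=0$, add $(k3,v3)$ to the multiset $suggestions$; otherwise, if $k3<view$, add it as soon as at least $f+1$ elements $(k,v,pk)$ of $key2\_proofs$ satisfy $k3\le pk$ or ($k3\le k$ and $v3=v$). Once $|suggestions|\ge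 n-f$, choose some $(k,v)\in suggestions$ with $k$ maximal and send upon join $\langle propose,k,v,view\rangle$ (once per view). *All parties, in the current view.* On the first $\langle proof,k1,v1,pk1,view\rangle$ from $j$: if $view>k1>pk1$, add $(k1,v1,pk1)$ to the multiset $proofs$. On the first $\langle propose,key,val,view\rangle$ from the primary: if $lock=0$ or $val=lock\_val$, send upon join $\langle echo,val,view\rangle$; otherwise, if $view>key\ge lock$, do so as soon as at least $f+1$ elements $(k,v,pk)$ of $proofs$ satisfy $lock\le pk$ or ($lock\le k$ and $v\ne lock\_val$), where $lock,lock\_val$ are the values held when the proposal was processed. On $\langle echo,val,view\rangle$ from $n-f$ parties with the same $val$: send upon join $\langle key1,val,view\rangle$; if $key1\_val\ne val$, set $prev\_key1\leftarrow key1$, $key1\_val\leftarrow val$; then set $key1\leftarrow view$. On $\langle key1,val,view\rangle$ from $n-f$ parties with the same $val$: send upon join $\langle key2,val,view\rangle$; if $key2\_val\ne val$, set $prev\_key2\leftarrow key2$, $key2\_val\leftarrow val$; then set $key2\leftarrow view$. On $\langle key2,val,view\rangle$ from $n-f$ parties with the same $val$: send upon join $\langle key3,val,view\rangle$ and set $key3\leftarrow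 view$, $key3\_val\leftarrow val$. On $\langle key3,val,view\rangle$ from $n-f$ parties with the same $val$: send upon join $\langle lock,val,view\rangle$ and set $lock\leftarrow view$, $lock\_val\leftarrow val$. On $\langle lock,val,view\rangle$ from $n-f$ parties with the same $val$: send $\langle done,val\rangle$ to all, unless a $done$ message was sent before. *All parties, in every view.* On $\langle request,v\rangle$ from $j$: $highest\_request[j]\leftarrow\max(highest\_request[j],v)$. On $\langle done,val\rangle$ from $f+1$ parties with the same $val$: send $\langle done,val\rangle$ to all, unless a $done$ message was sent before. On $\langle done,val\rangle$ from $n-f$ parties with the same $val$: decide $val$ and terminate. On $\langle abort,v\rangle$ from $j$ with $highest\_abort[j]<v$: set $highest\_abort[j]\leftarrow v$; let $u$ be the $(f+1)$-th largest entry of $highest\_abort$; if $u>highest\_abort[i]$, send $\langle abort,u\rangle$ to all and set $highest\_abort[i]\leftarrow u$; then let $w$ be the $(n-f)$-th largest entry; if $w\ge view$, set $view\leftarrow w+1$. **Theorem.** For all $n,f$ with $f<n/3$ and all $\Delta>0$, IT-HS is a Byzantine Agreement protocol in partial synchrony resilient to $f$ Byzantine parties. -/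

import Mathlib

universe u

/-! ### Byzantine Agreement in the partially synchronous model -/

namespace PartialSync

/-- The messages a party sends in one atomic step: for every recipient, a list of messages. -/
abbrev Outbox (n : ℕ) (M : Type u) : Type u := Fin n → List M

/-- A protocol for `n` parties with inputs and outputs in `V`, over authenticated point-to-point
channels. Every party is a state machine with a local clock and (at most) one pending alarm. The
`ℝ` arguments are the reading of the party's own local clock at the moment of the step. Transitions
return the set of allowed outcomes (new state and messages sent), so a protocol may leave choices
open; every resolution of the choices is then considered. -/
structure Protocol (n : ℕ) (V : Type u) where
  State : Type u
  Msg : Type u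
  /-- code run by party `i` with the given input when it starts -/
  start : Fin n → V → ℝ → Set (State × Outbox n Msg)
  /-- `receive i now j m s`: party `i` in state `s` receives the message `m` from party `j` -/
  receive : Fin n → ℝ → Fin n → Msg → State → Set (State × Outbox n Msg)
  /-- local clock reading at which the pending alarm, if any, goes off -/
  deadline : State → Option ℝ
  /-- code run by party `i` when its alarm goes off -/
  timeout : Fin n → ℝ → State → Set (State × Outbox n Msg)
  /-- the value decided on, if the party has decided (and thereby terminated) -/
  decision : State → Option V

/-- Events of an execution. Behaviour of faulty parties needs no events of its own: what they do
is visible only through the messages `recv i j m` that nonfaulty parties `i` get from faulty `j`. -/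
inductive Event (n : ℕ) (M : Type u) : Type u
  | start (i : Fin n)
  | recv (i j : Fin n) (m : M)
  | timeout (i : Fin n)
  | idle

/-- The party that takes a step in an event. -/
def Event.party {n : ℕ} {M : Type u} : Event n M → Option (Fin n)
  | .start i => some i
  | .recv i _ _ => some i
  | .timeout i => some i
  | .idle => none

/-- `LocalStep P i x now e s s' o`: in event `e`, the party `i` with input `x` and local clock
reading `now` moves from `s` to `s'` and sends `o`, following the protocol. The state is `none`
before the party has started. A party that has decided has terminated: it ignores all messages,
its alarm is off and it sends nothing any more. -/
inductive LocalStep {n : ℕ} {V : Type u} (P : Protocol n V) (i : Fin n) (x : V) (now : ℝ) :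
    Event n P.Msg → Option P.State → Option P.State → Outbox n P.Msg → Prop
  | start {s' : P.State} {o : Outbox n P.Msg} (h : (s', o) ∈ P.start i x now) :
      LocalStep P i x now (.start i) none (some s') o
  | recv {j : Fin n} {m : P.Msg} {s s' : P.State} {o : Outbox n P.Msg}
      (hs : P.decision s = none) (h : (s', o) ∈ P.receive i now j m s) :
      LocalStep P i x now (.recv i j m) (some s) (some s') o
  | timeout {s s' : P.State} {o : Outbox n P.Msg} {d : ℝ}
      (hs : P.decision s = none) (hd : P.deadline s = some d) (hnow : d ≤ now)
      (h : (s', o) ∈ P.timeout i now s) :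
      LocalStep P i x now (.timeout i) (some s) (some s') o
  | terminated {j : Fin n} {m : P.Msg} {s : P.State} (hs : P.decision s ≠ none) :
      LocalStep P i x now (.recv i j m) (some s) (some s) (fun _ => [])
  | other {e : Event n P.Msg} {s : Option P.State} (he : e.party ≠ some i) :
      LocalStep P i x now e s s (fun _ => [])

/-- An execution of `P` in the partially synchronous model with message delay bound `Δ`, in which
the parties outside `faulty` follow the protocol with the given inputs, while the parties in
`faulty` behave arbitrarily. Steps are indexed by `ℕ`; step `k` happens at real time `time k` and
leads from `state k` to `state (k + 1)`. Message delays, the order of events, `GST`, the clocks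
before `GST` and all messages of faulty parties are arbitrary, and may depend on everything. -/
structure Execution {n : ℕ} {V : Type u} (P : Protocol n V) (faulty : Finset (Fin n)) (Δ : ℝ)
    (input : Fin n → V) where
  /-- the global stabilization time -/
  GST : ℝ
  /-- `clock i t` is the reading of the local clock of party `i` at real time `t` -/
  clock : Fin n → ℝ → ℝ
  time : ℕ → ℝ
  event : ℕ → Event n P.Msg
  state : ℕ → Fin n → Option P.State
  /-- `sent k i j`: the messages that party `i` sends to party `j` in step `k` -/
  sent : ℕ → Fin n → Outbox n P.Msg
  /-- From `GST` on the clocks run in step with real time. (They are arbitrary before; that they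
  show the same reading afterwards is not needed.) -/
  clock_sync : ∀ i s t, GST ≤ s → s ≤ t → clock i t - clock i s = t - s
  time_mono : Monotone time
  /-- only finitely many steps happen in bounded time -/
  time_unbounded : ∀ T : ℝ, ∃ k, T < time k
  state_zero : ∀ i, i ∉ faulty → state 0 i = none
  /-- nonfaulty parties follow the protocol -/
  step : ∀ k i, i ∉ faulty → LocalStep P i (input i) (clock i (time k)) (event k)
    (state k i) (state (k + 1) i) (sent k i)
  /-- all nonfaulty parties participate -/
  starts : ∀ i, i ∉ faulty → ∃ k, event k = .start i ∧ time k ≤ GST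
  /-- channels are authenticated: what arrives in the name of a nonfaulty party was sent by it -/
  authentic : ∀ k i j m, i ∉ faulty → j ∉ faulty → event k = .recv i j m →
    ∃ k' < k, m ∈ sent k' j i
  /-- every message between nonfaulty parties arrives, no later than `Δ` after both its sending
  and `GST` -/
  delivery : ∀ k i j m, i ∉ faulty → j ∉ faulty → m ∈ sent k i j →
    ∃ k' > k, event k' = .recv j i m ∧ time k' ≤ max (time k) GST + Δ
  /-- alarms are never overdue: time does not pass a moment at which the local clock has reached
  the deadline of a pending alarm without the alarm going off -/
  punctual : ∀ k i s d, i ∉ faulty → state (k + 1) i = some s → P.decision s = none →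
    P.deadline s = some d → ∀ t, time k ≤ t → t < time (k + 1) → clock i t < d

namespace Execution

variable {n : ℕ} {V : Type u} {P : Protocol n V} {faulty : Finset (Fin n)} {Δ : ℝ}
  {input : Fin n → V}

/-- Party `i` decides on `v` (and terminates) at some point of the execution. -/
def Decides (E : Execution P faulty Δ input) (i : Fin n) (v : V) : Prop :=
  ∃ k s, E.state k i = some s ∧ P.decision s = some v

/-- All nonfaulty parties eventually decide on a value and terminate. -/
def Termination (E : Execution P faulty Δ input) : Prop :=
  ∀ i, i ∉ faulty → ∃ v, E.Decides i v

/-- No two nonfaulty parties decide on different values. -/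
def Correctness (E : Execution P faulty Δ input) : Prop :=
  ∀ i j v w, i ∉ faulty → j ∉ faulty → E.Decides i v → E.Decides j w → v = w

/-- If all parties are nonfaulty and have the same input, no other value is decided on. -/
def Validity (E : Execution P faulty Δ input) : Prop :=
  faulty = ∅ → ∀ v, (∀ i, input i = v) → ∀ i w, E.Decides i w → w = v

end Execution

/-- `P` is a Byzantine Agreement protocol in partial synchrony with delay bound `Δ`, resilient to
`f` Byzantine parties. -/
def IsByzantineAgreement {n : ℕ} {V : Type u} (P : Protocol n V) (f : ℕ) (Δ : ℝ) : Prop :=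
  ∀ faulty : Finset (Fin n), faulty.card ≤ f → ∀ input : Fin n → V,
    ∀ E : Execution P faulty Δ input, E.Termination ∧ E.Correctness ∧ E.Validity

end PartialSync

/-! ### The protocol IT-HS -/

namespace ITHS

open PartialSync

/-- The five all-to-all voting rounds of a view. -/
inductive Phase : Type
  | echo | key1 | key2 | key3 | lock
  deriving DecidableEq

/-- A triple `(key, val, prev)` such as `(key1, key1_val, prev_key1)`: the last view in which the
key was set, its value, and the last view in which it was set to a different value. -/
structure KeyRecord (V : Type u) : Type u where
  key : ℤ
  val : V
  prev : ℤ

/-- Set the key to `v` in view `view`. -/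
def KeyRecord.set {V : Type u} [DecidableEq V] (r : KeyRecord V) (view : ℕ) (v : V) :
    KeyRecord V :=
  if r.val ≠ v then ⟨view, v, r.key⟩ else ⟨view, r.val, r.prev⟩

inductive Msg (V : Type u) : Type u
  | request (view : ℕ)
  | suggest (k3 : ℤ) (v3 : V) (key2 : KeyRecord V) (view : ℕ)
  | proof (key1 : KeyRecord V) (view : ℕ)
  | propose (key : ℤ) (val : V) (view : ℕ)
  | vote (ph : Phase) (val : V) (view : ℕ)
  | done (val : V)
  | abort (view : ℕ)

structure State (n : ℕ) (V : Type u) : Type u where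
  lock : ℤ
  lockVal : V
  key3 : ℤ
  key3Val : V
  key2 : KeyRecord V
  key1 : KeyRecord V
  view : ℕ
  highestRequest : Fin n → ℕ
  highestAbort : Fin n → ℕ
  /-- the parties from which `done` has been received with a given value -/
  doneFrom : V → Finset (Fin n)
  /-- whether a `done` message has been sent -/
  doneSent : Bool
  decided : Option V
  /-- local clock reading at which the view times out; `none` once it has done so -/
  timer : Option ℝ
  /-- messages for which `sendAllUponJoin` has been called (this and the remaining fields concern
  the current view only and are reset when a view starts) -/
  joinMsgs : List (Msg V)
  /-- the first `suggest` message received from each party: `(k3, v3)` and the `key2` record -/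
  suggestFrom : Fin n → Option ((ℤ × V) × KeyRecord V)
  /-- whether a `propose` message has been sent -/
  proposed : Bool
  /-- the first `proof` message received from each party -/
  proofFrom : Fin n → Option (KeyRecord V)
  /-- whether a `propose` message has been received from the primary -/
  proposalSeen : Bool
  /-- a proposed value that is waiting for the lock to be opened, together with the lock
  `(lock, lock_val)` that the party held when it processed the proposal -/
  pending : Option (V × ℤ × V)
  /-- the parties from which a vote of the given phase and value has been received -/
  voteFrom : Phase → V → Finset (Fin n)

/-- The primary of a view; parties are numbered from `0`. -/
def IsPrimary {n : ℕ} (j : Fin n) (view : ℕ) : Prop := (j : ℕ) = view % n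

instance {n : ℕ} (j : Fin n) (view : ℕ) : Decidable (IsPrimary j view) :=
  inferInstanceAs (Decidable ((j : ℕ) = view % n))

/-- The `k`-th largest entry of an array, counted with multiplicity (`1 ≤ k ≤ n`). -/
def kthLargest {n : ℕ} (k : ℕ) (a : Fin n → ℕ) : ℕ :=
  (Finset.univ.filter fun j => k ≤ (Finset.univ.filter fun l => a j ≤ a l).card).sup a

/-- `accept_key`, where `proofs` holds at most one triple per party. -/
def acceptKey {n : ℕ} {V : Type u} [DecidableEq V] (f : ℕ) (key : ℤ) (value : V)
    (proofs : Fin n → Option (KeyRecord V)) : Prop :=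
  f + 1 ≤ (Finset.univ.filter fun j =>
    ∃ r ∈ proofs j, key ≤ r.prev ∨ (key ≤ r.key ∧ value = r.val)).card

instance {n : ℕ} {V : Type u} [DecidableEq V] (f : ℕ) (key : ℤ) (value : V)
    (proofs : Fin n → Option (KeyRecord V)) : Decidable (acceptKey f key value proofs) :=
  inferInstanceAs (Decidable (_ ≤ _))

/-- `open_lock`, where `proofs` holds at most one triple per party. -/
def openLock {n : ℕ} {V : Type u} [DecidableEq V] (f : ℕ) (lock : ℤ) (lockVal : V)
    (proofs : Fin n → Option (KeyRecord V)) : Prop :=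
  f + 1 ≤ (Finset.univ.filter fun j =>
    ∃ r ∈ proofs j, lock ≤ r.prev ∨ (lock ≤ r.key ∧ r.val ≠ lockVal)).card

instance {n : ℕ} {V : Type u} [DecidableEq V] (f : ℕ) (lock : ℤ) (lockVal : V)
    (proofs : Fin n → Option (KeyRecord V)) : Decidable (openLock f lock lockVal proofs) :=
  inferInstanceAs (Decidable (_ ≤ _))

section

variable {n : ℕ} {V : Type u}

/-- Send a message to every party (the sender included). -/
def sendAll (m : Msg V) : Outbox n (Msg V) := fun _ => [m]

def sendNone : Outbox n (Msg V) := fun _ => []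

/-- `send_all_upon_join`: send `m` now to the parties known to have joined the view; it is sent to
each other party as soon as that party's `request` arrives (see `onRequest`). -/
def sendAllUponJoin (m : Msg V) (s : State n V) : State n V × Outbox n (Msg V) :=
  ({ s with joinMsgs := s.joinMsgs ++ [m] },
    fun j => if s.highestRequest j = s.view then [m] else [])

/-- The `suggest` message of a party in its current state. -/
def suggestMsg (s : State n V) : Msg V := .suggest s.key3 s.key3Val s.key2 s.view

/-- Start view `v`: free the memory of the previous view, set the alarm `11 Δ` ahead, send
`request` to all, send `proof` (with the current `key1` fields) upon join, and send `suggest` to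
the primary if it is known to have joined. -/
noncomputable def enterView (Δ now : ℝ) (v : ℕ) (s : State n V) : State n V × Outbox n (Msg V) :=
  let s₁ : State n V := { s with
    view := v, timer := some (now + 11 * Δ), joinMsgs := [], suggestFrom := fun _ => none,
    proposed := false, proofFrom := fun _ => none, proposalSeen := false, pending := none,
    voteFrom := fun _ _ => ∅ }
  let r := sendAllUponJoin (.proof s₁.key1 v) s₁
  (r.1, fun j => .request v ::
    ((if s₁.highestRequest j = v ∧ IsPrimary j v then [suggestMsg s₁] else []) ++ r.2 j))

/-- Initial state (with input `x`), before the first view, which is view `1`, is entered. -/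
def initState (x : V) : State n V where
  lock := 0
  lockVal := x
  key3 := 0
  key3Val := x
  key2 := ⟨0, x, -1⟩
  key1 := ⟨0, x, -1⟩
  view := 1
  highestRequest := fun _ => 0
  highestAbort := fun _ => 0
  doneFrom := fun _ => ∅
  doneSent := false
  decided := none
  timer := none
  joinMsgs := []
  suggestFrom := fun _ => none
  proposed := false
  proofFrom := fun _ => none
  proposalSeen := false
  pending := none
  voteFrom := fun _ _ => ∅

/-- A `request` message for view `v` from `j`. If it shows that `j` has joined the current view,
the messages waiting for that are sent to `j`, and `suggest` is sent if `j` is the primary. -/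
def onRequest (j : Fin n) (v : ℕ) (s : State n V) : State n V × Outbox n (Msg V) :=
  if s.highestRequest j < v then
    ({ s with highestRequest := Function.update s.highestRequest j v },
      fun l => if l = j ∧ v = s.view then
          (if IsPrimary j v then [suggestMsg s] else []) ++ s.joinMsgs
        else [])
  else (s, sendNone)

/-- An `abort` message for view `v` from `j`, received by `i`. -/
noncomputable def onAbort (f : ℕ) (Δ now : ℝ) (i j : Fin n) (v : ℕ) (s : State n V) :
    State n V × Outbox n (Msg V) :=
  if s.highestAbort j < v then
    let a₁ := Function.update s.highestAbort j v
    let u := kthLargest (f + 1) a₁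
    let a₂ := if a₁ i < u then Function.update a₁ i u else a₁
    let o₂ : Outbox n (Msg V) := if a₁ i < u then sendAll (.abort u) else sendNone
    let s₂ : State n V := { s with highestAbort := a₂ }
    let w := kthLargest (n - f) a₂
    if s.view ≤ w then
      let r := enterView Δ now (w + 1) s₂
      (r.1, fun l => o₂ l ++ r.2 l)
    else (s₂, o₂)
  else (s, sendNone)

variable [DecidableEq V]

/-- Send `done` for `val` to all parties unless a `done` message has been sent before. -/
def sendDone (val : V) (s : State n V) : State n V × Outbox n (Msg V) :=
  if s.doneSent then (s, sendNone) else ({ s with doneSent := true }, sendAll (.done val))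

/-- A `done` message from `j`: echo it at `f + 1` such messages, decide at `n - f`. -/
def onDone (f : ℕ) (j : Fin n) (val : V) (s : State n V) : State n V × Outbox n (Msg V) :=
  if j ∈ s.doneFrom val then (s, sendNone)
  else
    let d := insert j (s.doneFrom val)
    let s₁ : State n V := { s with doneFrom := Function.update s.doneFrom val d }
    let r := if d.card = f + 1 then sendDone val s₁ else (s₁, sendNone)
    (if d.card = n - f then { r.1 with decided := some val } else r.1, r.2)

/-- The set `key2_proofs` of a primary. -/
def key2Proofs (s : State n V) (j : Fin n) : Option (KeyRecord V) :=
  match s.suggestFrom j with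
  | some (_, r) => if r.prev < r.key ∧ r.key < s.view then some r else none
  | none => none

/-- The multiset `suggestions` of a primary, indexed by the parties that made them. -/
def suggestions (f : ℕ) (s : State n V) (j : Fin n) : Option (ℤ × V) :=
  match s.suggestFrom j with
  | some ((k, v), _) =>
    if k = 0 ∨ (k < s.view ∧ acceptKey f k v (key2Proofs s)) then some (k, v) else none
  | none => none

/-- A rule that picks some suggestion whose key is maximal. -/
def IsPick (pick : (Fin n → Option (ℤ × V)) → ℤ × V) : Prop :=
  ∀ S : Fin n → Option (ℤ × V), (∃ j, S j ≠ none) →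
    (∃ j, S j = some (pick S)) ∧ ∀ j kv, S j = some kv → kv.1 ≤ (pick S).1

/-- A `suggest` message from `j` in the current view; only the primary reacts, and only to the
first one from `j`. -/
def onSuggest (f : ℕ) (pick : (Fin n → Option (ℤ × V)) → ℤ × V) (i j : Fin n) (k3 : ℤ) (v3 : V)
    (r : KeyRecord V) (s : State n V) : State n V × Outbox n (Msg V) :=
  if IsPrimary i s.view ∧ s.suggestFrom j = none then
    let s₁ : State n V :=
      { s with suggestFrom := Function.update s.suggestFrom j (some ((k3, v3), r)) }
    let S := suggestions f s₁
    if s₁.proposed = false ∧ n - f ≤ (Finset.univ.filter fun l => (S l).isSome).card then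
      sendAllUponJoin (.propose (pick S).1 (pick S).2 s.view) { s₁ with proposed := true }
    else (s₁, sendNone)
  else (s, sendNone)

/-- The set `proofs` of a party. -/
def proofs (s : State n V) (j : Fin n) : Option (KeyRecord V) :=
  match s.proofFrom j with
  | some r => if r.prev < r.key ∧ r.key < s.view then some r else none
  | none => none

/-- Echo the pending proposal if the lock can be opened. -/
def tryOpen (f : ℕ) (s : State n V) : State n V × Outbox n (Msg V) :=
  match s.pending with
  | some (val, lock, lockVal) =>
    if openLock f lock lockVal (proofs s) then
      sendAllUponJoin (.vote .echo val s.view) { s with pending := none }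
    else (s, sendNone)
  | none => (s, sendNone)

/-- A `proof` message from `j` in the current view; only the first one from `j` counts. -/
def onProof (f : ℕ) (j : Fin n) (r : KeyRecord V) (s : State n V) :
    State n V × Outbox n (Msg V) :=
  if s.proofFrom j = none then
    tryOpen f { s with proofFrom := Function.update s.proofFrom j (some r) }
  else (s, sendNone)

/-- A `propose` message from `j` in the current view; only the first one from the primary
counts. -/
def onPropose (f : ℕ) (j : Fin n) (key : ℤ) (val : V) (s : State n V) :
    State n V × Outbox n (Msg V) :=
  if IsPrimary j s.view ∧ s.proposalSeen = false then
    let s₁ : State n V := { s with proposalSeen := true }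
    if s.lock = 0 ∨ val = s.lockVal then sendAllUponJoin (.vote .echo val s.view) s₁
    else if s.lock ≤ key ∧ key < s.view then
      tryOpen f { s₁ with pending := some (val, s.lock, s.lockVal) }
    else (s₁, sendNone)
  else (s, sendNone)

/-- What a party does upon `n - f` votes of a phase for the same value in the current view. -/
def onQuorum (ph : Phase) (val : V) (s : State n V) : State n V × Outbox n (Msg V) :=
  match ph with
  | .echo => sendAllUponJoin (.vote .key1 val s.view) { s with key1 := s.key1.set s.view val }
  | .key1 => sendAllUponJoin (.vote .key2 val s.view) { s with key2 := s.key2.set s.view val }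
  | .key2 => sendAllUponJoin (.vote .key3 val s.view) { s with key3 := s.view, key3Val := val }
  | .key3 => sendAllUponJoin (.vote .lock val s.view) { s with lock := s.view, lockVal := val }
  | .lock => sendDone val s

/-- An `echo`, `key1`, `key2`, `key3` or `lock` message from `j` in the current view. -/
def onVote (f : ℕ) (j : Fin n) (ph : Phase) (val : V) (s : State n V) :
    State n V × Outbox n (Msg V) :=
  if j ∈ s.voteFrom ph val then (s, sendNone)
  else
    let d := insert j (s.voteFrom ph val)
    let s₁ : State n V := { s with
      voteFrom := Function.update s.voteFrom ph (Function.update (s.voteFrom ph) val d) }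
    if d.card = n - f then onQuorum ph val s₁ else (s₁, sendNone)

/-- Party `i` in state `s` receives `m` from `j`. Messages that belong to a view other than the
current one are ignored, except `request`, `abort` and `done`. -/
noncomputable def onReceive (f : ℕ) (Δ : ℝ) (pick : (Fin n → Option (ℤ × V)) → ℤ × V) (i : Fin n)
    (now : ℝ) (j : Fin n) (m : Msg V) (s : State n V) : State n V × Outbox n (Msg V) :=
  match m with
  | .request v => onRequest j v s
  | .abort v => onAbort f Δ now i j v s
  | .done val => onDone f j val s
  | .suggest k3 v3 r v => if v = s.view then onSuggest f pick i j k3 v3 r s else (s, sendNone)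
  | .proof r v => if v = s.view then onProof f j r s else (s, sendNone)
  | .propose key val v => if v = s.view then onPropose f j key val s else (s, sendNone)
  | .vote ph val v => if v = s.view then onVote f j ph val s else (s, sendNone)

end

/-- The protocol IT-HS for `n` parties, with resilience parameter `f` and delay bound `Δ`. -/
noncomputable def protocol (n f : ℕ) (Δ : ℝ) (V : Type u) [DecidableEq V] : Protocol n V where
  State := State n V
  Msg := Msg V
  start := fun _ x now => {enterView Δ now 1 (initState x)}
  receive := fun i now j m s => {r | ∃ pick, IsPick pick ∧ r = onReceive f Δ pick i now j m s}
  deadline := fun s => s.timer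
  timeout := fun _ _ s => {({ s with timer := none }, sendAll (.abort s.view))}
  decision := fun s => s.decided

end ITHS

/-!
Any two sets of `n - f` parties share a nonfaulty party, so each phase of a view carries at most
one value, and the values carried by successive phases agree.

*Agreement.* A first nonfaulty `done` for `val` rests on `n - f` `lock` messages of one view
`v`, so at least `f + 1` nonfaulty parties were locked on `val` in view `v`. By induction on
time these never echo another value in a later view: opening a lock takes proofs of `f + 1`
parties, hence one of a nonfaulty party showing a `key1` for another value in some view `≥ v`,
and `key1` takes `n - f` echoes, among them one of a locked party.

*Termination.* As `f + 1` aborts are repeated by every nonfaulty party and `n - f` aborts end a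
view, the parties move through the views together. After stabilization, consider a view whose
primary is nonfaulty and hears all nonfaulty parties. If a party is locked, then `f + 1` nonfaulty
parties have set `key3` in the view of the lock or later, and one of them is among the `n - f`
suggestions; so the proposed key is at least every nonfaulty lock. If the proposed value differs
from a locked one, a nonfaulty `key2` behind the proposal rests on `key1` messages, in a view no
earlier than the lock, of `f + 1` nonfaulty parties, whose proofs open the lock. All rounds then
finish within `11 Δ`, so every nonfaulty party sends `done`.

*Validity.* If all parties are nonfaulty and have the same input, no other value ever occurs.
-/

/-! ### Executions -/

namespace PartialSync.Execution

variable {n : ℕ} {V : Type*} {P : Protocol n V} {faulty : Finset (Fin n)} {Δ : ℝ}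
  {input : Fin n → V} (E : Execution P faulty Δ input)

/-- Before step `k`, party `i` has received `m` from `j`. -/
def Received (k : ℕ) (i j : Fin n) (m : P.Msg) : Prop := ∃ l < k, E.event l = .recv i j m

/-- Before step `k`, party `i` has sent `m` to `j`. -/
def Sent (k : ℕ) (i j : Fin n) (m : P.Msg) : Prop := ∃ l < k, m ∈ E.sent l i j

/-- The number of steps taken up to time `T`. -/
noncomputable def upTo (T : ℝ) : ℕ := Nat.find (E.time_unbounded T)

variable {E}

theorem Received.mono {k k' : ℕ} {i j : Fin n} {m : P.Msg} (h : E.Received k i j m)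
    (hk : k ≤ k') : E.Received k' i j m :=
  let ⟨l, hl, h⟩ := h
  ⟨l, hl.trans_le hk, h⟩

theorem Sent.mono {k k' : ℕ} {i j : Fin n} {m : P.Msg} (h : E.Sent k i j m) (hk : k ≤ k') :
    E.Sent k' i j m :=
  let ⟨l, hl, h⟩ := h
  ⟨l, hl.trans_le hk, h⟩

theorem Received.exists_sent_lt {k : ℕ} {i j : Fin n} {m : P.Msg} (hi : i ∉ faulty)
    (hj : j ∉ faulty) (h : E.Received k i j m) : ∃ l < k, E.Sent l j i m := by
  obtain ⟨l, hl, h⟩ := h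
  obtain ⟨l', hl', h⟩ := E.authentic l i j m hi hj h
  exact ⟨l, hl, l', hl', h⟩

variable (E)

theorem lt_upTo {k : ℕ} {T : ℝ} : k < E.upTo T ↔ E.time k ≤ T := by
  refine ⟨fun h => not_lt.1 (Nat.find_min (E.time_unbounded T) h), fun h => ?_⟩
  by_contra hk
  exact (Nat.find_spec (E.time_unbounded T)).not_ge ((E.time_mono (not_lt.1 hk)).trans h)

theorem upTo_mono {T T' : ℝ} (h : T ≤ T') : E.upTo T ≤ E.upTo T' := by
  by_contra! hlt
  exact lt_irrefl _ (E.lt_upTo.2 ((E.lt_upTo.1 hlt).trans h))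

theorem exists_le_upTo (k : ℕ) : ∃ T, E.GST ≤ T ∧ k ≤ E.upTo T :=
  ⟨max (E.time k) E.GST, le_max_right _ _, (E.lt_upTo.2 (le_max_left _ _)).le⟩

theorem exists_event_recv {i j : Fin n} (hi : i ∉ faulty) (hj : j ∉ faulty) {k : ℕ} {m : P.Msg}
    {T : ℝ} (hk : k < E.upTo T) (hT : E.GST ≤ T) (h : m ∈ E.sent k i j) :
    ∃ l > k, l < E.upTo (T + Δ) ∧ E.event l = .recv j i m := by
  obtain ⟨l, hl, he, ht⟩ := E.delivery k i j m hi hj h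
  have := max_le (E.lt_upTo.1 hk) hT
  exact ⟨l, hl, E.lt_upTo.2 (by linarith), he⟩

end PartialSync.Execution

namespace ITHS

open PartialSync

/-! ### The transition relation of IT-HS -/

section kthLargest

variable {n : ℕ}

theorem le_kthLargest_iff {k : ℕ} (hk : 1 ≤ k) (hkn : k ≤ n) (a : Fin n → ℕ) (x : ℕ) :
    x ≤ kthLargest k a ↔ k ≤ (Finset.univ.filter fun l => x ≤ a l).card := by
  constructor
  · intro h
    rcases Nat.eq_zero_or_pos x with rfl | hx
    · simpa using hkn
    · obtain ⟨j, hj, hxj⟩ := (Finset.le_sup_iff (by simpa using hx)).1 h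
      exact (Finset.mem_filter.1 hj).2.trans
        (Finset.card_le_card (Finset.monotone_filter_right _ fun l _ hl => hxj.trans hl))
  · intro h
    obtain ⟨j, hj, hmin⟩ := Finset.exists_min_image (Finset.univ.filter fun l => x ≤ a l) a
      (Finset.card_pos.1 (by omega))
    refine (Finset.mem_filter.1 hj).2.trans (Finset.le_sup (f := a) ?_)
    refine Finset.mem_filter.2 ⟨Finset.mem_univ j, h.trans (Finset.card_le_card fun l hl => ?_)⟩
    exact Finset.mem_filter.2 ⟨Finset.mem_univ l, hmin l hl⟩

end kthLargest

section Transition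

variable {n : ℕ} {V : Type*}

/-- `AbortUpdate f i j v a a' o`: when `i` receives `abort v` from `j`, its array of highest aborts
changes from `a` to `a'` and the `abort` messages `o` are sent. -/
inductive AbortUpdate (f : ℕ) (i j : Fin n) (v : ℕ) (a : Fin n → ℕ) :
    (Fin n → ℕ) → Outbox n (Msg V) → Prop
  | keep (h : kthLargest (f + 1) (Function.update a j v) ≤ Function.update a j v i) :
      AbortUpdate f i j v a (Function.update a j v) sendNone
  | raise (u : ℕ) (hu : u = kthLargest (f + 1) (Function.update a j v))
      (h : Function.update a j v i < u) :
      AbortUpdate f i j v a (Function.update (Function.update a j v) i u) (sendAll (.abort u))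

theorem AbortUpdate.le {f : ℕ} {i j : Fin n} {v : ℕ} {a a' : Fin n → ℕ} {o : Outbox n (Msg V)}
    (h : AbortUpdate f i j v a a' o) (hv : a j < v) : a ≤ a' := by
  have hle : a ≤ Function.update a j v := le_update_self_iff.2 hv.le
  cases h with
  | keep => exact hle
  | raise u hu h => exact hle.trans (le_update_self_iff.2 h.le)

theorem AbortUpdate.le_self {f : ℕ} (hf : f < n) {i j : Fin n} {v : ℕ} {a a' : Fin n → ℕ}
    {o : Outbox n (Msg V)} (h : AbortUpdate f i j v a a' o) {x : ℕ}
    (hx : f + 1 ≤ (Finset.univ.filter fun l => x ≤ a' l).card) : x ≤ a' i := by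
  cases h with
  | keep h => exact ((le_kthLargest_iff (by omega) hf _ _).2 hx).trans h
  | raise u hu h =>
    rw [Function.update_self]
    by_contra hxu
    refine hxu (hu ▸ (le_kthLargest_iff (by omega) hf _ _).2 (hx.trans ?_))
    refine Finset.card_le_card fun l hl => ?_
    simp only [Finset.mem_filter, Finset.mem_univ, true_and] at hl ⊢
    rw [Function.update_apply] at hl
    split_ifs at hl
    · omega
    · exact hl

/-- The state `s` with `x` recorded as the first `suggest` message from `j`. -/
abbrev State.recordSuggest (s : State n V) (j : Fin n) (x : (ℤ × V) × KeyRecord V) : State n V :=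
  { s with suggestFrom := Function.update s.suggestFrom j (some x) }

/-- The state `s` with `r` recorded as the first `proof` message from `j`. -/
abbrev State.recordProof (s : State n V) (j : Fin n) (r : KeyRecord V) : State n V :=
  { s with proofFrom := Function.update s.proofFrom j (some r) }

/-- The outbox that sends `m` to all parties known to have joined the view of `s`. -/
def sendJoined (s : State n V) (m : Msg V) : Outbox n (Msg V) :=
  fun l => if s.highestRequest l = s.view then [m] else []

/-- The message `m` from `j` has no effect on party `i` in state `s`. -/
def Stale (i j : Fin n) (s : State n V) : Msg V → Prop
  | .request v => v ≤ s.highestRequest j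
  | .abort v => v ≤ s.highestAbort j
  | .done val => j ∈ s.doneFrom val
  | .suggest _ _ _ v => v = s.view → IsPrimary i s.view → s.suggestFrom j ≠ none
  | .proof _ v => v = s.view → s.proofFrom j ≠ none
  | .propose _ _ v => v = s.view → IsPrimary j s.view → s.proposalSeen = true
  | .vote ph val v => v = s.view → j ∈ s.voteFrom ph val

variable [DecidableEq V]

/-- The record of votes after a vote of phase `ph` for `val` from `j`. -/
def addVote (s : State n V) (ph : Phase) (val : V) (j : Fin n) : Phase → V → Finset (Fin n) :=
  Function.update s.voteFrom ph
    (Function.update (s.voteFrom ph) val (insert j (s.voteFrom ph val)))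

/-- `Transition f Δ now i s e s' o`: in event `e`, the running party `i` with local clock reading
`now` moves from `s` to `s'` and sends `o`. This is `LocalStep` for IT-HS with one constructor for
each branch of the code. -/
inductive Transition (f : ℕ) (Δ now : ℝ) (i : Fin n) (s : State n V) :
    Event n (Msg V) → State n V → Outbox n (Msg V) → Prop
  | idle {e : Event n (Msg V)}
      (h : s.decided = none → ∀ j m, e = .recv i j m → Stale i j s m) :
      Transition f Δ now i s e s sendNone
  | timeout {d : ℝ} (hd : s.timer = some d) (hnow : d ≤ now) :
      Transition f Δ now i s (.timeout i) { s with timer := none } (sendAll (.abort s.view))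
  | request {j : Fin n} {v : ℕ} (h : s.highestRequest j < v) :
      Transition f Δ now i s (.recv i j (.request v))
        { s with highestRequest := Function.update s.highestRequest j v }
        (fun l => if l = j ∧ v = s.view then
          (if IsPrimary j v then [suggestMsg s] else []) ++ s.joinMsgs else [])
  | abortStay {j : Fin n} {v : ℕ} {a : Fin n → ℕ} {o : Outbox n (Msg V)}
      (h : s.highestAbort j < v) (ha : AbortUpdate f i j v s.highestAbort a o)
      (hw : kthLargest (n - f) a < s.view) :
      Transition f Δ now i s (.recv i j (.abort v)) { s with highestAbort := a } o
  | abortEnter {j : Fin n} {v : ℕ} {a : Fin n → ℕ} {o : Outbox n (Msg V)}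
      (h : s.highestAbort j < v) (ha : AbortUpdate f i j v s.highestAbort a o)
      (hw : s.view ≤ kthLargest (n - f) a) :
      Transition f Δ now i s (.recv i j (.abort v))
        (enterView Δ now (kthLargest (n - f) a + 1) { s with highestAbort := a }).1
        (fun l => o l ++
          (enterView Δ now (kthLargest (n - f) a + 1) { s with highestAbort := a }).2 l)
  | done {j : Fin n} {val : V} {d : Finset (Fin n)} {b : Bool} {o : Outbox n (Msg V)}
      (h : j ∉ s.doneFrom val) (hd : d = insert j (s.doneFrom val))
      (ho : (d.card = f + 1 ∧ s.doneSent = false ∧ b = true ∧ o = sendAll (.done val)) ∨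
        ((d.card = f + 1 → s.doneSent = true) ∧ b = s.doneSent ∧ o = sendNone)) :
      Transition f Δ now i s (.recv i j (.done val))
        { s with
          doneFrom := Function.update s.doneFrom val d, doneSent := b,
          decided := if d.card = n - f then some val else s.decided } o
  | suggest {j : Fin n} {k3 : ℤ} {v3 : V} {r : KeyRecord V}
      (hi : IsPrimary i s.view) (h : s.suggestFrom j = none)
      (hq : s.proposed = false → (Finset.univ.filter fun l =>
        (suggestions f (s.recordSuggest j ((k3, v3), r)) l).isSome).card < n - f) :
      Transition f Δ now i s (.recv i j (.suggest k3 v3 r s.view))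
        (s.recordSuggest j ((k3, v3), r)) sendNone
  | propose {j : Fin n} {k3 : ℤ} {v3 : V} {r : KeyRecord V} {key : ℤ} {val : V}
      (hi : IsPrimary i s.view) (h : s.suggestFrom j = none) (hp : s.proposed = false)
      (hq : n - f ≤ (Finset.univ.filter fun l =>
        (suggestions f (s.recordSuggest j ((k3, v3), r)) l).isSome).card)
      (hpick : ∃ l, suggestions f (s.recordSuggest j ((k3, v3), r)) l = some (key, val))
      (hmax : ∀ l kv, suggestions f (s.recordSuggest j ((k3, v3), r)) l = some kv →
        kv.1 ≤ key) :
      Transition f Δ now i s (.recv i j (.suggest k3 v3 r s.view))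
        { s.recordSuggest j ((k3, v3), r) with
          proposed := true, joinMsgs := s.joinMsgs ++ [.propose key val s.view] }
        (sendJoined s (.propose key val s.view))
  | proof {j : Fin n} {r : KeyRecord V} (h : s.proofFrom j = none)
      (hq : ∀ val l lv, s.pending = some (val, l, lv) →
        ¬ openLock f l lv (proofs (s.recordProof j r))) :
      Transition f Δ now i s (.recv i j (.proof r s.view)) (s.recordProof j r) sendNone
  | proofOpen {j : Fin n} {r : KeyRecord V} {val : V} {l : ℤ} {lv : V}
      (h : s.proofFrom j = none) (hp : s.pending = some (val, l, lv))
      (hq : openLock f l lv (proofs (s.recordProof j r))) :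
      Transition f Δ now i s (.recv i j (.proof r s.view))
        { s.recordProof j r with
          pending := none, joinMsgs := s.joinMsgs ++ [.vote .echo val s.view] }
        (sendJoined s (.vote .echo val s.view))
  | proposeEcho {j : Fin n} {key : ℤ} {val : V} (hj : IsPrimary j s.view)
      (h : s.proposalSeen = false) (hl : s.lock = 0 ∨ val = s.lockVal) :
      Transition f Δ now i s (.recv i j (.propose key val s.view))
        { s with
          proposalSeen := true, joinMsgs := s.joinMsgs ++ [.vote .echo val s.view] }
        (sendJoined s (.vote .echo val s.view))
  | proposeOpen {j : Fin n} {key : ℤ} {val : V} (hj : IsPrimary j s.view)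
      (h : s.proposalSeen = false) (hl : s.lock ≠ 0) (hv : val ≠ s.lockVal) (hk : s.lock ≤ key)
      (hk' : key < s.view) (hq : openLock f s.lock s.lockVal (proofs s)) :
      Transition f Δ now i s (.recv i j (.propose key val s.view))
        { s with
          proposalSeen := true, pending := none,
          joinMsgs := s.joinMsgs ++ [.vote .echo val s.view] }
        (sendJoined s (.vote .echo val s.view))
  | proposeWait {j : Fin n} {key : ℤ} {val : V} (hj : IsPrimary j s.view)
      (h : s.proposalSeen = false) (hl : s.lock ≠ 0) (hv : val ≠ s.lockVal) (hk : s.lock ≤ key)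
      (hk' : key < s.view) (hq : ¬ openLock f s.lock s.lockVal (proofs s)) :
      Transition f Δ now i s (.recv i j (.propose key val s.view))
        { s with proposalSeen := true, pending := some (val, s.lock, s.lockVal) } sendNone
  | proposeReject {j : Fin n} {key : ℤ} {val : V} (hj : IsPrimary j s.view)
      (h : s.proposalSeen = false) (hl : s.lock ≠ 0) (hv : val ≠ s.lockVal)
      (hk : ¬ (s.lock ≤ key ∧ key < s.view)) :
      Transition f Δ now i s (.recv i j (.propose key val s.view))
        { s with proposalSeen := true } sendNone
  | vote {j : Fin n} {ph : Phase} {val : V} (h : j ∉ s.voteFrom ph val)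
      (hc : (insert j (s.voteFrom ph val)).card ≠ n - f) :
      Transition f Δ now i s (.recv i j (.vote ph val s.view))
        { s with voteFrom := addVote s ph val j } sendNone
  | quorumEcho {j : Fin n} {val : V} (h : j ∉ s.voteFrom .echo val)
      (hc : (insert j (s.voteFrom .echo val)).card = n - f) :
      Transition f Δ now i s (.recv i j (.vote .echo val s.view))
        { s with
          voteFrom := addVote s .echo val j, key1 := s.key1.set s.view val,
          joinMsgs := s.joinMsgs ++ [.vote .key1 val s.view] }
        (sendJoined s (.vote .key1 val s.view))
  | quorumKey1 {j : Fin n} {val : V} (h : j ∉ s.voteFrom .key1 val)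
      (hc : (insert j (s.voteFrom .key1 val)).card = n - f) :
      Transition f Δ now i s (.recv i j (.vote .key1 val s.view))
        { s with
          voteFrom := addVote s .key1 val j, key2 := s.key2.set s.view val,
          joinMsgs := s.joinMsgs ++ [.vote .key2 val s.view] }
        (sendJoined s (.vote .key2 val s.view))
  | quorumKey2 {j : Fin n} {val : V} (h : j ∉ s.voteFrom .key2 val)
      (hc : (insert j (s.voteFrom .key2 val)).card = n - f) :
      Transition f Δ now i s (.recv i j (.vote .key2 val s.view))
        { s with
          voteFrom := addVote s .key2 val j, key3 := s.view, key3Val := val,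
          joinMsgs := s.joinMsgs ++ [.vote .key3 val s.view] }
        (sendJoined s (.vote .key3 val s.view))
  | quorumKey3 {j : Fin n} {val : V} (h : j ∉ s.voteFrom .key3 val)
      (hc : (insert j (s.voteFrom .key3 val)).card = n - f) :
      Transition f Δ now i s (.recv i j (.vote .key3 val s.view))
        { s with
          voteFrom := addVote s .key3 val j, lock := s.view, lockVal := val,
          joinMsgs := s.joinMsgs ++ [.vote .lock val s.view] }
        (sendJoined s (.vote .lock val s.view))
  | quorumLock {j : Fin n} {val : V} {o : Outbox n (Msg V)} (h : j ∉ s.voteFrom .lock val)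
      (hc : (insert j (s.voteFrom .lock val)).card = n - f)
      (ho : (s.doneSent = false ∧ o = sendAll (.done val)) ∨
        (s.doneSent = true ∧ o = sendNone)) :
      Transition f Δ now i s (.recv i j (.vote .lock val s.view))
        { s with voteFrom := addVote s .lock val j, doneSent := true } o

namespace Transition

variable {f : ℕ} {Δ now : ℝ} {i j : Fin n} {s : State n V}

theorem stale {m : Msg V} (h : Stale i j s m) :
    Transition f Δ now i s (.recv i j m) s sendNone :=
  .idle fun _ _ _ he => by cases he; exact h

theorem of_onRequest (v : ℕ) :
    Transition f Δ now i s (.recv i j (.request v)) (onRequest j v s).1 (onRequest j v s).2 := by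
  unfold onRequest
  by_cases h : s.highestRequest j < v
  · rw [if_pos h]
    exact .request h
  · rw [if_neg h]
    exact .stale (not_lt.1 h)

theorem of_onAbort (v : ℕ) :
    Transition f Δ now i s (.recv i j (.abort v)) (onAbort f Δ now i j v s).1
      (onAbort f Δ now i j v s).2 := by
  unfold onAbort
  by_cases h : s.highestAbort j < v
  · rw [if_pos h]
    by_cases hu : Function.update s.highestAbort j v i <
        kthLargest (f + 1) (Function.update s.highestAbort j v)
    · simp only [if_pos hu]
      split_ifs with hw
      · exact .abortEnter h (.raise _ rfl hu) hw
      · exact .abortStay h (.raise _ rfl hu) (not_le.1 hw)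
    · simp only [if_neg hu]
      split_ifs with hw
      · exact .abortEnter h (.keep (not_lt.1 hu)) hw
      · exact .abortStay h (.keep (not_lt.1 hu)) (not_le.1 hw)
  · rw [if_neg h]
    exact .stale (not_lt.1 h)

theorem of_onDone (val : V) :
    Transition f Δ now i s (.recv i j (.done val)) (onDone f j val s).1 (onDone f j val s).2 := by
  by_cases h : j ∈ s.doneFrom val
  · rw [onDone, if_pos h]
    exact .stale h
  have hstep := fun b o ho => Transition.done (Δ := Δ) (now := now) (i := i) (b := b) (o := o)
    (f := f) h rfl ho
  rw [onDone, if_neg h]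
  by_cases hc : (insert j (s.doneFrom val)).card = f + 1
  · by_cases hd : s.doneSent = true
    · convert hstep _ _ (.inr ⟨fun _ => hd, rfl, rfl⟩) using 1 <;>
        simp only [sendDone, if_pos hc, if_pos hd]
      split_ifs <;> rfl
    · convert hstep _ _ (.inl ⟨hc, by simpa using hd, rfl, rfl⟩) using 1 <;>
        simp only [sendDone, if_pos hc, if_neg hd]
      split_ifs <;> rfl
  · convert hstep _ _ (.inr ⟨fun h => absurd h hc, rfl, rfl⟩) using 1 <;>
      simp only [if_neg hc]
    split_ifs <;> rfl

theorem of_onSuggest (hf : f < n) {pick : (Fin n → Option (ℤ × V)) → ℤ × V}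
    (hpick : IsPick pick) (k3 : ℤ) (v3 : V) (r : KeyRecord V) :
    Transition f Δ now i s (.recv i j (.suggest k3 v3 r s.view))
      (onSuggest f pick i j k3 v3 r s).1 (onSuggest f pick i j k3 v3 r s).2 := by
  simp only [onSuggest]
  split_ifs with h hq
  · obtain ⟨hp, hq⟩ := hq
    obtain ⟨l, hl⟩ := Finset.card_pos.1 ((Nat.sub_pos_of_lt hf).trans_le hq)
    obtain ⟨hmem, hmax⟩ := hpick (suggestions f (s.recordSuggest j ((k3, v3), r)))
      ⟨l, Option.isSome_iff_ne_none.1 (Finset.mem_filter.1 hl).2⟩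
    exact .propose h.1 h.2 hp hq hmem hmax
  · exact .suggest h.1 h.2 fun hp => not_le.1 fun hc => hq ⟨hp, hc⟩
  · exact .stale fun _ hi hn => h ⟨hi, hn⟩

theorem of_onProof (r : KeyRecord V) :
    Transition f Δ now i s (.recv i j (.proof r s.view)) (onProof f j r s).1
      (onProof f j r s).2 := by
  unfold onProof tryOpen
  split_ifs with h
  · split
    · next val l lv hp =>
      split_ifs with ho
      · exact .proofOpen h hp ho
      · refine .proof h fun val' l' lv' hp' => ?_
        cases hp.symm.trans hp'
        exact ho
    · next hp => exact .proof h fun val l lv hp' => absurd (hp.symm.trans hp') nofun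
  · exact .stale fun _ => h

theorem of_onPropose (key : ℤ) (val : V) :
    Transition f Δ now i s (.recv i j (.propose key val s.view)) (onPropose f j key val s).1
      (onPropose f j key val s).2 := by
  simp only [onPropose, tryOpen]
  split_ifs with h hl hk ho
  · exact .proposeEcho h.1 h.2 hl
  · obtain ⟨hl, hv⟩ := not_or.1 hl
    exact .proposeOpen h.1 h.2 hl hv hk.1 hk.2 ho
  · obtain ⟨hl, hv⟩ := not_or.1 hl
    exact .proposeWait h.1 h.2 hl hv hk.1 hk.2 ho
  · obtain ⟨hl, hv⟩ := not_or.1 hl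
    exact .proposeReject h.1 h.2 hl hv hk
  · exact .stale fun _ hj => Bool.eq_true_of_not_eq_false fun hs => h ⟨hj, hs⟩

theorem of_onVote (ph : Phase) (val : V) :
    Transition f Δ now i s (.recv i j (.vote ph val s.view)) (onVote f j ph val s).1
      (onVote f j ph val s).2 := by
  simp only [onVote]
  split_ifs with h hc
  · exact .stale fun _ => h
  · cases ph
    · exact .quorumEcho h hc
    · exact .quorumKey1 h hc
    · exact .quorumKey2 h hc
    · exact .quorumKey3 h hc
    · simp only [onQuorum, sendDone]
      split_ifs with hd
      · convert Transition.quorumLock (Δ := Δ) (now := now) (i := i) h hc (.inr ⟨hd, rfl⟩) using 1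
        rw [← hd]
        rfl
      · exact .quorumLock h hc (.inl ⟨Bool.eq_false_of_not_eq_true hd, rfl⟩)
  · exact .vote h hc

theorem of_onReceive (hf : f < n) {pick : (Fin n → Option (ℤ × V)) → ℤ × V}
    (hpick : IsPick pick) (m : Msg V) :
    Transition f Δ now i s (.recv i j m) (onReceive f Δ pick i now j m s).1
      (onReceive f Δ pick i now j m s).2 := by
  cases m with
  | request v => exact of_onRequest v
  | abort v => exact of_onAbort v
  | done val => exact of_onDone val
  | suggest k3 v3 r v =>
    by_cases hv : v = s.view
    · subst hv; simpa only [onReceive, if_true] using of_onSuggest hf hpick k3 v3 r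
    · simpa only [onReceive, if_neg hv] using stale (m := .suggest k3 v3 r v) fun h => absurd h hv
  | proof r v =>
    by_cases hv : v = s.view
    · subst hv; simpa only [onReceive, if_true] using of_onProof r
    · simpa only [onReceive, if_neg hv] using stale (m := .proof r v) fun h => absurd h hv
  | propose key val v =>
    by_cases hv : v = s.view
    · subst hv; simpa only [onReceive, if_true] using of_onPropose key val
    · simpa only [onReceive, if_neg hv] using stale (m := .propose key val v) fun h => absurd h hv
  | vote ph val v =>
    by_cases hv : v = s.view
    · subst hv; simpa only [onReceive, if_true] using of_onVote ph val
    · simpa only [onReceive, if_neg hv] using stale (m := .vote ph val v) fun h => absurd h hv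

end Transition

end Transition

/-! ### Monotonicity of states -/

section StateLe

variable {n : ℕ} {V : Type*}

/-- The order in which the states of a party appear: the records that are kept forever only grow,
and those that concern the current view grow as long as the view is not left. -/
structure State.Le (s s' : State n V) : Prop where
  view : s.view ≤ s'.view
  request : s.highestRequest ≤ s'.highestRequest
  abort : s.highestAbort ≤ s'.highestAbort
  doneFrom : s.doneFrom ≤ s'.doneFrom
  doneSent : s.doneSent = true → s'.doneSent = true
  join : s.view = s'.view → s.joinMsgs ⊆ s'.joinMsgs
  vote : s.view = s'.view → s.voteFrom ≤ s'.voteFrom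
  suggest : s.view = s'.view → ∀ j x, s.suggestFrom j = some x → s'.suggestFrom j = some x
  proof : s.view = s'.view → ∀ j x, s.proofFrom j = some x → s'.proofFrom j = some x
  proposed : s.view = s'.view → s.proposed = true → s'.proposed = true
  proposalSeen : s.view = s'.view → s.proposalSeen = true → s'.proposalSeen = true

theorem State.Le.refl (s : State n V) : s.Le s where
  view := le_rfl
  request := le_rfl
  abort := le_rfl
  doneFrom := le_rfl
  doneSent := id
  join _ := List.Subset.refl _
  vote _ := le_rfl
  suggest _ _ _ := id
  proof _ _ _ := id
  proposed _ := id
  proposalSeen _ := id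

theorem State.Le.trans {s₁ s₂ s₃ : State n V} (h : s₁.Le s₂) (h' : s₂.Le s₃) : s₁.Le s₃ := by
  have hview (e : s₁.view = s₃.view) : s₁.view = s₂.view ∧ s₂.view = s₃.view := by
    have := h.view
    have := h'.view
    omega
  exact {
    view := h.view.trans h'.view
    request := h.request.trans h'.request
    abort := h.abort.trans h'.abort
    doneFrom := h.doneFrom.trans h'.doneFrom
    doneSent := h'.doneSent ∘ h.doneSent
    join := fun e => List.Subset.trans (h.join (hview e).1) (h'.join (hview e).2)
    vote := fun e => (h.vote (hview e).1).trans (h'.vote (hview e).2)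
    suggest := fun e j x hx => h'.suggest (hview e).2 j x (h.suggest (hview e).1 j x hx)
    proof := fun e j x hx => h'.proof (hview e).2 j x (h.proof (hview e).1 j x hx)
    proposed := fun e hx => h'.proposed (hview e).2 (h.proposed (hview e).1 hx)
    proposalSeen := fun e hx => h'.proposalSeen (hview e).2 (h.proposalSeen (hview e).1 hx) }

theorem State.le_enterView (Δ now : ℝ) {v : ℕ} {s : State n V} {a : Fin n → ℕ} (hv : s.view < v)
    (ha : s.highestAbort ≤ a) : s.Le (enterView Δ now v { s with highestAbort := a }).1 where
  view := hv.le
  request := le_rfl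
  abort := ha
  doneFrom := le_rfl
  doneSent := id
  join e := absurd e hv.ne
  vote e := absurd e hv.ne
  suggest e := absurd e hv.ne
  proof e := absurd e hv.ne
  proposed e := absurd e hv.ne
  proposalSeen e := absurd e hv.ne

theorem update_eq_some_of_eq_none {α β : Type*} [DecidableEq α] {a : α → Option β} {j l : α}
    {x y : β} (h : a j = none) (hx : a l = some x) : Function.update a j (some y) l = some x := by
  rw [Function.update_of_ne, hx]
  rintro rfl
  simp [h] at hx

variable [DecidableEq V]

theorem le_addVote (s : State n V) (ph : Phase) (val : V) (j : Fin n) :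
    s.voteFrom ≤ addVote s ph val j :=
  le_update_self_iff.2 (le_update_self_iff.2 (Finset.subset_insert _ _))

theorem addVote_apply (s : State n V) (ph ph' : Phase) (val val' : V) (j : Fin n) :
    addVote s ph val j ph' val' =
      if ph' = ph ∧ val' = val then insert j (s.voteFrom ph val) else s.voteFrom ph' val' := by
  unfold addVote
  by_cases h : ph' = ph
  · subst h
    by_cases h' : val' = val
    · subst h'; simp
    · simp [h']
  · simp [h]

theorem Transition.le {f : ℕ} {Δ now : ℝ} {i : Fin n} {s s' : State n V} {e : Event n (Msg V)}
    {o : Outbox n (Msg V)} (h : Transition f Δ now i s e s' o) : s.Le s' := by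
  have hr := State.Le.refl s
  cases h with
  | idle | timeout => exact { hr with }
  | request h => exact { hr with request := le_update_self_iff.2 h.le }
  | abortStay h ha hw => exact { hr with abort := ha.le h }
  | abortEnter h ha hw => exact s.le_enterView Δ now (Nat.lt_succ_of_le hw) (ha.le h)
  | done h hd ho =>
    subst hd
    refine { hr with
      doneFrom := le_update_self_iff.2 (Finset.subset_insert _ _), doneSent := fun hs => ?_ }
    rcases ho with ⟨-, -, hb, -⟩ | ⟨-, hb, -⟩
    · exact hb
    · exact hb.trans hs
  | suggest hi h => exact { hr with suggest := fun _ _ _ => update_eq_some_of_eq_none h }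
  | propose hi h =>
    exact { hr with
      suggest := fun _ _ _ => update_eq_some_of_eq_none h
      proposed := fun _ _ => rfl
      join := fun _ => List.subset_append_left _ _ }
  | proof h => exact { hr with proof := fun _ _ _ => update_eq_some_of_eq_none h }
  | proofOpen h =>
    exact { hr with
      proof := fun _ _ _ => update_eq_some_of_eq_none h
      join := fun _ => List.subset_append_left _ _ }
  | proposeEcho | proposeOpen =>
    exact { hr with
      proposalSeen := fun _ _ => rfl
      join := fun _ => List.subset_append_left _ _ }
  | proposeWait | proposeReject => exact { hr with proposalSeen := fun _ _ => rfl }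
  | vote => exact { hr with vote := fun _ => le_addVote _ _ _ _ }
  | quorumEcho | quorumKey1 | quorumKey2 | quorumKey3 =>
    exact { hr with
      vote := fun _ => le_addVote _ _ _ _
      join := fun _ => List.subset_append_left _ _ }
  | quorumLock =>
    exact { hr with vote := fun _ => le_addVote _ _ _ _, doneSent := fun _ => rfl }

end StateLe

/-! ### Runs -/

/-- A run: an execution of IT-HS with at most `f < n / 3` faulty parties and a positive delay
bound. The assumptions of the theorem are bundled here because every later lemma is about a run. -/
structure Run (n : ℕ) (V : Type*) [DecidableEq V] (f : ℕ) (Δ : ℝ) where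
  three_mul_lt : 3 * f < n
  delay_pos : 0 < Δ
  faulty : Finset (Fin n)
  card_faulty_le : faulty.card ≤ f
  input : Fin n → V
  exec : Execution (protocol n f Δ V) faulty Δ input

namespace Run

variable {n : ℕ} {V : Type*} [DecidableEq V] {f : ℕ} {Δ : ℝ} (R : Run n V f Δ)

/-- The global stabilization time of the run. -/
abbrev GST : ℝ := R.exec.GST

/-- The real time of step `k`. -/
abbrev time (k : ℕ) : ℝ := R.exec.time k

/-- The reading of the local clock of `i` at real time `t`. -/
abbrev clock (i : Fin n) (t : ℝ) : ℝ := R.exec.clock i t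

/-- The reading of the local clock of `i` at step `k`. -/
abbrev now (k : ℕ) (i : Fin n) : ℝ := R.clock i (R.time k)

/-- The event of step `k`. -/
abbrev event (k : ℕ) : Event n (Msg V) := R.exec.event k

/-- The state of `i` before step `k`. -/
abbrev state (k : ℕ) (i : Fin n) : Option (State n V) := R.exec.state k i

/-- The messages sent by `i` in step `k`. -/
abbrev sent (k : ℕ) (i : Fin n) : Outbox n (Msg V) := R.exec.sent k i

/-- The number of steps taken up to time `T`. -/
noncomputable abbrev upTo (T : ℝ) : ℕ := R.exec.upTo T

/-- Before step `k`, party `i` has received `m` from `j`. -/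
abbrev Received (k : ℕ) (i j : Fin n) (m : Msg V) : Prop := R.exec.Received k i j m

/-- Before step `k`, party `i` has sent `m` to `j`. -/
abbrev Sent (k : ℕ) (i j : Fin n) (m : Msg V) : Prop := R.exec.Sent k i j m

/-- Before step `k`, party `i` has called `sendAllUponJoin` for `m`. -/
def Cast (k : ℕ) (i : Fin n) (m : Msg V) : Prop :=
  ∃ l ≤ k, ∃ s, R.state l i = some s ∧ m ∈ s.joinMsgs

/-- The outcome of the start of party `i` in step `k`. -/
noncomputable abbrev init (k : ℕ) (i : Fin n) : State n V × Outbox n (Msg V) :=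
  enterView Δ (R.now k i) 1 (initState (R.input i))

include R in
theorem lt_card : f < n := by
  have := R.three_mul_lt
  omega

theorem state_zero {i : Fin n} (hi : i ∉ R.faulty) : R.state 0 i = none := R.exec.state_zero i hi

theorem step_of_none {i : Fin n} (hi : i ∉ R.faulty) {k : ℕ} (hs : R.state k i = none) :
    (R.event k ≠ .start i ∧ R.state (k + 1) i = none ∧ R.sent k i = sendNone) ∨
      (R.state (k + 1) i = some (R.init k i).1 ∧ R.sent k i = (R.init k i).2) := by
  have h := R.exec.step k i hi
  unfold event state sent at *
  rw [hs] at h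
  generalize R.exec.event k = e at h ⊢
  generalize R.exec.state (k + 1) i = s' at h ⊢
  generalize R.exec.sent k i = o at h ⊢
  cases h with
  | start h =>
    obtain ⟨rfl, rfl⟩ := Prod.mk.inj (Set.mem_singleton_iff.1 h)
    exact .inr ⟨rfl, rfl⟩
  | other he => exact .inl ⟨fun h => he (h ▸ rfl), rfl, rfl⟩

theorem transition {i : Fin n} (hi : i ∉ R.faulty) {k : ℕ} {s : State n V}
    (hs : R.state k i = some s) : ∃ s', R.state (k + 1) i = some s' ∧
      Transition f Δ (R.now k i) i s (R.event k) s' (R.sent k i) := by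
  have h := R.exec.step k i hi
  unfold event state sent at *
  rw [hs] at h
  generalize R.exec.event k = e at h ⊢
  generalize R.exec.state (k + 1) i = s' at h ⊢
  generalize R.exec.sent k i = o at h ⊢
  cases h with
  | recv hd h =>
    obtain ⟨pick, hp, h⟩ := h
    obtain ⟨rfl, rfl⟩ := Prod.mk.inj h
    exact ⟨_, rfl, .of_onReceive R.lt_card hp _⟩
  | timeout hd ht hnow h =>
    obtain ⟨rfl, rfl⟩ := Prod.mk.inj (Set.mem_singleton_iff.1 h)
    exact ⟨_, rfl, .timeout ht hnow⟩
  | terminated hd => exact ⟨s, rfl, .idle fun h => absurd h hd⟩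
  | other he => exact ⟨s, rfl, .idle fun _ j m h => absurd (congrArg Event.party h) he⟩

theorem invariant {i : Fin n} (hi : i ∉ R.faulty) (Inv : ℕ → State n V → Prop)
    (start : ∀ k, R.state k i = none → R.state (k + 1) i = some (R.init k i).1 →
      R.sent k i = (R.init k i).2 → Inv (k + 1) (R.init k i).1)
    (step : ∀ k s s' e o, R.state k i = some s → R.state (k + 1) i = some s' → R.event k = e →
      R.sent k i = o → Transition f Δ (R.now k i) i s e s' o → Inv k s → Inv (k + 1) s') :
    ∀ {k s}, R.state k i = some s → Inv k s := by
  intro k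
  induction k with
  | zero =>
    intro s hs
    cases (R.state_zero hi).symm.trans hs
  | succ k ih =>
    intro s' hs'
    rcases hs : R.state k i with _ | s
    · rcases R.step_of_none hi hs with ⟨-, h, -⟩ | ⟨h, ho⟩
      · cases h.symm.trans hs'
      · cases h.symm.trans hs'
        exact start k hs h ho
    · obtain ⟨s'', h, hstep⟩ := R.transition hi hs
      cases h.symm.trans hs'
      exact step k s _ _ _ hs h rfl rfl hstep (ih hs)

theorem exists_state_of_le {i : Fin n} (hi : i ∉ R.faulty) {k k' : ℕ} (hk : k ≤ k')
    {s : State n V} (hs : R.state k i = some s) : ∃ s', R.state k' i = some s' ∧ s.Le s' := by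
  induction hk with
  | refl => exact ⟨s, hs, .refl s⟩
  | step _ ih =>
    obtain ⟨s', hs', hle⟩ := ih
    obtain ⟨s'', hs'', h⟩ := R.transition hi hs'
    exact ⟨s'', hs'', hle.trans h.le⟩

theorem state_le {i : Fin n} (hi : i ∉ R.faulty) {k k' : ℕ} (hk : k ≤ k') {s s' : State n V}
    (hs : R.state k i = some s) (hs' : R.state k' i = some s') : s.Le s' := by
  obtain ⟨s'', hs'', hle⟩ := R.exists_state_of_le hi hk hs
  cases hs''.symm.trans hs'
  exact hle

theorem lt_of_view_lt {i : Fin n} (hi : i ∉ R.faulty) {k k' : ℕ} {s s' : State n V}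
    (hs : R.state k i = some s) (hs' : R.state k' i = some s') (h : s.view < s'.view) :
    k < k' := by
  by_contra! hk
  exact (R.state_le hi hk hs' hs).view.not_gt h

variable {R}

theorem Cast.mono {k k' : ℕ} {i : Fin n} {m : Msg V} (h : R.Cast k i m) (hk : k ≤ k') :
    R.Cast k' i m :=
  let ⟨l, hl, h⟩ := h
  ⟨l, hl.trans hk, h⟩

end Run

/-! ### Messages sent -/

section Messages

variable {n : ℕ} {V : Type*}

/-- The message is one of those that are sent upon join, and it belongs to view `v`. -/
def Msg.InView (v : ℕ) : Msg V → Prop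
  | .proof _ w => w = v
  | .propose _ _ w => w = v
  | .vote _ _ w => w = v
  | _ => False

theorem Msg.InView.unique {v w : ℕ} {m : Msg V} (h : m.InView v) (h' : m.InView w) : v = w := by
  cases m <;> first | exact h.elim | exact h.symm.trans h'

theorem mem_enterView {Δ now : ℝ} {v : ℕ} {s : State n V} {j : Fin n} {m : Msg V}
    (h : m ∈ (enterView Δ now v s).2 j) : m = .request v ∨
      (m = suggestMsg (enterView Δ now v s).1 ∧ s.highestRequest j = v) ∨
      (m = .proof s.key1 v ∧ s.highestRequest j = v) := by
  simp only [enterView, sendAllUponJoin, List.mem_cons, List.mem_append] at h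
  rcases h with h | h | h
  · exact .inl h
  · split_ifs at h with hc
    · exact .inr (.inl ⟨List.mem_singleton.1 h, hc.1⟩)
    · cases h
  · split_ifs at h with hc
    · exact .inr (.inr ⟨List.mem_singleton.1 h, hc⟩)
    · cases h

theorem mem_sendJoined {s : State n V} {j : Fin n} {m m' : Msg V} (h : m ∈ sendJoined s m' j) :
    m = m' ∧ s.highestRequest j = s.view := by
  unfold sendJoined at h
  split_ifs at h with hc
  · exact ⟨List.mem_singleton.1 h, hc⟩
  · cases h

theorem AbortUpdate.of_mem {f : ℕ} (hf : f < n) {i j p : Fin n} {v : ℕ} {a a' : Fin n → ℕ}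
    {o : Outbox n (Msg V)} (h : AbortUpdate f i j v a a' o) {m : Msg V} (hm : m ∈ o p) :
    ∃ u, m = .abort u ∧ o = sendAll (.abort u) ∧
      f + 1 ≤ (Finset.univ.filter fun l => u ≤ Function.update a j v l).card := by
  cases h with
  | keep => cases hm
  | raise u hu =>
    exact ⟨u, List.mem_singleton.1 hm, rfl,
      (le_kthLargest_iff (by omega) hf _ _).1 hu.le⟩

end Messages

namespace Run

variable {n : ℕ} {V : Type*} [DecidableEq V] {f : ℕ} {Δ : ℝ} {R : Run n V f Δ}

theorem inView_of_mem {i : Fin n} (hi : i ∉ R.faulty) {k : ℕ} {s : State n V}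
    (hs : R.state k i = some s) : ∀ m ∈ s.joinMsgs, m.InView s.view := by
  refine R.invariant hi (fun _ s => ∀ m ∈ s.joinMsgs, m.InView s.view) ?_ ?_ hs
  · intro k _ _ _ m hm
    cases List.mem_singleton.1 hm
    rfl
  · intro k s s' e o _ _ _ _ h ih
    cases h with
    | abortEnter =>
      intro m hm
      cases List.mem_singleton.1 hm
      rfl
    | _ => first
      | exact ih
      | exact List.forall_mem_append.2 ⟨ih, List.forall_mem_singleton.2 rfl⟩

/-- The reasons for which `i` may send `m` to `j` in step `k`. Messages other than those sent upon
join and `suggest` go to all parties. -/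
inductive SentBy (R : Run n V f Δ) (k : ℕ) (i j : Fin n) : Msg V → Prop
  | request {s : State n V} (hs : R.state (k + 1) i = some s) : SentBy R k i j (.request s.view)
  | suggest {s : State n V} (hs : R.state (k + 1) i = some s)
      (hj : s.highestRequest j = s.view) : SentBy R k i j (suggestMsg s)
  | join {s : State n V} {m : Msg V} (hs : R.state (k + 1) i = some s)
      (hj : s.highestRequest j = s.view) (hm : m ∈ s.joinMsgs) : SentBy R k i j m
  | timeout {s : State n V} {d : ℝ} (hs : R.state k i = some s) (hd : s.timer = some d)
      (hnow : d ≤ R.now k i) (ho : ∀ p, .abort s.view ∈ R.sent k i p) :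
      SentBy R k i j (.abort s.view)
  | abort {s : State n V} {l : Fin n} {v u : ℕ} (hs : R.state k i = some s)
      (he : R.event k = .recv i l (.abort v))
      (hu : f + 1 ≤ (Finset.univ.filter fun p => u ≤ Function.update s.highestAbort l v p).card)
      (ho : ∀ p, .abort u ∈ R.sent k i p) : SentBy R k i j (.abort u)
  | lock {s : State n V} {val : V} (hs : R.state (k + 1) i = some s)
      (hc : n - f ≤ (s.voteFrom .lock val).card) (ho : ∀ p, .done val ∈ R.sent k i p) :
      SentBy R k i j (.done val)
  | done {s : State n V} {val : V} (hs : R.state (k + 1) i = some s)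
      (hc : f + 1 ≤ (s.doneFrom val).card) (ho : ∀ p, .done val ∈ R.sent k i p) :
      SentBy R k i j (.done val)

theorem SentBy.of_enterView {i : Fin n} {k : ℕ} {now : ℝ} {v : ℕ} {s : State n V}
    (hs : R.state (k + 1) i = some (enterView Δ now v s).1) {j : Fin n} {m : Msg V}
    (h : m ∈ (enterView Δ now v s).2 j) : R.SentBy k i j m := by
  rcases mem_enterView h with rfl | ⟨rfl, hj⟩ | ⟨rfl, hj⟩
  · exact .request hs
  · exact .suggest hs hj
  · exact .join hs hj (List.mem_singleton.2 rfl)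

theorem SentBy.of_request {i j l : Fin n} {k v : ℕ} {s : State n V}
    (hs : R.state (k + 1) i =
      some { s with highestRequest := Function.update s.highestRequest l v })
    {m : Msg V} (h : m ∈ if j = l ∧ v = s.view then
      (if IsPrimary l v then [suggestMsg s] else []) ++ s.joinMsgs else []) :
    R.SentBy k i j m := by
  split_ifs at h with hc hl
  · obtain ⟨rfl, rfl⟩ := hc
    rcases List.mem_append.1 h with h | h
    · cases List.mem_singleton.1 h
      have := SentBy.suggest (j := j) hs (Function.update_self ..)
      exact this
    · exact .join hs (Function.update_self ..) h
  · obtain ⟨rfl, rfl⟩ := hc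
    exact .join hs (Function.update_self ..) h
  · cases h

theorem SentBy.of_transition {i j : Fin n} {k : ℕ} {s s' : State n V} {m : Msg V}
    {e : Event n (Msg V)} {o : Outbox n (Msg V)} (hs : R.state k i = some s)
    (hs' : R.state (k + 1) i = some s') (he : R.event k = e) (ho : R.sent k i = o)
    (h : Transition f Δ (R.now k i) i s e s' o) (hm : m ∈ R.sent k i j) : R.SentBy k i j m := by
  have hmo : m ∈ o j := ho ▸ hm
  have mem_sent {m : Msg V} (h : o = sendAll m) (p : Fin n) : m ∈ R.sent k i p := by
    rw [ho, h]
    exact List.mem_singleton.2 rfl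
  cases h with
  | timeout hd hnow =>
    cases List.mem_singleton.1 hmo
    exact .timeout hs hd hnow (mem_sent rfl)
  | request => exact .of_request hs' hmo
  | abortStay h ha =>
    obtain ⟨u, rfl, hou, hu⟩ := ha.of_mem R.lt_card hmo
    exact .abort hs he hu (mem_sent hou)
  | abortEnter h ha =>
    rcases List.mem_append.1 hmo with hmo | hmo
    · obtain ⟨u, rfl, rfl, hu⟩ := ha.of_mem R.lt_card hmo
      exact .abort hs he hu fun p => ho ▸ List.mem_append_left _ (List.mem_singleton.2 rfl)
    · exact .of_enterView hs' hmo
  | done h hd' hod =>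
    rcases hod with ⟨hc, -, -, hod⟩ | ⟨-, -, rfl⟩
    · cases List.mem_singleton.1 (hod ▸ hmo)
      exact .done hs' (by simp [hc]) (mem_sent hod)
    · cases hmo
  | quorumLock h hc hod =>
    rcases hod with ⟨-, hod⟩ | ⟨-, rfl⟩
    · cases List.mem_singleton.1 (hod ▸ hmo)
      exact .lock hs' (by simp [addVote_apply, hc]) (mem_sent hod)
    · cases hmo
  | _ => first
    | cases hmo
    | (obtain ⟨rfl, hj⟩ := mem_sendJoined hmo
       exact .join hs' hj (List.mem_append_right _ (List.mem_singleton.2 rfl)))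

theorem sentBy_of_mem {i : Fin n} (hi : i ∉ R.faulty) {k : ℕ} {j : Fin n} {m : Msg V}
    (hm : m ∈ R.sent k i j) : R.SentBy k i j m := by
  rcases hs : R.state k i with _ | s
  · rcases R.step_of_none hi hs with ⟨-, -, ho⟩ | ⟨hs', ho⟩
    · exact absurd (ho ▸ hm) List.not_mem_nil
    · exact .of_enterView hs' (ho ▸ hm)
  · obtain ⟨s', hs', h⟩ := R.transition hi hs
    exact .of_transition hs hs' rfl rfl h hm

theorem join_of_sent {i : Fin n} (hi : i ∉ R.faulty) {k : ℕ} {j : Fin n} {m : Msg V} {v : ℕ}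
    (hm : m ∈ R.sent k i j) (hv : m.InView v) : ∃ s, R.state (k + 1) i = some s ∧
      s.view = v ∧ s.highestRequest j = v ∧ m ∈ s.joinMsgs := by
  cases sentBy_of_mem hi hm with
  | join hs hj hm =>
    obtain rfl := hv.unique (inView_of_mem hi hs _ hm)
    exact ⟨_, hs, rfl, hj, hm⟩
  | _ => exact hv.elim

theorem suggest_of_sent {i : Fin n} (hi : i ∉ R.faulty) {k : ℕ} {j : Fin n} {k3 : ℤ} {v3 : V}
    {r : KeyRecord V} {v : ℕ} (hm : .suggest k3 v3 r v ∈ R.sent k i j) :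
    ∃ s, R.state (k + 1) i = some s ∧ s.view = v ∧ s.highestRequest j = v ∧
      s.key3 = k3 ∧ s.key3Val = v3 ∧ s.key2 = r := by
  generalize h : Msg.suggest k3 v3 r v = m at hm
  cases sentBy_of_mem hi hm with
  | join hs hj hm => subst h; exact (inView_of_mem hi hs _ hm).elim
  | suggest hs hj =>
    cases h
    exact ⟨_, hs, rfl, hj, rfl, rfl, rfl⟩
  | _ => cases h

theorem request_of_sent {i : Fin n} (hi : i ∉ R.faulty) {k : ℕ} {j : Fin n} {v : ℕ}
    (hm : .request v ∈ R.sent k i j) : ∃ s, R.state (k + 1) i = some s ∧ s.view = v := by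
  generalize h : Msg.request v = m at hm
  cases sentBy_of_mem hi hm with
  | join hs hj hm => subst h; exact (inView_of_mem hi hs _ hm).elim
  | request hs => cases h; exact ⟨_, hs, rfl⟩
  | _ => cases h

theorem cast_of_received {i j : Fin n} (hi : i ∉ R.faulty) (hj : j ∉ R.faulty) {k : ℕ}
    {m : Msg V} {v : ℕ} (hm : R.Received k i j m) (hv : m.InView v) :
    ∃ k' < k, R.Cast k' j m := by
  obtain ⟨k', hk', l, hl, h⟩ := hm.exists_sent_lt hi hj
  obtain ⟨s, hs, -, -, h⟩ := join_of_sent hj h hv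
  exact ⟨k', hk', l + 1, hl, s, hs, h⟩

theorem cast_mem {i : Fin n} (hi : i ∉ R.faulty) {k k' : ℕ} {m : Msg V} {s : State n V}
    (h : R.Cast k' i m) (hk : k' ≤ k) (hs : R.state k i = some s) (hv : m.InView s.view) :
    m ∈ s.joinMsgs := by
  obtain ⟨l, hl, s', hs', hm⟩ := h
  exact (R.state_le hi (hl.trans hk) hs' hs).join ((inView_of_mem hi hs' _ hm).unique hv) hm

theorem cast_common {i : Fin n} (hi : i ∉ R.faulty) {k k' : ℕ} {m m' : Msg V} {v : ℕ}
    (h : R.Cast k i m) (h' : R.Cast k' i m') (hv : m.InView v) (hv' : m'.InView v) :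
    ∃ l ≤ max k k', ∃ s, R.state l i = some s ∧ s.view = v ∧ m ∈ s.joinMsgs ∧ m' ∈ s.joinMsgs := by
  obtain ⟨l, hl, s, hs, hm⟩ := h
  obtain ⟨l', hl', s', hs', hm'⟩ := h'
  have e := (inView_of_mem hi hs _ hm).unique hv
  have e' := (inView_of_mem hi hs' _ hm').unique hv'
  rcases le_total l l' with hll | hll
  · exact ⟨l', by omega, s', hs', e', (R.state_le hi hll hs hs').join (by omega) hm, hm'⟩
  · exact ⟨l, by omega, s, hs, e, hm, (R.state_le hi hll hs' hs).join (by omega) hm'⟩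

end Run

/-! ### Votes and quorums -/

/-- The order in which the voting rounds of a view follow each other. -/
inductive Phase.Next : Phase → Phase → Prop
  | echo : Next .echo .key1
  | key1 : Next .key1 .key2
  | key2 : Next .key2 .key3
  | key3 : Next .key3 .lock

theorem Phase.Next.eq_iff {p p' q q' : Phase} (h : p.Next p') (h' : q.Next q') :
    p = q ↔ p' = q' := by
  cases h <;> cases h' <;> simp only [reduceCtorEq]

section VotesMatch

variable {n : ℕ} {V : Type*} {f : ℕ} {s : State n V}

/-- A party has voted in a round exactly if it has received a quorum of votes of the round
before. -/
def State.VotesMatch (f : ℕ) (s : State n V) : Prop :=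
  ∀ (ph ph' : Phase) (val : V), ph.Next ph' →
    (.vote ph' val s.view ∈ s.joinMsgs ↔ n - f ≤ (s.voteFrom ph val).card)

theorem State.votesMatch_enterView (hf : f < n) {Δ now : ℝ} {v : ℕ} :
    (enterView Δ now v s).1.VotesMatch f := by
  intro ph ph' val _
  simp only [enterView, sendAllUponJoin, List.nil_append, List.mem_singleton, reduceCtorEq,
    Finset.card_empty, false_iff]
  omega

theorem mem_append_vote {L : List (Msg V)} {ph ph' : Phase} {val val' : V} {v v' : ℕ} :
    .vote ph val v ∈ L ++ [.vote ph' val' v'] ↔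
      .vote ph val v ∈ L ∨ (ph = ph' ∧ val = val' ∧ v = v') := by
  simp

namespace State.VotesMatch

variable (h : s.VotesMatch f)
include h

theorem append_propose {key : ℤ} {val : V} {ph ph' : Phase} {val' : V} (hn : ph.Next ph') :
    .vote ph' val' s.view ∈ s.joinMsgs ++ [.propose key val s.view] ↔
      n - f ≤ (s.voteFrom ph val').card := by
  simpa using h ph ph' val' hn

theorem append_echo {val : V} {ph ph' : Phase} {val' : V} (hn : ph.Next ph') :
    .vote ph' val' s.view ∈ s.joinMsgs ++ [.vote .echo val s.view] ↔
      n - f ≤ (s.voteFrom ph val').card := by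
  have : ph' ≠ .echo := by cases hn <;> simp
  rw [mem_append_vote, h _ _ _ hn]
  tauto

variable [DecidableEq V] {j : Fin n}

theorem addVote {p : Phase} {val : V} (hj : j ∉ s.voteFrom p val)
    (hc : (insert j (s.voteFrom p val)).card ≠ n - f ∨ p = .lock) {ph ph' : Phase} {val' : V}
    (hn : ph.Next ph') : .vote ph' val' s.view ∈ s.joinMsgs ↔
      n - f ≤ (addVote s p val j ph val').card := by
  rw [h _ _ _ hn, addVote_apply]
  split_ifs with he
  · obtain ⟨rfl, rfl⟩ := he
    rcases hc with hc | rfl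
    · rw [Finset.card_insert_of_notMem hj] at hc ⊢
      omega
    · cases hn
  · rfl

theorem quorum {p p' : Phase} {val : V} (hp : p.Next p')
    (hc : (insert j (s.voteFrom p val)).card = n - f) {ph ph' : Phase} {val' : V}
    (hn : ph.Next ph') : .vote ph' val' s.view ∈ s.joinMsgs ++ [.vote p' val s.view] ↔
      n - f ≤ (ITHS.addVote s p val j ph val').card := by
  rw [mem_append_vote, h _ _ _ hn, addVote_apply]
  split_ifs with he
  · obtain ⟨rfl, rfl⟩ := he
    simp [(hp.eq_iff hn).1 rfl, hc]
  · rw [hn.eq_iff hp] at he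
    tauto

end State.VotesMatch

end VotesMatch

namespace Run

variable {n : ℕ} {V : Type*} [DecidableEq V] {f : ℕ} {Δ : ℝ} {R : Run n V f Δ}

theorem votesMatch {i : Fin n} (hi : i ∉ R.faulty) {k : ℕ} {s : State n V}
    (hs : R.state k i = some s) : s.VotesMatch f := by
  refine R.invariant hi (fun _ s => s.VotesMatch f)
    (fun _ _ _ _ => State.votesMatch_enterView R.lt_card) ?_ hs
  intro k s s' e o _ _ _ _ h ih
  cases h with
  | abortEnter => exact State.votesMatch_enterView R.lt_card
  | propose => exact fun _ _ _ => ih.append_propose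
  | proofOpen | proposeEcho | proposeOpen => exact fun _ _ _ => ih.append_echo
  | vote h hc => exact fun _ _ _ => ih.addVote h (.inl hc)
  | quorumLock h => exact fun _ _ _ => ih.addVote h (.inr rfl)
  | quorumEcho h hc => exact fun _ _ _ => ih.quorum .echo hc
  | quorumKey1 h hc => exact fun _ _ _ => ih.quorum .key1 hc
  | quorumKey2 h hc => exact fun _ _ _ => ih.quorum .key2 hc
  | quorumKey3 h hc => exact fun _ _ _ => ih.quorum .key3 hc
  | _ => exact ih

theorem received_of_mem_voteFrom {i : Fin n} (hi : i ∉ R.faulty) {k : ℕ} {s : State n V}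
    (hs : R.state k i = some s) : ∀ j ph val, j ∈ s.voteFrom ph val →
      R.Received k i j (.vote ph val s.view) := by
  refine R.invariant hi (fun k s => ∀ j ph val, j ∈ s.voteFrom ph val →
    R.Received k i j (.vote ph val s.view)) ?_ ?_ hs
  · intro k _ _ _ j ph val hj
    cases hj
  intro k s s' e o _ _ he _ h ih
  have ih' := fun j ph val hj => (ih j ph val hj).mono k.le_succ
  have hadd {j : Fin n} {ph : Phase} {val : V} (he : R.event k = .recv i j (.vote ph val s.view)) :
      ∀ j' ph' val', j' ∈ addVote s ph val j ph' val' →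
        R.Received (k + 1) i j' (.vote ph' val' s.view) := by
    intro j' ph' val' hj'
    rw [addVote_apply] at hj'
    split_ifs at hj' with hc
    · obtain ⟨rfl, rfl⟩ := hc
      rcases Finset.mem_insert.1 hj' with rfl | hj'
      · exact ⟨k, k.lt_succ_self, he⟩
      · exact ih' _ _ _ hj'
    · exact ih' _ _ _ hj'
  cases h with
  | abortEnter =>
    intro j ph val hj
    cases hj
  | vote | quorumEcho | quorumKey1 | quorumKey2 | quorumKey3 | quorumLock => exact hadd he
  | _ => exact ih'

section Counting

variable (R)

theorem card_sdiff_faulty {S : Finset (Fin n)} (hS : n - f ≤ S.card) :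
    f + 1 ≤ (S \ R.faulty).card := by
  have := Finset.le_card_sdiff R.faulty S
  have := R.card_faulty_le
  have := R.three_mul_lt
  omega

theorem exists_mem_not_faulty {S : Finset (Fin n)} (hS : f + 1 ≤ S.card) :
    ∃ j ∈ S, j ∉ R.faulty := by
  by_contra! h
  have := Finset.card_le_card (show S ⊆ R.faulty from h)
  have := R.card_faulty_le
  omega

theorem card_compl_faulty : n - f ≤ R.faultyᶜ.card := by
  rw [Finset.card_compl, Fintype.card_fin]
  have := R.card_faulty_le
  omega

end Counting

/-- Before step `k`, at least `n - f` parties, apart from faulty ones, have voted for `val`. -/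
def Quorum (R : Run n V f Δ) (k : ℕ) (ph : Phase) (val : V) (v : ℕ) : Prop :=
  ∃ S : Finset (Fin n), n - f ≤ S.card ∧
    ∀ j ∈ S, j ∉ R.faulty → ∃ k' < k, R.Cast k' j (.vote ph val v)

namespace Quorum

variable {k : ℕ} {ph : Phase} {val : V} {v : ℕ}

theorem mono {k' : ℕ} (h : R.Quorum k ph val v) (hk : k ≤ k') : R.Quorum k' ph val v := by
  obtain ⟨S, hS, h⟩ := h
  refine ⟨S, hS, fun j hj hjf => ?_⟩
  obtain ⟨l, hl, h⟩ := h j hj hjf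
  exact ⟨l, hl.trans_le hk, h⟩

theorem exists_mem (h : R.Quorum k ph val v) {H : Finset (Fin n)} (hH : f + 1 ≤ H.card)
    (hHf : ∀ j ∈ H, j ∉ R.faulty) : ∃ j ∈ H, ∃ k' < k, R.Cast k' j (.vote ph val v) := by
  obtain ⟨S, hS, h⟩ := h
  have hne : (S ∩ H).Nonempty := by
    rw [← Finset.card_pos]
    have := Finset.card_union_add_card_inter S H
    have : (S ∪ H).card ≤ n := (Finset.card_le_univ _).trans_eq (Fintype.card_fin n)
    omega
  obtain ⟨j, hj⟩ := hne
  rw [Finset.mem_inter] at hj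
  exact ⟨j, hj.2, h j hj.1 (hHf j hj.2)⟩

theorem exists_voters (h : R.Quorum k ph val v) : ∃ H : Finset (Fin n), f + 1 ≤ H.card ∧
    ∀ j ∈ H, j ∉ R.faulty ∧ ∃ k' < k, R.Cast k' j (.vote ph val v) := by
  obtain ⟨S, hS, h⟩ := h
  refine ⟨S \ R.faulty, R.card_sdiff_faulty hS, fun j hj => ?_⟩
  rw [Finset.mem_sdiff] at hj
  exact ⟨hj.2, h j hj.1 hj.2⟩

theorem exists_voter (h : R.Quorum k ph val v) :
    ∃ j, j ∉ R.faulty ∧ ∃ k' < k, R.Cast k' j (.vote ph val v) := by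
  obtain ⟨H, hH, h⟩ := h.exists_voters
  obtain ⟨j, hj⟩ := Finset.card_pos.1 (Nat.lt_of_lt_of_le f.succ_pos hH)
  exact ⟨j, h j hj⟩

end Quorum

theorem quorum_of_voteFrom {i : Fin n} (hi : i ∉ R.faulty) {k : ℕ} {s : State n V}
    (hs : R.state k i = some s) {ph : Phase} {val : V}
    (h : n - f ≤ (s.voteFrom ph val).card) : R.Quorum k ph val s.view :=
  ⟨_, h, fun j hj hjf => cast_of_received hi hjf (received_of_mem_voteFrom hi hs j ph val hj) rfl⟩

theorem quorum_of_cast {i : Fin n} (hi : i ∉ R.faulty) {k : ℕ} {ph ph' : Phase} {val : V} {v : ℕ}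
    (h : R.Cast k i (.vote ph' val v)) (hn : ph.Next ph') : R.Quorum k ph val v := by
  obtain ⟨l, hl, s, hs, hm⟩ := h
  obtain rfl : v = s.view := inView_of_mem hi hs _ hm
  exact (quorum_of_voteFrom hi hs ((votesMatch hi hs _ _ _ hn).1 hm)).mono hl

theorem Quorum.of_next {k : ℕ} {ph ph' : Phase} {val : V} {v : ℕ} (h : R.Quorum k ph' val v)
    (hn : ph.Next ph') : R.Quorum k ph val v := by
  obtain ⟨j, hj, l, hl, h⟩ := h.exists_voter
  exact (quorum_of_cast hj h hn).mono hl.le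

theorem Quorum.echo {k : ℕ} {ph : Phase} {val : V} {v : ℕ} (h : R.Quorum k ph val v) :
    R.Quorum k .echo val v := by
  cases ph with
  | echo => exact h
  | key1 => exact h.of_next .echo
  | key2 => exact (h.of_next .key1).of_next .echo
  | key3 => exact ((h.of_next .key2).of_next .key1).of_next .echo
  | lock => exact (((h.of_next .key3).of_next .key2).of_next .key1).of_next .echo

end Run

/-! ### Echoes -/

theorem proofs_eq_some {n : ℕ} {V : Type*} {s : State n V} {j : Fin n} {r : KeyRecord V} :
    proofs s j = some r ↔ s.proofFrom j = some r ∧ r.prev < r.key ∧ r.key < s.view := by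
  unfold proofs
  cases s.proofFrom j with
  | none => simp
  | some r' =>
    simp only [Option.some.injEq, ite_eq_iff]
    constructor
    · rintro (⟨h, rfl⟩ | ⟨_, h⟩)
      · exact ⟨rfl, h⟩
      · cases h
    · rintro ⟨rfl, h⟩
      exact .inl ⟨h, rfl⟩

namespace Run

variable {n : ℕ} {V : Type*} [DecidableEq V] {f : ℕ} {Δ : ℝ} {R : Run n V f Δ}

/-- In view `v`, before step `k`, party `i` has processed the proposal `(key, val)` of the primary
while holding the lock `(l, lv)`. -/
def Considered (R : Run n V f Δ) (k : ℕ) (i : Fin n) (v : ℕ) (key : ℤ) (val : V) (l : ℤ)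
    (lv : V) : Prop :=
  ∃ k' < k, ∃ s p, R.state k' i = some s ∧ s.view = v ∧ s.lock = l ∧ s.lockVal = lv ∧
    IsPrimary p v ∧ R.Received k i p (.propose key val v)

/-- Before step `k`, party `i` has received proofs in view `v` that open the lock `(l, lv)`. -/
def Opened (R : Run n V f Δ) (k : ℕ) (i : Fin n) (v : ℕ) (l : ℤ) (lv : V) : Prop :=
  ∃ S : Finset (Fin n), f + 1 ≤ S.card ∧ ∀ j ∈ S, ∃ r, R.Received k i j (.proof r v) ∧
    (l ≤ r.prev ∨ (l ≤ r.key ∧ r.val ≠ lv))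

theorem Considered.mono {k k' : ℕ} {i : Fin n} {v : ℕ} {key : ℤ} {val : V} {l : ℤ} {lv : V}
    (h : R.Considered k i v key val l lv) (hk : k ≤ k') : R.Considered k' i v key val l lv :=
  let ⟨m, hm, s, p, hs, hv, hl, hlv, hp, hr⟩ := h
  ⟨m, hm.trans_le hk, s, p, hs, hv, hl, hlv, hp, hr.mono hk⟩

theorem Opened.mono {k k' : ℕ} {i : Fin n} {v : ℕ} {l : ℤ} {lv : V}
    (h : R.Opened k i v l lv) (hk : k ≤ k') : R.Opened k' i v l lv := by
  obtain ⟨S, hS, h⟩ := h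
  refine ⟨S, hS, fun j hj => ?_⟩
  obtain ⟨r, hr, h⟩ := h j hj
  exact ⟨r, hr.mono hk, h⟩

theorem opened_of_openLock {i : Fin n} {k : ℕ} {s : State n V}
    (hr : ∀ j r, s.proofFrom j = some r → R.Received k i j (.proof r s.view)) {l : ℤ} {lv : V}
    (h : openLock f l lv (proofs s)) : R.Opened k i s.view l lv := by
  refine ⟨_, h, fun j hj => ?_⟩
  obtain ⟨r, hr', h⟩ := (Finset.mem_filter.1 hj).2
  exact ⟨r, hr j r (proofs_eq_some.1 hr').1, h⟩

/-- What a nonfaulty party did with the proposal of the current view: it has echoed it for a reason,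
it is waiting for proofs that open its lock, or it has rejected it. -/
structure EchoInv (R : Run n V f Δ) (i : Fin n) (k : ℕ) (s : State n V) : Prop where
  received : ∀ j r, s.proofFrom j = some r → R.Received k i j (.proof r s.view)
  seen : ∀ val, .vote .echo val s.view ∈ s.joinMsgs → s.proposalSeen = true ∧ s.pending = none
  unique : ∀ val val', .vote .echo val s.view ∈ s.joinMsgs → .vote .echo val' s.view ∈ s.joinMsgs →
    val = val'
  reason : ∀ val, .vote .echo val s.view ∈ s.joinMsgs → ∃ key l lv,
    R.Considered k i s.view key val l lv ∧ (l = 0 ∨ val = lv ∨ R.Opened k i s.view l lv)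
  waiting : ∀ val l lv, s.pending = some (val, l, lv) →
    s.proposalSeen = true ∧ ¬ openLock f l lv (proofs s) ∧ ∃ key,
      R.Considered k i s.view key val l lv ∧ l ≠ 0 ∧ val ≠ lv ∧ l ≤ key ∧ key < s.view
  answered : s.proposalSeen = true → (∃ val, .vote .echo val s.view ∈ s.joinMsgs) ∨
    (∃ val l lv, s.pending = some (val, l, lv)) ∨
    ∃ key val l lv, R.Considered k i s.view key val l lv ∧ l ≠ 0 ∧ val ≠ lv ∧
      ¬ (l ≤ key ∧ key < s.view)

namespace EchoInv

variable {i : Fin n} {k : ℕ} {s s' : State n V}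

theorem frame {k' : ℕ} (h : R.EchoInv i k s) (hk : k ≤ k') (hv : s'.view = s.view)
    (hs : s'.proposalSeen = s.proposalSeen) (hp : s'.pending = s.pending)
    (hj : ∀ val, .vote .echo val s.view ∈ s'.joinMsgs ↔ .vote .echo val s.view ∈ s.joinMsgs)
    (hr : ∀ j r, s'.proofFrom j = some r → R.Received k' i j (.proof r s.view))
    (hq : ∀ val l lv, s.pending = some (val, l, lv) → ¬ openLock f l lv (proofs s')) :
    R.EchoInv i k' s' := by
  constructor
  · rwa [hv]
  · simp only [hv, hs, hp, hj]
    exact h.seen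
  · simp only [hv, hj]
    exact h.unique
  · simp only [hv, hj]
    intro val hval
    obtain ⟨key, l, lv, hcon, hc⟩ := h.reason val hval
    exact ⟨key, l, lv, hcon.mono hk, hc.imp_right fun hc => hc.imp_right fun ho => ho.mono hk⟩
  · simp only [hv, hs, hp]
    intro val l lv hpend
    obtain ⟨hseen, -, key, hcon, hc⟩ := h.waiting val l lv hpend
    exact ⟨hseen, hq val l lv hpend, key, hcon.mono hk, hc⟩
  · simp only [hv, hs, hp, hj]
    intro hseen
    refine (h.answered hseen).imp_right fun h => h.imp_right fun h => ?_
    obtain ⟨key, val, l, lv, hcon, hc⟩ := h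
    exact ⟨key, val, l, lv, hcon.mono hk, hc⟩

theorem of_enterView {now : ℝ} {v : ℕ} : R.EchoInv i k (enterView Δ now v s).1 := by
  constructor <;> simp [enterView, sendAllUponJoin]

theorem of_echo {val : V} (hv : s'.view = s.view) (hs : s'.proposalSeen = true)
    (hp : s'.pending = none) (hj : s'.joinMsgs = s.joinMsgs ++ [.vote .echo val s.view])
    (hnew : ∀ val, .vote .echo val s.view ∉ s.joinMsgs)
    (hr : ∀ j r, s'.proofFrom j = some r → R.Received k i j (.proof r s.view))
    {key l : ℤ} {lv : V} (hcon : R.Considered k i s.view key val l lv)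
    (hc : l = 0 ∨ val = lv ∨ R.Opened k i s.view l lv) : R.EchoInv i k s' := by
  have hj' : ∀ val', .vote .echo val' s.view ∈ s'.joinMsgs ↔ val' = val := by
    intro val'
    simp [hj, hnew]
  constructor
  · rwa [hv]
  · exact fun _ _ => ⟨hs, hp⟩
  · simp only [hv, hj']
    rintro _ _ rfl rfl
    rfl
  · simp only [hv, hj']
    rintro _ rfl
    exact ⟨key, l, lv, hcon, hc⟩
  · simp [hp]
  · exact fun _ => .inl ⟨val, by simp only [hv, hj']⟩

theorem received_update {j : Fin n} {r : KeyRecord V} (h : R.EchoInv i k s)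
    (he : R.event k = .recv i j (.proof r s.view)) (j' : Fin n) (r' : KeyRecord V)
    (hj' : Function.update s.proofFrom j (some r) j' = some r') :
    R.Received (k + 1) i j' (.proof r' s.view) := by
  rw [Function.update_apply] at hj'
  split_ifs at hj' with hj
  · cases hj'
    subst hj
    exact ⟨k, k.lt_succ_self, he⟩
  · exact (h.received j' r' hj').mono k.le_succ

theorem proofOpen {j : Fin n} {r : KeyRecord V} {val : V} {l : ℤ} {lv : V}
    (h : R.EchoInv i k s) (he : R.event k = .recv i j (.proof r s.view))
    (hp : s.pending = some (val, l, lv)) (hq : openLock f l lv (proofs (s.recordProof j r))) :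
    R.EchoInv i (k + 1) { s.recordProof j r with
      pending := none, joinMsgs := s.joinMsgs ++ [.vote .echo val s.view] } := by
  obtain ⟨hseen, -, key, hcon, -⟩ := h.waiting val l lv hp
  have hopen : R.Opened (k + 1) i s.view l lv :=
    opened_of_openLock (s := s.recordProof j r) (h.received_update he) hq
  refine of_echo (s := s) rfl hseen rfl rfl (fun val hm => ?_) (h.received_update he)
    (hcon.mono k.le_succ) (.inr (.inr hopen))
  exact Option.some_ne_none _ (hp.symm.trans (h.seen val hm).2)

theorem not_mem_of_not_seen (h : R.EchoInv i k s) (hs : s.proposalSeen = false) (val : V) :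
    .vote .echo val s.view ∉ s.joinMsgs :=
  fun hm => Bool.false_ne_true (hs.symm.trans (h.seen val hm).1)

theorem pending_ne_of_not_seen (h : R.EchoInv i k s) (hs : s.proposalSeen = false) (val : V)
    (l : ℤ) (lv : V) : s.pending ≠ some (val, l, lv) :=
  fun hp => Bool.false_ne_true (hs.symm.trans (h.waiting val l lv hp).1)

theorem of_not_echo (hj : ∀ val, .vote .echo val s.view ∉ s.joinMsgs)
    (hr : ∀ j r, s.proofFrom j = some r → R.Received k i j (.proof r s.view))
    (hw : ∀ val l lv, s.pending = some (val, l, lv) →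
      s.proposalSeen = true ∧ ¬ openLock f l lv (proofs s) ∧ ∃ key,
        R.Considered k i s.view key val l lv ∧ l ≠ 0 ∧ val ≠ lv ∧ l ≤ key ∧ key < s.view)
    (ha : (∃ val l lv, s.pending = some (val, l, lv)) ∨
      ∃ key val l lv, R.Considered k i s.view key val l lv ∧ l ≠ 0 ∧ val ≠ lv ∧
        ¬ (l ≤ key ∧ key < s.view)) : R.EchoInv i k s where
  received := hr
  seen val hm := absurd hm (hj val)
  unique val _ hm := absurd hm (hj val)
  reason val hm := absurd hm (hj val)
  waiting := hw
  answered _ := .inr ha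

end EchoInv

theorem echoInv {i : Fin n} (hi : i ∉ R.faulty) {k : ℕ} {s : State n V}
    (hs : R.state k i = some s) : R.EchoInv i k s := by
  refine R.invariant hi (R.EchoInv i) (fun _ _ _ _ => .of_enterView) ?_ hs
  intro k s s' e o hs _ he _ h ih
  have hr := fun j r h => (ih.received j r h).mono k.le_succ
  have hcon {j key val} (hj : IsPrimary j s.view)
      (he : R.event k = .recv i j (.propose key val s.view)) :
      R.Considered (k + 1) i s.view key val s.lock s.lockVal :=
    ⟨k, k.lt_succ_self, s, j, hs, rfl, rfl, rfl, hj, k, k.lt_succ_self, he⟩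
  cases h with
  | abortEnter => exact .of_enterView
  | proof h hq =>
    exact ih.frame k.le_succ rfl rfl rfl (fun _ => .rfl) (ih.received_update he) hq
  | proofOpen h hp hq => exact ih.proofOpen he hp hq
  | proposeEcho hj h hl =>
    have hp : s.pending = none :=
      Option.eq_none_iff_forall_ne_some.2 fun _ => ih.pending_ne_of_not_seen h _ _ _
    exact .of_echo (s := s) rfl rfl hp rfl (ih.not_mem_of_not_seen h) hr (hcon hj he)
      (hl.imp_right .inl)
  | proposeOpen hj h hl hv hk hk' hq =>
    exact .of_echo (s := s) rfl rfl rfl rfl (ih.not_mem_of_not_seen h) hr (hcon hj he)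
      (.inr (.inr (opened_of_openLock hr hq)))
  | proposeWait hj h hl hv hk hk' hq =>
    refine .of_not_echo (ih.not_mem_of_not_seen h) hr ?_ (.inl ⟨_, _, _, rfl⟩)
    intro val' l lv hp
    cases hp
    exact ⟨rfl, hq, _, hcon hj he, hl, hv, hk, hk'⟩
  | proposeReject hj h hl hv hk =>
    exact .of_not_echo (ih.not_mem_of_not_seen h) hr
      (fun val l lv hp => absurd hp (ih.pending_ne_of_not_seen h val l lv))
      (.inr ⟨_, _, _, _, hcon hj he, hl, hv, hk⟩)
  | _ => exact ih.frame k.le_succ rfl rfl rfl (by simp) hr fun _ _ _ hp => (ih.waiting _ _ _ hp).2.1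

theorem echo_unique {i : Fin n} (hi : i ∉ R.faulty) {k k' : ℕ} {val val' : V} {v : ℕ}
    (h : R.Cast k i (.vote .echo val v)) (h' : R.Cast k' i (.vote .echo val' v)) : val = val' := by
  obtain ⟨l, -, s, hs, rfl, hm, hm'⟩ := cast_common hi h h' rfl rfl
  exact (echoInv hi hs).unique val val' hm hm'

theorem Quorum.unique {k k' : ℕ} {ph ph' : Phase} {val val' : V} {v : ℕ}
    (h : R.Quorum k ph val v) (h' : R.Quorum k' ph' val' v) : val = val' := by
  obtain ⟨H, hH, hvote⟩ := h.echo.exists_voters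
  obtain ⟨j, hj, l, -, hc⟩ := h'.echo.exists_mem hH fun j hj => (hvote j hj).1
  obtain ⟨l', -, hc'⟩ := (hvote j hj).2
  exact echo_unique (hvote j hj).1 hc' hc

end Run

/-! ### Keys and locks -/

/-- The record `r` shows that the key was set to `val` in view `w`, or later overwritten. -/
def Dominates {V : Type*} (r : KeyRecord V) (w : ℕ) (val : V) : Prop :=
  (w : ℤ) ≤ r.key ∧ (r.val = val ∨ (w : ℤ) ≤ r.prev)

theorem vote_notMem_enterView {n : ℕ} {V : Type*} {Δ now : ℝ} {v : ℕ} {s : State n V} {ph : Phase}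
    {val : V} {w : ℕ} : .vote ph val w ∉ (enterView Δ now v s).1.joinMsgs := by
  simp [enterView, sendAllUponJoin]

section Dominates

variable {V : Type*} [DecidableEq V]

theorem Dominates.set {r : KeyRecord V} {w v : ℕ} {val val' : V} (h : Dominates r w val)
    (hv : r.key ≤ v) : Dominates (r.set v val') w val := by
  unfold KeyRecord.set
  obtain ⟨h1, h2⟩ := h
  split_ifs with hc
  · exact ⟨h1.trans hv, .inr h1⟩
  · exact ⟨h1.trans hv, h2⟩

theorem dominates_set_self (r : KeyRecord V) (v : ℕ) (val : V) : Dominates (r.set v val) v val := by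
  unfold KeyRecord.set
  split_ifs with hc
  · exact ⟨le_rfl, .inl rfl⟩
  · exact ⟨le_rfl, .inl (not_not.1 hc)⟩

end Dominates

namespace Run

variable {n : ℕ} {V : Type*} [DecidableEq V] {f : ℕ} {Δ : ℝ} {R : Run n V f Δ}

/-- What a key record `r` that `i` holds in view `v` tells about the votes of `i` in phase `ph`. -/
structure KeyInv (R : Run n V f Δ) (i : Fin n) (ph : Phase) (k : ℕ) (v : ℕ) (r : KeyRecord V) :
    Prop where
  lt : r.prev < r.key
  nonneg : 0 ≤ r.key
  le : r.key ≤ v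
  key : 0 < r.key → ∃ w : ℕ, r.key = w ∧ R.Cast k i (.vote ph r.val w)
  prev : 0 < r.prev → ∃ w : ℕ, r.prev = w ∧ ∃ val ≠ r.val, R.Cast k i (.vote ph val w)

namespace KeyInv

variable {i : Fin n} {ph : Phase} {k v : ℕ} {r : KeyRecord V}

theorem mono {k' v' : ℕ} (h : R.KeyInv i ph k v r) (hk : k ≤ k') (hv : v ≤ v') :
    R.KeyInv i ph k' v' r := by
  refine ⟨h.lt, h.nonneg, h.le.trans (Int.ofNat_le.2 hv), fun h0 => ?_, fun h0 => ?_⟩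
  · obtain ⟨w, hw, hc⟩ := h.key h0
    exact ⟨w, hw, hc.mono hk⟩
  · obtain ⟨w, hw, val, hval, hc⟩ := h.prev h0
    exact ⟨w, hw, val, hval, hc.mono hk⟩

theorem init {x : V} : R.KeyInv i ph k v ⟨0, x, -1⟩ := by
  constructor <;> simp

theorem set (hi : i ∉ R.faulty) {ph' : Phase} (hn : ph.Next ph') {val : V}
    (h : R.KeyInv i ph' k v r) (hv : 0 < v) (hc : R.Cast k i (.vote ph' val v)) :
    R.KeyInv i ph' k v (r.set v val) := by
  unfold KeyRecord.set
  split_ifs with hval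
  · refine ⟨?_, by simp, le_rfl, fun _ => ⟨v, rfl, hc⟩, fun h0 => ?_⟩
    · refine lt_of_le_of_ne h.le fun he => hval ?_
      replace he : r.key = v := he
      obtain ⟨w, hw, hc'⟩ := h.key (by omega)
      obtain rfl : w = v := by omega
      exact (quorum_of_cast hi hc' hn).unique (quorum_of_cast hi hc hn)
    · obtain ⟨w, hw, hc⟩ := h.key h0
      exact ⟨w, hw, _, hval, hc⟩
  · rw [not_not] at hval
    subst hval
    exact ⟨h.lt.trans_le h.le, by simp, le_rfl, fun _ => ⟨v, rfl, hc⟩, h.prev⟩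

end KeyInv

theorem view_pos {i : Fin n} (hi : i ∉ R.faulty) {k : ℕ} {s : State n V}
    (hs : R.state k i = some s) : 0 < s.view :=
  R.invariant hi (fun _ s => 0 < s.view) (fun _ _ _ _ => Nat.one_pos)
    (fun _ _ _ _ _ _ _ _ _ h ih => ih.trans_le h.le.view) hs

/-- What the keys and the lock in a state of a nonfaulty party tell about its votes. -/
structure KeysInv (R : Run n V f Δ) (i : Fin n) (k : ℕ) (s : State n V) : Prop where
  key1 : R.KeyInv i .key1 k s.view s.key1
  key2 : R.KeyInv i .key2 k s.view s.key2
  key3 : (s.key3 = 0 ∧ s.key3Val = R.input i) ∨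
    ∃ w : ℕ, 0 < w ∧ w ≤ s.view ∧ s.key3 = w ∧ R.Cast k i (.vote .key3 s.key3Val w)
  lock : s.lock = 0 ∨
    ∃ w : ℕ, 0 < w ∧ w ≤ s.view ∧ s.lock = w ∧ R.Cast k i (.vote .lock s.lockVal w)

theorem KeysInv.frame {i : Fin n} {k k' : ℕ} {s s' : State n V} (h : R.KeysInv i k s)
    (hk : k ≤ k') (hv : s.view ≤ s'.view) (h1 : s'.key1 = s.key1) (h2 : s'.key2 = s.key2)
    (h3 : s'.key3 = s.key3) (h3' : s'.key3Val = s.key3Val) (hl : s'.lock = s.lock)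
    (hl' : s'.lockVal = s.lockVal) : R.KeysInv i k' s' := by
  refine ⟨h1 ▸ h.key1.mono hk hv, h2 ▸ h.key2.mono hk hv, ?_, ?_⟩
  · rw [h3, h3']
    exact h.key3.imp_right fun ⟨w, h0, hw, he, hc⟩ => ⟨w, h0, hw.trans hv, he, hc.mono hk⟩
  · rw [hl, hl']
    exact h.lock.imp_right fun ⟨w, h0, hw, he, hc⟩ => ⟨w, h0, hw.trans hv, he, hc.mono hk⟩

theorem keysInv {i : Fin n} (hi : i ∉ R.faulty) {k : ℕ} {s : State n V}
    (hs : R.state k i = some s) : R.KeysInv i k s := by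
  refine R.invariant hi (R.KeysInv i)
    (fun _ _ _ _ => ⟨.init, .init, .inl ⟨rfl, rfl⟩, .inl rfl⟩) ?_ hs
  intro k s s' e o hs hs' _ _ h ih
  have ih' : R.KeysInv i (k + 1) s := ih.frame k.le_succ le_rfl rfl rfl rfl rfl rfl rfl
  have hpos := view_pos hi hs
  have hcast : ∀ m ∈ s'.joinMsgs, R.Cast (k + 1) i m := fun m hm => ⟨k + 1, le_rfl, s', hs', hm⟩
  cases h with
  | abortEnter h ha hw => exact ih.frame k.le_succ (Nat.le_succ_of_le hw) rfl rfl rfl rfl rfl rfl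
  | quorumEcho h hc => exact { ih' with key1 := ih'.key1.set hi .echo hpos (hcast _ (by simp)) }
  | quorumKey1 h hc => exact { ih' with key2 := ih'.key2.set hi .key1 hpos (hcast _ (by simp)) }
  | quorumKey2 h hc =>
    exact { ih' with key3 := .inr ⟨s.view, hpos, le_rfl, rfl, hcast _ (by simp)⟩ }
  | quorumKey3 h hc =>
    exact { ih' with lock := .inr ⟨s.view, hpos, le_rfl, rfl, hcast _ (by simp)⟩ }
  | _ => exact ih'.frame le_rfl le_rfl rfl rfl rfl rfl rfl rfl

theorem not_cast_of_none {i : Fin n} (hi : i ∉ R.faulty) {k : ℕ} {m : Msg V}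
    (hs : R.state k i = none) : ¬ R.Cast k i m := by
  rintro ⟨l, hl, s, hs', -⟩
  obtain ⟨s', h, -⟩ := R.exists_state_of_le hi hl hs'
  cases hs.symm.trans h

theorem cast_succ {i : Fin n} {k : ℕ} {m : Msg V} {s : State n V}
    (hs : R.state (k + 1) i = some s) (h : R.Cast (k + 1) i m) :
    R.Cast k i m ∨ m ∈ s.joinMsgs := by
  obtain ⟨l, hl, s', hs', hm⟩ := h
  rcases hl.lt_or_eq with hl | rfl
  · exact .inl ⟨l, Nat.le_of_lt_succ hl, s', hs', hm⟩
  · cases hs.symm.trans hs'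
    exact .inr hm

theorem not_cast_vote_init {i : Fin n} (hi : i ∉ R.faulty) {k : ℕ} (hs : R.state k i = none)
    (hs' : R.state (k + 1) i = some (R.init k i).1) {ph : Phase} {val : V} {w : ℕ} :
    ¬ R.Cast (k + 1) i (.vote ph val w) := by
  intro h
  rcases cast_succ hs' h with h | h
  · exact not_cast_of_none hi hs h
  · exact vote_notMem_enterView h

theorem view_le_of_cast {i : Fin n} (hi : i ∉ R.faulty) {k : ℕ} {m : Msg V} {v : ℕ}
    {s : State n V} (hs : R.state k i = some s) (h : R.Cast k i m) (hv : m.InView v) :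
    v ≤ s.view := by
  obtain ⟨l, hl, s', hs', hm⟩ := h
  obtain rfl : v = s'.view := hv.unique (inView_of_mem hi hs' _ hm)
  exact (R.state_le hi hl hs' hs).view

/-- The keys and the lock of a nonfaulty party reflect its votes before step `k`. -/
structure VotesInv (R : Run n V f Δ) (i : Fin n) (k : ℕ) (s : State n V) : Prop where
  key1 : ∀ val w, R.Cast k i (.vote .key1 val w) → Dominates s.key1 w val
  key2 : ∀ val w, R.Cast k i (.vote .key2 val w) → Dominates s.key2 w val
  key3 : ∀ val w, R.Cast k i (.vote .key3 val w) → (w : ℤ) ≤ s.key3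
  lock : ∀ val w, R.Cast k i (.vote .lock val w) → (w : ℤ) ≤ s.lock

theorem cast_of_cast_succ {i : Fin n} {k : ℕ} {m : Msg V} {s s' : State n V}
    (hs : R.state k i = some s) (hs' : R.state (k + 1) i = some s')
    (hm : m ∈ s'.joinMsgs → m ∈ s.joinMsgs) (h : R.Cast (k + 1) i m) : R.Cast k i m :=
  (cast_succ hs' h).elim id fun h => ⟨k, le_rfl, s, hs, hm h⟩

theorem dominates_set_of_cast_succ {i : Fin n} {k : ℕ} {s s' : State n V}
    (hs : R.state k i = some s) (hs' : R.state (k + 1) i = some s') {ph : Phase} {val : V} {v : ℕ}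
    (hj : s'.joinMsgs = s.joinMsgs ++ [.vote ph val v]) {r : KeyRecord V} (hr : r.key ≤ v)
    (hdom : ∀ val' w, R.Cast k i (.vote ph val' w) → Dominates r w val') (val' : V) (w : ℕ)
    (h : R.Cast (k + 1) i (.vote ph val' w)) : Dominates (r.set v val) w val' := by
  rcases cast_succ hs' h with h | h
  · exact (hdom val' w h).set hr
  rcases mem_append_vote.1 (hj ▸ h) with h | ⟨-, rfl, rfl⟩
  · exact (hdom val' w ⟨k, le_rfl, s, hs, h⟩).set hr
  · exact dominates_set_self _ _ _

theorem votesInv {i : Fin n} (hi : i ∉ R.faulty) {k : ℕ} {s : State n V}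
    (hs : R.state k i = some s) : R.VotesInv i k s := by
  refine R.invariant hi (R.VotesInv i) ?_ ?_ hs
  · intro k hs hs' _
    have hnot {ph val w} := not_cast_vote_init (ph := ph) (val := val) (w := w) hi hs hs'
    exact ⟨fun _ _ h => (hnot h).elim, fun _ _ h => (hnot h).elim, fun _ _ h => (hnot h).elim,
      fun _ _ h => (hnot h).elim⟩
  intro k s s' e o hs hs' _ _ h ih
  have keep {ph : Phase} {p : V → ℕ → Prop} (ih : ∀ val w, R.Cast k i (.vote ph val w) → p val w)
      (hj : ∀ val w, .vote ph val w ∈ s'.joinMsgs → .vote ph val w ∈ s.joinMsgs) :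
      ∀ val w, R.Cast (k + 1) i (.vote ph val w) → p val w :=
    fun val w h => ih val w (cast_of_cast_succ hs hs' (hj val w) h)
  have present {ph : Phase} (val : V) (w : ℕ) (h : R.Cast (k + 1) i (.vote ph val w)) :
      (w : ℤ) ≤ s'.view := Int.ofNat_le.2 (view_le_of_cast hi hs' h rfl)
  have hkeys := keysInv hi hs
  cases h with
  | quorumEcho =>
    exact ⟨dominates_set_of_cast_succ hs hs' rfl hkeys.key1.le ih.key1, keep ih.key2 (by simp),
      keep ih.key3 (by simp), keep ih.lock (by simp)⟩
  | quorumKey1 =>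
    exact ⟨keep ih.key1 (by simp), dominates_set_of_cast_succ hs hs' rfl hkeys.key2.le ih.key2,
      keep ih.key3 (by simp), keep ih.lock (by simp)⟩
  | quorumKey2 =>
    exact ⟨keep ih.key1 (by simp), keep ih.key2 (by simp), present, keep ih.lock (by simp)⟩
  | quorumKey3 =>
    exact ⟨keep ih.key1 (by simp), keep ih.key2 (by simp), keep ih.key3 (by simp), present⟩
  | abortEnter =>
    exact ⟨keep ih.key1 fun _ _ h => absurd h vote_notMem_enterView,
      keep ih.key2 fun _ _ h => absurd h vote_notMem_enterView,
      keep ih.key3 fun _ _ h => absurd h vote_notMem_enterView,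
      keep ih.lock fun _ _ h => absurd h vote_notMem_enterView⟩
  | _ =>
    exact ⟨keep ih.key1 (by simp), keep ih.key2 (by simp), keep ih.key3 (by simp),
      keep ih.lock (by simp)⟩

/-! ### Proofs -/

theorem view_of_cast {i : Fin n} (hi : i ∉ R.faulty) {k : ℕ} {m : Msg V} {v : ℕ}
    (h : R.Cast k i m) (hv : m.InView v) :
    ∃ l ≤ k, ∃ s, R.state l i = some s ∧ s.view = v ∧ m ∈ s.joinMsgs := by
  obtain ⟨l, hl, s, hs, hm⟩ := h
  exact ⟨l, hl, s, hs, (inView_of_mem hi hs _ hm).unique hv, hm⟩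

theorem Cast.of_view_lt {i : Fin n} (hi : i ∉ R.faulty) {k k' : ℕ} {m : Msg V} {v : ℕ}
    {s : State n V} (h : R.Cast k' i m) (hv : m.InView v) (hs : R.state k i = some s)
    (hlt : v < s.view) : ∃ l < k, R.Cast l i m := by
  obtain ⟨l, -, s', hs', rfl, hm⟩ := view_of_cast hi h hv
  exact ⟨l, R.lt_of_view_lt hi hs' hs hlt, l, le_rfl, s', hs', hm⟩

/-- What a record `r` that `i` sends in a proof of view `v` tells about its earlier votes. -/
structure ProofInv (R : Run n V f Δ) (i : Fin n) (k v : ℕ) (r : KeyRecord V) : Prop where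
  keyInv : R.KeyInv i .key1 k v r
  lt : r.key < v
  dominates : ∀ val w, w < v → R.Cast k i (.vote .key1 val w) → Dominates r w val

theorem proofInv {i : Fin n} (hi : i ∉ R.faulty) {k : ℕ} {s : State n V}
    (hs : R.state k i = some s) :
    ∀ r, .proof r s.view ∈ s.joinMsgs → R.ProofInv i k s.view r := by
  refine R.invariant hi (fun k s => ∀ r, .proof r s.view ∈ s.joinMsgs →
    R.ProofInv i k s.view r) ?_ ?_ hs
  · intro k hs hs' _ r hr
    cases List.mem_singleton.1 hr
    exact ⟨.init, Int.zero_lt_one, fun _ _ _ h => (not_cast_vote_init hi hs hs' h).elim⟩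
  intro k s s' e o hs hs' _ _ h ih
  have old {val w} (hw : w < s'.view) (h : R.Cast (k + 1) i (.vote .key1 val w)) :
      R.Cast k i (.vote .key1 val w) :=
    (cast_succ hs' h).elim id fun h => absurd (inView_of_mem hi hs' _ h) hw.ne
  have frame (hv : s'.view = s.view)
      (hj : ∀ r, .proof r s.view ∈ s'.joinMsgs → .proof r s.view ∈ s.joinMsgs) (r : KeyRecord V)
      (hr : .proof r s'.view ∈ s'.joinMsgs) : R.ProofInv i (k + 1) s'.view r := by
    rw [hv] at hr old ⊢
    have h := ih r (hj r hr)
    exact ⟨h.keyInv.mono k.le_succ le_rfl, h.lt,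
      fun val w hw hc => h.dominates val w hw (old hw hc)⟩
  cases h with
  | abortEnter h ha hw =>
    intro r hr
    cases List.mem_singleton.1 hr
    have hkey := (keysInv hi hs).key1
    have hlt : s.view < kthLargest (n - f) _ + 1 := Nat.lt_succ_of_le hw
    exact ⟨hkey.mono k.le_succ hlt.le, hkey.le.trans_lt (Int.ofNat_lt.2 hlt),
      fun val w hw h => (votesInv hi hs).key1 val w (old hw h)⟩
  | _ => exact frame rfl (by simp)

theorem proofInv_of_received {i j : Fin n} (hi : i ∉ R.faulty) (hj : j ∉ R.faulty) {k : ℕ}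
    {r : KeyRecord V} {v : ℕ} (h : R.Received k i j (.proof r v)) (k' : ℕ) (hk : k ≤ k') :
    R.ProofInv j k' v r := by
  obtain ⟨l, hl, h⟩ := cast_of_received hi hj h (v := v) rfl
  obtain ⟨l', hl', s, hs, rfl, hm⟩ := view_of_cast hj h (v := v) rfl
  have hinv := proofInv hj hs r hm
  refine ⟨hinv.keyInv.mono (by omega) le_rfl, hinv.lt, fun val w hw hc => ?_⟩
  obtain ⟨p, hp, hc⟩ := hc.of_view_lt hj (v := w) rfl hs hw
  exact hinv.dominates val w hw (hc.mono hp.le)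

end Run

/-! ### Agreement -/

section DoneInv

variable {n : ℕ} {V : Type*}

/-- How the `done` messages received and sent are reflected in a state. -/
structure DoneInv (f : ℕ) (s : State n V) : Prop where
  decided : ∀ val, s.decided = some val → n - f ≤ (s.doneFrom val).card
  decide : ∀ val, n - f ≤ (s.doneFrom val).card → s.decided ≠ none
  amplify : ∀ val, f + 1 ≤ (s.doneFrom val).card → s.doneSent = true
  lock : ∀ val, n - f ≤ (s.voteFrom .lock val).card → s.doneSent = true

variable {f : ℕ} {s : State n V}

theorem DoneInv.enterView (hf : f < n) {Δ now : ℝ} {v : ℕ} (h : DoneInv f s) :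
    DoneInv f (enterView Δ now v s).1 where
  decided := h.decided
  decide := h.decide
  amplify := h.amplify
  lock val hc := by
    rw [show ((ITHS.enterView Δ now v s).1.voteFrom .lock val).card = 0 from rfl] at hc
    omega

theorem doneInv_init (hf : f < n) (x : V) : DoneInv f (initState x : State n V) := by
  constructor <;> simp [initState] <;> omega

variable [DecidableEq V] {j : Fin n} {val : V}

theorem DoneInv.done {d : Finset (Fin n)} {b : Bool} (hs : DoneInv f s)
    (h : j ∉ s.doneFrom val) (hd : d = insert j (s.doneFrom val))
    (hb : s.doneSent = true → b = true) (hc : d.card = f + 1 → b = true) :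
    DoneInv f { s with
      doneFrom := Function.update s.doneFrom val d, doneSent := b,
      decided := if d.card = n - f then some val else s.decided } := by
  have hcard : d.card = (s.doneFrom val).card + 1 := by
    rw [hd, Finset.card_insert_of_notMem h]
  constructor <;> simp only [Function.update_apply] <;> intro val' hval'
  · split_ifs at hval' with hn
    · cases hval'
      simp [hn]
    · have := hs.decided val' hval'
      split_ifs with he
      · subst he; omega
      · exact this
  · split_ifs with hn
    · simp
    · split_ifs at hval' with he
      · exact hs.decide val (by omega)
      · exact hs.decide val' hval'
  · split_ifs at hval' with he
    · by_cases hc' : d.card = f + 1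
      · exact hc hc'
      · exact hb (hs.amplify val (by omega))
    · exact hb (hs.amplify val' hval')
  · exact hb (hs.lock val' hval')

theorem DoneInv.vote {ph : Phase} (hs : DoneInv f s) (h : j ∉ s.voteFrom ph val)
    (hc : (insert j (s.voteFrom ph val)).card ≠ n - f) :
    DoneInv f { s with voteFrom := addVote s ph val j } := by
  refine { hs with lock := fun val' h' => ?_ }
  simp only [addVote_apply] at h'
  split_ifs at h' with he
  · obtain ⟨rfl, rfl⟩ := he
    rw [Finset.card_insert_of_notMem h] at hc h'
    exact hs.lock val' (by omega)
  · exact hs.lock val' h'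

end DoneInv

namespace Run

variable {n : ℕ} {V : Type*} [DecidableEq V] {f : ℕ} {Δ : ℝ} {R : Run n V f Δ}

section Locked

variable {k v : ℕ} {val : V}

theorem lock_of_cast_lock {i : Fin n} (hi : i ∉ R.faulty) {K : ℕ} {s : State n V}
    (hK : R.Cast K i (.vote .lock val v)) (hs : R.state k i = some s) (hv : v < s.view)
    (hQ : ∀ ph w val', v ≤ w → R.Quorum k ph val' w → val' = val) :
    0 < s.lock ∧ (v : ℤ) ≤ s.lock ∧ s.lockVal = val := by
  obtain ⟨K', -, sK, hsK, rfl, -⟩ := view_of_cast hi hK rfl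
  have hpos := view_pos hi hsK
  obtain ⟨l, hl, hc⟩ := hK.of_view_lt hi rfl hs hv
  have hle := (votesInv hi hs).lock val sK.view (hc.mono hl.le)
  refine ⟨by omega, hle, ?_⟩
  rcases (keysInv hi hs).lock with h | ⟨w, -, -, hw, hc⟩
  · omega
  · exact hQ .key3 w _ (by omega) (quorum_of_cast hi hc .key3)

theorem not_opened {i : Fin n} (hi : i ∉ R.faulty)
    (hQ : ∀ ph w val', v ≤ w → R.Quorum k ph val' w → val' = val) {v' : ℕ} {l : ℤ} (hl : 0 < l)
    (hv : v ≤ l) : ¬ R.Opened k i v' l val := by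
  rintro ⟨S, hS, hopen⟩
  obtain ⟨j, hj, hjf⟩ := R.exists_mem_not_faulty hS
  obtain ⟨r, hr, h⟩ := hopen j hj
  have hkey := (proofInv_of_received hi hjf hr k le_rfl).keyInv
  have hval (hle : l ≤ r.key) : r.val = val := by
    obtain ⟨w, hw, hc⟩ := hkey.key (by omega)
    exact hQ .echo w _ (by omega) (quorum_of_cast hjf hc .echo)
  rcases h with h | ⟨h, hne⟩
  · obtain ⟨w, hw, val', hne, hc⟩ := hkey.prev (by omega)
    refine hne ?_
    rw [hval (h.trans hkey.lt.le)]
    exact hQ .echo w _ (by omega) (quorum_of_cast hjf hc .echo)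
  · exact hne (hval h)

/-- An opened lock needs a key of another value in a later view, hence a quorum of echoes for that
value. The locked parties meet every quorum, so one of them would have had to echo before. -/
theorem echo_of_locked {L : Finset (Fin n)} (hL : f + 1 ≤ L.card)
    (hlock : ∀ i ∈ L, i ∉ R.faulty ∧ ∃ k, R.Cast k i (.vote .lock val v)) (k : ℕ) :
    ∀ i ∈ L, ∀ v' > v, ∀ val', R.Cast k i (.vote .echo val' v') → val' = val := by
  induction k using Nat.strong_induction_on with
  | _ k ih =>
  intro i hiL v' hv' val' hcast
  obtain ⟨hi, K, hK⟩ := hlock i hiL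
  have hQ (ph w val'') (hw : v ≤ w) (h : R.Quorum k ph val'' w) : val'' = val := by
    rcases hw.eq_or_lt with rfl | hw
    · exact h.unique (quorum_of_cast hi hK .key3)
    · obtain ⟨i', hi', l, hl, hc⟩ := h.echo.exists_mem hL fun i hi => (hlock i hi).1
      exact ih l hl i' hi' w hw val'' hc
  obtain ⟨l, hl, s, hs, rfl, hm⟩ := view_of_cast hi hcast rfl
  obtain ⟨key, l₀, lv, ⟨k', hk', s₀, p, hs₀, hv₀, rfl, rfl, -, -⟩, hreason⟩ :=
    (echoInv hi hs).reason val' hm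
  obtain ⟨hpos, hle, hval⟩ := lock_of_cast_lock hi hK hs₀ (hv₀ ▸ hv')
    fun ph w val'' hw h => hQ ph w val'' hw (h.mono (hk'.le.trans hl))
  rcases hreason with h | h | h
  · omega
  · exact h.trans hval
  · exact absurd (hval ▸ h.mono hl) (not_opened hi hQ hpos hle)

end Locked

theorem lock_quorum_unique_of_lt {k k' : ℕ} {val val' : V} {v v' : ℕ} (h : R.Quorum k .lock val v)
    (h' : R.Quorum k' .lock val' v') (hv : v < v') : val' = val := by
  obtain ⟨L, hL, hlock⟩ := h.exists_voters
  obtain ⟨i, hi, l, -, hc⟩ := h'.echo.exists_mem hL fun j hj => (hlock j hj).1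
  refine echo_of_locked hL (fun i hi => ⟨(hlock i hi).1, ?_⟩) l i hi v' hv val' hc
  obtain ⟨l, -, h⟩ := (hlock i hi).2
  exact ⟨l, h⟩

theorem lock_quorum_unique {k k' : ℕ} {val val' : V} {v v' : ℕ} (h : R.Quorum k .lock val v)
    (h' : R.Quorum k' .lock val' v') : val = val' := by
  rcases lt_trichotomy v v' with hv | rfl | hv
  · exact (lock_quorum_unique_of_lt h h' hv).symm
  · exact h.unique h'
  · exact lock_quorum_unique_of_lt h' h hv

theorem received_of_mem_doneFrom {i : Fin n} (hi : i ∉ R.faulty) {k : ℕ} {s : State n V}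
    (hs : R.state k i = some s) : ∀ j val, j ∈ s.doneFrom val → R.Received k i j (.done val) := by
  refine R.invariant hi (fun k s => ∀ j val, j ∈ s.doneFrom val → R.Received k i j (.done val))
    ?_ ?_ hs
  · intro k _ _ _ j val hj
    cases hj
  intro k s s' e o _ _ he _ h ih
  have ih' := fun j val hj => (ih j val hj).mono k.le_succ
  cases h with
  | done h hd ho =>
    intro j' val' hj'
    subst hd
    simp only [Function.update_apply] at hj'
    split_ifs at hj' with hc
    · subst hc
      rcases Finset.mem_insert.1 hj' with rfl | hj'
      · exact ⟨k, k.lt_succ_self, he⟩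
      · exact ih' _ _ hj'
    · exact ih' _ _ hj'
  | _ => exact ih'

theorem quorum_of_done {k : ℕ} : ∀ {i p : Fin n} {val : V}, i ∉ R.faulty →
    .done val ∈ R.sent k i p → ∃ k' v, R.Quorum k' .lock val v := by
  induction k using Nat.strong_induction_on with
  | _ k ih =>
  intro i p val hi hm
  generalize h : Msg.done val = m at hm
  cases sentBy_of_mem hi hm with
  | join hs hj hm => subst h; exact (inView_of_mem hi hs _ hm).elim
  | lock hs hc ho =>
    cases h
    exact ⟨_, _, quorum_of_voteFrom hi hs hc⟩
  | done hs hc ho =>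
    cases h
    obtain ⟨j, hj, hjf⟩ := R.exists_mem_not_faulty hc
    obtain ⟨l, hl, l', hl', h⟩ := (received_of_mem_doneFrom hi hs j _ hj).exists_sent_lt hi hjf
    exact ih l' (by omega) hjf h
  | _ => cases h

theorem doneInv {i : Fin n} (hi : i ∉ R.faulty) {k : ℕ} {s : State n V}
    (hs : R.state k i = some s) : DoneInv f s := by
  refine R.invariant hi (fun _ s => DoneInv f s)
    (fun _ _ _ _ => (doneInv_init R.lt_card _).enterView R.lt_card) ?_ hs
  intro k s s' e o _ _ _ _ h ih
  cases h with
  | abortEnter => exact DoneInv.enterView (s := { s with highestAbort := _ }) R.lt_card { ih with }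
  | done h hd ho =>
    rcases ho with ⟨-, -, rfl, -⟩ | ⟨hc, rfl, -⟩
    · exact ih.done h hd (fun _ => rfl) fun _ => rfl
    · exact ih.done h hd id hc
  | vote h hc => exact ih.vote h hc
  | quorumEcho | quorumKey1 | quorumKey2 | quorumKey3 =>
    exact { ih with lock := fun val' h' => ih.lock val' (by simpa [addVote_apply] using h') }
  | quorumLock => exact { ih with lock := fun _ _ => rfl, amplify := fun _ _ => rfl }
  | _ => exact { ih with }

theorem quorum_of_decided {i : Fin n} (hi : i ∉ R.faulty) {k : ℕ} {s : State n V}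
    (hs : R.state k i = some s) {val : V} (h : s.decided = some val) :
    ∃ k v, R.Quorum k .lock val v := by
  have hlt := R.three_mul_lt
  have hc := (doneInv hi hs).decided val h
  obtain ⟨j, hj, hjf⟩ := R.exists_mem_not_faulty (S := s.doneFrom val) (by omega)
  obtain ⟨l, -, l', -, h⟩ := (received_of_mem_doneFrom hi hs j _ hj).exists_sent_lt hi hjf
  exact quorum_of_done hjf h

end Run

/-! ### Suggestions and proposals -/

section Suggestions

variable {n : ℕ} {V : Type*}

theorem key2Proofs_eq_some {s : State n V} {j : Fin n} {r : KeyRecord V} :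
    key2Proofs s j = some r ↔
      ∃ kv, s.suggestFrom j = some (kv, r) ∧ r.prev < r.key ∧ r.key < s.view := by
  unfold key2Proofs
  rcases s.suggestFrom j with _ | ⟨kv, r'⟩
  · simp
  · simp only [Option.some.injEq, ite_eq_iff, Prod.mk.injEq]
    constructor
    · rintro (⟨h, rfl⟩ | ⟨_, h⟩)
      · exact ⟨kv, ⟨rfl, rfl⟩, h⟩
      · cases h
    · rintro ⟨_, ⟨rfl, rfl⟩, h⟩
      exact .inl ⟨h, rfl⟩

variable [DecidableEq V] {f : ℕ}

theorem suggestions_eq_some {s : State n V} {j : Fin n} {k : ℤ} {v : V} :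
    suggestions f s j = some (k, v) ↔ (∃ r, s.suggestFrom j = some ((k, v), r)) ∧
      (k = 0 ∨ (k < s.view ∧ acceptKey f k v (key2Proofs s))) := by
  unfold suggestions
  rcases s.suggestFrom j with _ | ⟨⟨k', v'⟩, r'⟩
  · simp
  · simp only [Option.some.injEq, ite_eq_iff, Prod.mk.injEq]
    constructor
    · rintro (⟨h, rfl, rfl⟩ | ⟨_, h⟩)
      · exact ⟨⟨r', ⟨rfl, rfl⟩, rfl⟩, h⟩
      · cases h
    · rintro ⟨⟨_, ⟨rfl, rfl⟩, rfl⟩, h⟩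
      exact .inl ⟨h, rfl, rfl⟩

theorem suggestions_congr {s s' : State n V} (hv : s'.view = s.view)
    (hs : s'.suggestFrom = s.suggestFrom) : suggestions f s' = suggestions f s := by
  have : key2Proofs s' = key2Proofs s := by
    funext j
    simp only [key2Proofs, hv, hs]
  funext j
  simp only [suggestions, hv, hs, this]

end Suggestions

namespace Run

variable {n : ℕ} {V : Type*} [DecidableEq V] {f : ℕ} {Δ : ℝ} {R : Run n V f Δ}

/-- `(key, val)` is a suggestion with maximal key among at least `n - f` accepted suggestions that
party `i` has received in view `v` before step `k`, and which `s` records. -/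
structure Proposal (R : Run n V f Δ) (k : ℕ) (i : Fin n) (v : ℕ) (key : ℤ) (val : V)
    (s : State n V) : Prop where
  view : s.view = v
  received : ∀ j k3 v3 r, s.suggestFrom j = some ((k3, v3), r) →
    R.Received k i j (.suggest k3 v3 r v)
  card : n - f ≤ (Finset.univ.filter fun l => (suggestions f s l).isSome).card
  mem : ∃ l, suggestions f s l = some (key, val)
  le : ∀ l kv, suggestions f s l = some kv → kv.1 ≤ key

theorem Proposal.mono {k k' : ℕ} {i : Fin n} {v : ℕ} {key : ℤ} {val : V} {s : State n V}
    (h : R.Proposal k i v key val s) (hk : k ≤ k') : R.Proposal k' i v key val s :=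
  { h with received := fun j k3 v3 r hr => (h.received j k3 v3 r hr).mono hk }

/-- What the recorded suggestions and the proposal in the state `s` of party `i` before step `k`
say about the run: a proposal is made at most once, and as soon as `n - f` suggestions are
accepted. -/
structure ProposeInv (R : Run n V f Δ) (i : Fin n) (k : ℕ) (s : State n V) : Prop where
  received : ∀ j k3 v3 r, s.suggestFrom j = some ((k3, v3), r) →
    R.Received k i j (.suggest k3 v3 r s.view)
  proposed : (∃ key val, .propose key val s.view ∈ s.joinMsgs) ↔ s.proposed = true
  unique : ∀ key val key' val', .propose key val s.view ∈ s.joinMsgs →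
    .propose key' val' s.view ∈ s.joinMsgs → key = key' ∧ val = val'
  reason : ∀ key val, .propose key val s.view ∈ s.joinMsgs →
    ∃ s₁, R.Proposal k i s.view key val s₁
  waiting : s.proposed = false →
    (Finset.univ.filter fun l => (suggestions f s l).isSome).card < n - f

namespace ProposeInv

variable {i : Fin n} {k : ℕ} {s : State n V}

theorem frame {k' : ℕ} {s' : State n V} (h : R.ProposeInv i k s) (hk : k ≤ k')
    (hv : s'.view = s.view) (hs : s'.suggestFrom = s.suggestFrom)
    (hp : s'.proposed = s.proposed)
    (hj : ∀ key val, .propose key val s.view ∈ s'.joinMsgs ↔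
      .propose key val s.view ∈ s.joinMsgs) : R.ProposeInv i k' s' := by
  constructor
  · rw [hs, hv]
    exact fun j k3 v3 r hr => (h.received j k3 v3 r hr).mono hk
  · simp only [hv, hj, hp]
    exact h.proposed
  · simp only [hv, hj]
    exact h.unique
  · simp only [hv, hj]
    intro key val hm
    obtain ⟨s₁, h⟩ := h.reason key val hm
    exact ⟨s₁, h.mono hk⟩
  · rw [hp, suggestions_congr hv hs]
    exact h.waiting

theorem of_enterView {now : ℝ} {v : ℕ} : R.ProposeInv i k (enterView Δ now v s).1 := by
  have hf := R.lt_card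
  constructor
  case waiting =>
    intro _
    rw [Finset.filter_false_of_mem]
    · simpa using hf
    · intro l _
      simp [suggestions, enterView, sendAllUponJoin]
  all_goals simp [enterView, sendAllUponJoin]

theorem received_recordSuggest {j : Fin n} {k3 : ℤ} {v3 : V} {r : KeyRecord V}
    (h : R.ProposeInv i k s) (he : R.event k = .recv i j (.suggest k3 v3 r s.view)) (j' : Fin n)
    (k3' : ℤ) (v3' : V) (r' : KeyRecord V)
    (hj' : (s.recordSuggest j ((k3, v3), r)).suggestFrom j' = some ((k3', v3'), r')) :
    R.Received (k + 1) i j' (.suggest k3' v3' r' s.view) := by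
  simp only [Function.update_apply] at hj'
  split_ifs at hj' with hj
  · cases hj'
    subst hj
    exact ⟨k, k.lt_succ_self, he⟩
  · exact (h.received j' k3' v3' r' hj').mono k.le_succ

theorem of_proposal {s' : State n V} {key : ℤ} {val : V} (hv : s'.view = s.view)
    (hnew : ∀ key val, .propose key val s.view ∉ s.joinMsgs)
    (hj : s'.joinMsgs = s.joinMsgs ++ [.propose key val s.view]) (hp : s'.proposed = true)
    {s₁ : State n V} (hs : s'.suggestFrom = s₁.suggestFrom)
    (h : R.Proposal k i s.view key val s₁) : R.ProposeInv i k s' := by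
  have hmem : ∀ key' val', .propose key' val' s'.view ∈ s'.joinMsgs ↔
      key' = key ∧ val' = val := by
    intro key' val'
    simp [hv, hj, hnew]
  refine ⟨?_, ⟨fun _ => hp, fun _ => ⟨key, val, (hmem _ _).2 ⟨rfl, rfl⟩⟩⟩, ?_, ?_, ?_⟩
  · rw [hs, hv]
    exact h.received
  · intro key₁ val₁ key₂ val₂ h₁ h₂
    obtain ⟨rfl, rfl⟩ := (hmem _ _).1 h₁
    obtain ⟨rfl, rfl⟩ := (hmem _ _).1 h₂
    exact ⟨rfl, rfl⟩
  · intro key₁ val₁ h₁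
    obtain ⟨rfl, rfl⟩ := (hmem _ _).1 h₁
    exact ⟨s₁, hv ▸ h⟩
  · exact fun h => absurd (hp.symm.trans h) nofun

end ProposeInv

theorem proposeInv {i : Fin n} (hi : i ∉ R.faulty) {k : ℕ} {s : State n V}
    (hs : R.state k i = some s) : R.ProposeInv i k s := by
  refine R.invariant hi (R.ProposeInv i) (fun _ _ _ _ => .of_enterView) ?_ hs
  intro k s s' e o _ _ he _ h ih
  cases h with
  | abortEnter => exact .of_enterView
  | suggest hi h hq =>
    refine ⟨ih.received_recordSuggest he, ih.proposed, ih.unique, fun key val hm => ?_, hq⟩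
    obtain ⟨s₁, h⟩ := ih.reason key val hm
    exact ⟨s₁, h.mono k.le_succ⟩
  | propose hi h hp hq hpick hmax =>
    have hnew : ∀ key val, .propose key val s.view ∉ s.joinMsgs := fun key val hm =>
      Bool.false_ne_true (hp.symm.trans (ih.proposed.1 ⟨key, val, hm⟩))
    exact .of_proposal (s := s) rfl hnew rfl rfl rfl
      ⟨rfl, ih.received_recordSuggest he, hq, hpick, hmax⟩
  | _ => exact ih.frame k.le_succ rfl rfl rfl (by simp)

theorem propose_unique {i : Fin n} (hi : i ∉ R.faulty) {k k' : ℕ} {key key' : ℤ} {val val' : V}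
    {v : ℕ} (h : R.Cast k i (.propose key val v)) (h' : R.Cast k' i (.propose key' val' v)) :
    key = key' ∧ val = val' := by
  obtain ⟨l, -, s, hs, rfl, hm, hm'⟩ := cast_common hi h h' rfl rfl
  exact (proposeInv hi hs).unique key val key' val' hm hm'

theorem suggest_of_received {i j : Fin n} (hi : i ∉ R.faulty) (hj : j ∉ R.faulty) {k : ℕ}
    {k3 : ℤ} {v3 : V} {r : KeyRecord V} {v : ℕ} (h : R.Received k i j (.suggest k3 v3 r v)) :
    ∃ k' < k, ∃ s, R.state k' j = some s ∧ s.view = v ∧ s.key3 = k3 ∧ s.key3Val = v3 ∧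
      s.key2 = r := by
  obtain ⟨k', hk', l, hl, h⟩ := h.exists_sent_lt hi hj
  obtain ⟨s, hs, h1, -, h2⟩ := suggest_of_sent hj h
  exact ⟨l + 1, by omega, s, hs, h1, h2⟩

theorem propose_of_echo {i : Fin n} (hi : i ∉ R.faulty) {k : ℕ} {val : V} {v : ℕ}
    (h : R.Cast k i (.vote .echo val v)) :
    ∃ p key, IsPrimary p v ∧ R.Received k i p (.propose key val v) := by
  obtain ⟨l, hl, s, hs, rfl, hm⟩ := view_of_cast hi h rfl
  obtain ⟨key, l0, lv, ⟨k', _, s0, p, -, -, -, -, hp, hr⟩, -⟩ := (echoInv hi hs).reason val hm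
  exact ⟨p, key, hp, hr.mono hl⟩

theorem proposal_of_cast {i : Fin n} (hi : i ∉ R.faulty) {k : ℕ} {key : ℤ} {val : V} {v : ℕ}
    (h : R.Cast k i (.propose key val v)) : ∃ s, R.Proposal k i v key val s := by
  obtain ⟨l, hl, s, hs, rfl, hm⟩ := view_of_cast hi h rfl
  obtain ⟨s₁, h⟩ := (proposeInv hi hs).reason key val hm
  exact ⟨s₁, h.mono hl⟩

/-! ### Validity -/

theorem echo_val_of_key3Val (hfaulty : R.faulty = ∅) {x : V} {k : ℕ}
    (hk : ∀ k' < k, ∀ i s, R.state k' i = some s → s.key3Val = x) {i : Fin n} {val : V} {v : ℕ}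
    (h : R.Cast k i (.vote .echo val v)) : val = x := by
  have hnf : ∀ i, i ∉ R.faulty := fun i => hfaulty ▸ Finset.notMem_empty i
  obtain ⟨p, key, -, hr⟩ := propose_of_echo (hnf i) h
  obtain ⟨k₁, hk₁, hc⟩ := cast_of_received (hnf i) (hnf p) hr (v := v) rfl
  obtain ⟨s₁, hs₁⟩ := proposal_of_cast (hnf p) hc
  obtain ⟨l, hl⟩ := hs₁.mem
  obtain ⟨⟨r, hr⟩, -⟩ := suggestions_eq_some.1 hl
  obtain ⟨k₂, hk₂, s₂, hs₂, -, -, h3, -⟩ :=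
    suggest_of_received (hnf p) (hnf l) (hs₁.received l _ _ r hr)
  exact h3.symm.trans (hk k₂ (by omega) l s₂ hs₂)

theorem key3Val_eq (hfaulty : R.faulty = ∅) {x : V} (hx : ∀ i, R.input i = x) (k : ℕ) :
    ∀ i s, R.state k i = some s → s.key3Val = x := by
  have hnf : ∀ i, i ∉ R.faulty := fun i => hfaulty ▸ Finset.notMem_empty i
  induction k using Nat.strong_induction_on with
  | _ k ih =>
  intro i s hs
  rcases (keysInv (hnf i) hs).key3 with ⟨-, h⟩ | ⟨w, -, -, -, hc⟩
  · exact h.trans (hx i)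
  · obtain ⟨j, -, l, hl, h⟩ := (quorum_of_cast (hnf i) hc .key2).echo.exists_voter
    exact echo_val_of_key3Val hfaulty (fun k' hk' => ih k' (by omega)) h

theorem decided_eq (hfaulty : R.faulty = ∅) {x : V} (hx : ∀ i, R.input i = x) {i : Fin n}
    {k : ℕ} {s : State n V} (hs : R.state k i = some s) {val : V} (h : s.decided = some val) :
    val = x := by
  have hi : i ∉ R.faulty := hfaulty ▸ Finset.notMem_empty i
  obtain ⟨k, v, hq⟩ := quorum_of_decided hi hs h
  obtain ⟨j, -, l, -, h⟩ := hq.echo.exists_voter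
  exact echo_val_of_key3Val hfaulty (fun k' _ => key3Val_eq hfaulty hx k') h

end Run

/-! ### Delivery of messages -/

section Effect

variable {n : ℕ} {V : Type*} {f : ℕ} {i j : Fin n}

theorem AbortUpdate.le_update {v : ℕ} {a a' : Fin n → ℕ} {o : Outbox n (Msg V)}
    (h : AbortUpdate f i j v a a' o) : v ≤ a' j := by
  cases h with
  | keep => rw [Function.update_self]
  | raise u hu h =>
    rw [Function.update_apply]
    split_ifs with hij
    · subst hij
      exact (Function.update_self j v a ▸ h).le
    · rw [Function.update_self]

variable {s s' : State n V} {m : Msg V}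

theorem Stale.of_le (h : Stale i j s m) (hle : s.Le s') (hv : s.view = s'.view) :
    Stale i j s' m := by
  cases m with
  | request => exact h.trans (hle.request j)
  | abort => exact h.trans (hle.abort j)
  | done val => exact hle.doneFrom val h
  | suggest =>
    intro he hp
    obtain ⟨x, hx⟩ := Option.ne_none_iff_exists'.1 (h (he.trans hv.symm) (hv ▸ hp))
    exact Option.ne_none_iff_exists'.2 ⟨x, hle.suggest hv j x hx⟩
  | proof =>
    intro he
    obtain ⟨x, hx⟩ := Option.ne_none_iff_exists'.1 (h (he.trans hv.symm))
    exact Option.ne_none_iff_exists'.2 ⟨x, hle.proof hv j x hx⟩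
  | propose => exact fun he hp => hle.proposalSeen hv (h (he.trans hv.symm) (hv ▸ hp))
  | vote ph val => exact fun he => hle.vote hv ph val (h (he.trans hv.symm))

variable [DecidableEq V] {Δ now : ℝ} {o : Outbox n (Msg V)}

theorem Transition.stale_of_recv (h : Transition f Δ now i s (.recv i j m) s' o)
    (hd : s.decided = none) : Stale i j s' m := by
  have hvote (ph : Phase) (val : V) : j ∈ addVote s ph val j ph val := by simp [addVote_apply]
  cases h with
  | idle h => exact h hd j m rfl
  | request => simp [Stale]
  | abortStay h ha => exact ha.le_update
  | abortEnter h ha => exact ha.le_update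
  | done h hd => simp [Stale, hd]
  | suggest => exact fun _ _ => by simp
  | propose => exact fun _ _ => by simp
  | proof => exact fun _ => by simp
  | proofOpen => exact fun _ => by simp
  | _ => first | exact fun _ => hvote _ _ | exact fun _ _ => rfl

end Effect

namespace Run

variable {n : ℕ} {V : Type*} [DecidableEq V] {f : ℕ} {Δ : ℝ} {R : Run n V f Δ}

theorem exists_state_upTo {i : Fin n} (hi : i ∉ R.faulty) {T : ℝ} (hT : R.GST ≤ T) :
    ∃ s, R.state (R.upTo T) i = some s := by
  obtain ⟨k, he, ht⟩ := R.exec.starts i hi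
  have : ∃ s, R.state (k + 1) i = some s := by
    rcases hs : R.state k i with _ | s
    · rcases R.step_of_none hi hs with ⟨h, -⟩ | ⟨h, -⟩
      · exact absurd he h
      · exact ⟨_, h⟩
    · obtain ⟨s', hs', -⟩ := R.transition hi hs
      exact ⟨s', hs'⟩
  obtain ⟨s, hs⟩ := this
  obtain ⟨s', hs', -⟩ := R.exists_state_of_le hi (R.exec.lt_upTo.2 (ht.trans hT)) hs
  exact ⟨s', hs'⟩

/-- Party `i` never decides. -/
def Undecided (R : Run n V f Δ) (i : Fin n) : Prop :=
  ∀ k s, R.state k i = some s → s.decided = none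

theorem exists_state_of_recv {i j : Fin n} (hi : i ∉ R.faulty) {k : ℕ} {m : Msg V}
    (he : R.event k = .recv i j m) : ∃ s, R.state k i = some s := by
  have h := R.exec.step k i hi
  unfold event at he
  unfold state
  generalize R.exec.event k = e at he h
  generalize R.exec.state k i = s at h ⊢
  generalize R.exec.state (k + 1) i = s' at h
  generalize R.exec.sent k i = o at h
  cases h with
  | recv => exact ⟨_, rfl⟩
  | terminated => exact ⟨_, rfl⟩
  | other h => exact absurd (congrArg Event.party he) h
  | _ => cases he

theorem stale_of_event {i j : Fin n} (hi : i ∉ R.faulty) (hu : R.Undecided i) {k : ℕ}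
    {m : Msg V} (he : R.event k = .recv i j m) :
    ∃ s, R.state (k + 1) i = some s ∧ Stale i j s m := by
  obtain ⟨s, hs⟩ := exists_state_of_recv hi he
  obtain ⟨s', hs', h⟩ := R.transition hi hs
  rw [he] at h
  exact ⟨s', hs', h.stale_of_recv (hu k s hs)⟩

/-! ### Aborts -/

/-- Before step `k`, party `i` has sent to all parties an abort message for view `x` or later. -/
def Aborted (R : Run n V f Δ) (k : ℕ) (i : Fin n) (x : ℕ) : Prop :=
  ∃ l < k, ∃ y ≥ x, ∀ p, .abort y ∈ R.sent l i p

theorem Aborted.mono {k k' : ℕ} {i : Fin n} {x : ℕ} (h : R.Aborted k i x) (hk : k ≤ k') :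
    R.Aborted k' i x :=
  let ⟨l, hl, h⟩ := h
  ⟨l, hl.trans_le hk, h⟩

theorem abort_mem_sent {i j : Fin n} (hi : i ∉ R.faulty) {k y : ℕ}
    (hm : .abort y ∈ R.sent k i j) (p : Fin n) : .abort y ∈ R.sent k i p := by
  generalize h : (Msg.abort y : Msg V) = m at hm
  cases sentBy_of_mem hi hm with
  | join hs hj hm => subst h; exact (inView_of_mem hi hs _ hm).elim
  | timeout hs hd hnow ho =>
    cases h
    exact ho p
  | abort hs he hu ho =>
    cases h
    exact ho p
  | _ => cases h

theorem aborted_of_event {i j : Fin n} (hi : i ∉ R.faulty) (hj : j ∉ R.faulty) {k v : ℕ}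
    (he : R.event k = .recv i j (.abort v)) : R.Aborted k j v := by
  obtain ⟨l, hl, hm⟩ := R.exec.authentic k i j _ hi hj he
  exact ⟨l, hl, v, le_rfl, abort_mem_sent hj hm⟩

/-- What the abort messages recorded in the state `s` of party `i` before step `k` say about the
run: `i` amplifies aborts, advances with `n - f` of them, and only then. -/
structure AbortInv (R : Run n V f Δ) (i : Fin n) (k : ℕ) (s : State n V) : Prop where
  amplified : ∀ x, f + 1 ≤ (Finset.univ.filter fun l => x ≤ s.highestAbort l).card →
    x ≤ s.highestAbort i
  advanced : ∀ x, n - f ≤ (Finset.univ.filter fun l => x ≤ s.highestAbort l).card → x < s.view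
  reason : n - f ≤ (Finset.univ.filter fun l => s.view ≤ s.highestAbort l + 1).card
  aborted : ∀ q x, q ∉ R.faulty → 0 < x → x ≤ s.highestAbort q → R.Aborted k q x

namespace AbortInv

variable {i : Fin n} {k : ℕ} {s : State n V}

theorem frame {k' : ℕ} {s' : State n V} (h : R.AbortInv i k s) (hk : k ≤ k')
    (hv : s'.view = s.view) (ha : s'.highestAbort = s.highestAbort) : R.AbortInv i k' s' := by
  constructor
  · rw [ha]; exact h.amplified
  · rw [ha, hv]; exact h.advanced
  · rw [ha, hv]; exact h.reason
  · rw [ha]; exact fun q x hq h0 hx => (h.aborted q x hq h0 hx).mono hk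

theorem of_init (ha : s.highestAbort = 0) (hv : s.view = 1) : R.AbortInv i k s := by
  have hf := R.lt_card
  have hcard {x m : ℕ} (hm : 0 < m)
      (h : m ≤ (Finset.univ.filter fun l => x ≤ s.highestAbort l).card) : x = 0 := by
    obtain ⟨l, hl⟩ := Finset.card_pos.1 (hm.trans_le h)
    simpa [ha] using (Finset.mem_filter.1 hl).2
  constructor
  · exact fun x hx => (hcard f.succ_pos hx).trans_le (Nat.zero_le _)
  · exact fun x hx => by rw [hcard (by omega) hx, hv]; exact Nat.one_pos
  · simp [ha, hv]
  · intro q x _ h0 hx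
    simp only [ha, Pi.zero_apply] at hx
    omega

theorem aborted_update {j : Fin n} {v : ℕ} {a : Fin n → ℕ} {o : Outbox n (Msg V)}
    (h : R.AbortInv i k s) (hi : i ∉ R.faulty) (he : R.event k = .recv i j (.abort v))
    (ha : AbortUpdate f i j v s.highestAbort a o) (ho : ∀ p, o p ⊆ R.sent k i p) (q : Fin n)
    (x : ℕ) (hq : q ∉ R.faulty) (h0 : 0 < x) (hx : x ≤ a q) : R.Aborted (k + 1) q x := by
  have of_le (hx : x ≤ Function.update s.highestAbort j v q) : R.Aborted (k + 1) q x := by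
    rw [Function.update_apply] at hx
    split_ifs at hx with hqj
    · subst hqj
      obtain ⟨l, hl, y, hy, hm⟩ := aborted_of_event hi hq he
      exact ⟨l, hl.trans k.lt_succ_self, y, hx.trans hy, hm⟩
    · exact (h.aborted q x hq h0 hx).mono k.le_succ
  cases ha with
  | keep => exact of_le hx
  | raise u =>
    rw [Function.update_apply] at hx
    split_ifs at hx with hqi
    · subst hqi
      exact ⟨k, k.lt_succ_self, u, hx, fun p => ho p (List.mem_singleton.2 rfl)⟩
    · exact of_le hx

end AbortInv

theorem abortInv {i : Fin n} (hi : i ∉ R.faulty) {k : ℕ} {s : State n V}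
    (hs : R.state k i = some s) : R.AbortInv i k s := by
  have hf := R.lt_card
  have hle (a : Fin n → ℕ) (x : ℕ) := le_kthLargest_iff (k := n - f) (by omega) (by omega) a x
  refine R.invariant hi (R.AbortInv i) (fun _ _ _ _ => .of_init rfl rfl) ?_ hs
  intro k s s' e o _ _ he ho h ih
  cases h with
  | abortStay h ha hw =>
    refine ⟨fun _ => ha.le_self hf, fun x hx => ((hle _ x).2 hx).trans_lt hw, ?_,
      ih.aborted_update hi he ha fun p m hm => ho ▸ hm⟩
    refine ih.reason.trans (Finset.card_le_card ?_)
    exact Finset.monotone_filter_right _ fun l _ hl => hl.trans (Nat.succ_le_succ (ha.le h l))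
  | @abortEnter _ _ a _ h ha hw =>
    refine ⟨fun _ => ha.le_self hf, fun x hx => Nat.lt_succ_of_le ((hle _ x).2 hx), ?_,
      ih.aborted_update hi he ha fun p m hm => ho ▸ List.mem_append_left _ hm⟩
    simpa [enterView, sendAllUponJoin] using (hle a _).1 le_rfl
  | _ => exact ih.frame k.le_succ rfl rfl

theorem timeout_of_abort {k : ℕ} : ∀ {i p : Fin n} {y : ℕ}, i ∉ R.faulty → 0 < y →
    .abort y ∈ R.sent k i p → ∃ l ≤ k, ∃ q s d, q ∉ R.faulty ∧ R.state l q = some s ∧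
      s.timer = some d ∧ d ≤ R.now l q ∧ y ≤ s.view := by
  induction k using Nat.strong_induction_on with
  | _ k ih =>
  intro i p y hi hy hm
  generalize h : (Msg.abort y : Msg V) = m at hm
  cases sentBy_of_mem hi hm with
  | join hs hj hm => subst h; exact (inView_of_mem hi hs _ hm).elim
  | timeout hs hd hnow =>
    cases h
    exact ⟨k, le_rfl, i, _, _, hi, hs, hd, hnow, le_rfl⟩
  | @abort s j v u hs he hu =>
    cases h
    obtain ⟨q, hq, hqf⟩ := R.exists_mem_not_faulty hu
    replace hq := (Finset.mem_filter.1 hq).2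
    have haborted : R.Aborted k q y := by
      rw [Function.update_apply] at hq
      split_ifs at hq with hqj
      · subst hqj
        obtain ⟨l, hl, z, hz, h⟩ := aborted_of_event hi hqf he
        exact ⟨l, hl, z, hq.trans hz, h⟩
      · exact (abortInv hi hs).aborted q y hqf hy hq
    obtain ⟨l, hl, z, hz, h⟩ := haborted
    obtain ⟨l', hl', q', s', d, hq', hs', hd, hnow, hv⟩ := ih l hl hqf (hy.trans_le hz) (h p)
    exact ⟨l', hl'.trans hl.le, q', s', d, hq', hs', hd, hnow, hz.trans hv⟩
  | _ => cases h

theorem aborted_of_lt_view {i : Fin n} (hi : i ∉ R.faulty) {k : ℕ} {s : State n V}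
    (hs : R.state k i = some s) {x : ℕ} (hx : 0 < x) (hv : x < s.view) :
    ∃ H : Finset (Fin n), f + 1 ≤ H.card ∧ ∀ q ∈ H, q ∉ R.faulty ∧ R.Aborted k q x := by
  have h := abortInv hi hs
  refine ⟨_, R.card_sdiff_faulty h.reason, fun q hq => ?_⟩
  simp only [Finset.mem_sdiff, Finset.mem_filter, Finset.mem_univ, true_and] at hq
  exact ⟨hq.2, h.aborted q x hq.2 hx (by omega)⟩

theorem le_highestAbort_of_aborted {i q : Fin n} (hi : i ∉ R.faulty) (hu : R.Undecided i)
    (hq : q ∉ R.faulty) {k x : ℕ} {T : ℝ} (hk : k ≤ R.upTo T) (hT : R.GST ≤ T)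
    (h : R.Aborted k q x) {s : State n V} (hs : R.state (R.upTo (T + Δ)) i = some s) :
    x ≤ s.highestAbort q := by
  obtain ⟨l, hl, y, hy, h⟩ := h
  obtain ⟨k', -, hk', he⟩ := R.exec.exists_event_recv hq hi (hl.trans_le hk) hT (h i)
  obtain ⟨s', hs', hle⟩ := stale_of_event hi hu he
  exact hy.trans (le_trans hle ((R.state_le hi hk' hs' hs).abort q))

/-- Of the `n - f` parties whose aborts led to the view, `f + 1` are nonfaulty; after `Δ` these
aborts have been amplified by every nonfaulty party, and after another `Δ` everyone advances. -/
theorem view_le_of_undecided (hu : ∀ i, i ∉ R.faulty → R.Undecided i) {i : Fin n}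
    (hi : i ∉ R.faulty) {k : ℕ} {T : ℝ} (hk : k ≤ R.upTo T) (hT : R.GST ≤ T) {s : State n V}
    (hs : R.state k i = some s) {q : Fin n} (hq : q ∉ R.faulty) {s' : State n V}
    (hs' : R.state (R.upTo (T + Δ + Δ)) q = some s') : s.view ≤ s'.view := by
  have hT' : R.GST ≤ T + Δ := by linarith [R.delay_pos]
  have hvpos := view_pos hq hs'
  by_contra hlt
  obtain ⟨x, hx⟩ : ∃ x, s.view = x + 1 := Nat.exists_eq_add_of_lt (by omega : 0 < s.view) |>.imp
    fun _ h => by omega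
  have hx0 : 0 < x := by omega
  obtain ⟨H, hH, hab⟩ := aborted_of_lt_view hi hs hx0 (by omega)
  have hall : ∀ p, p ∉ R.faulty → R.Aborted (R.upTo (T + Δ)) p x := by
    intro p hp
    obtain ⟨sp, hsp⟩ := exists_state_upTo hp hT'
    have hinv := abortInv hp hsp
    refine hinv.aborted p x hp hx0 (hinv.amplified x (hH.trans (Finset.card_le_card ?_)))
    exact fun p' hp' => Finset.mem_filter.2 ⟨Finset.mem_univ _,
      le_highestAbort_of_aborted hp (hu p hp) (hab p' hp').1 hk hT (hab p' hp').2 hsp⟩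
  have := (abortInv hq hs').advanced x (R.card_compl_faulty.trans (Finset.card_le_card fun p hp =>
    have hp := Finset.mem_compl.1 hp
    Finset.mem_filter.2 ⟨Finset.mem_univ _,
      le_highestAbort_of_aborted hq (hu q hq) hp le_rfl hT' (hall p hp) hs'⟩))
  omega

end Run

/-! ### Alarms -/

theorem Transition.timer_eq {n : ℕ} {V : Type*} [DecidableEq V] {f : ℕ} {Δ now : ℝ} {i : Fin n}
    {s s' : State n V} {e : Event n (Msg V)} {o : Outbox n (Msg V)}
    (h : Transition f Δ now i s e s' o) :
    s'.timer = s.timer ∨ s'.timer = none ∨ s.view < s'.view := by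
  cases h with
  | abortEnter h ha hw => exact .inr (.inr (Nat.lt_succ_of_le hw))
  | timeout => exact .inr (.inl rfl)
  | _ => exact .inl rfl

namespace Run

variable {n : ℕ} {V : Type*} [DecidableEq V] {f : ℕ} {Δ : ℝ} {R : Run n V f Δ}

/-- The alarm of party `i` in state `s` before step `k` was set for `11 * Δ` after `i` entered the
view; if it has gone off, then `i` has aborted the view. -/
structure TimerInv (R : Run n V f Δ) (i : Fin n) (k : ℕ) (s : State n V) : Prop where
  entered : ∀ d, s.timer = some d → ∃ k' < k, ∃ s', R.state (k' + 1) i = some s' ∧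
    s'.view = s.view ∧ d = R.now k' i + 11 * Δ
  aborted : s.timer = none → R.Aborted k i s.view

theorem TimerInv.of_entered {i : Fin n} {k : ℕ} {s : State n V} (hs : R.state (k + 1) i = some s)
    (ht : s.timer = some (R.now k i + 11 * Δ)) : R.TimerInv i (k + 1) s where
  entered d hd := ⟨k, k.lt_succ_self, s, hs, rfl, Option.some_injective _ (hd.symm.trans ht)⟩
  aborted h := by cases ht.symm.trans h

theorem timerInv {i : Fin n} (hi : i ∉ R.faulty) {k : ℕ} {s : State n V}
    (hs : R.state k i = some s) : R.TimerInv i k s := by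
  refine R.invariant hi (R.TimerInv i) (fun k _ hs' _ => .of_entered hs' rfl) ?_ hs
  intro k s s' e o _ hs' _ ho h ih
  cases h with
  | timeout =>
    refine ⟨fun d hd => (by cases hd), fun _ => ⟨k, k.lt_succ_self, s.view, le_rfl, fun p => ?_⟩⟩
    rw [ho]
    exact List.mem_singleton.2 rfl
  | abortEnter => exact .of_entered hs' rfl
  | _ =>
    refine ⟨fun d hd => ?_, fun h => (ih.aborted h).mono k.le_succ⟩
    obtain ⟨k', hk', h⟩ := ih.entered d hd
    exact ⟨k', hk'.trans k.lt_succ_self, h⟩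

theorem exists_le_clock (R : Run n V f Δ) (i : Fin n) (k : ℕ) (d : ℝ) :
    ∃ T, k ≤ R.upTo T ∧ d ≤ R.clock i T := by
  obtain ⟨T, hT, hk⟩ := R.exec.exists_le_upTo k
  have hle : T ≤ T + |d - R.clock i T| := le_add_of_nonneg_right (abs_nonneg _)
  have h := R.exec.clock_sync i T _ hT hle
  have := le_abs_self (d - R.clock i T)
  exact ⟨_, hk.trans (R.exec.upTo_mono hle), by unfold clock at *; linarith⟩

theorem clock_lt_of_timer {i : Fin n} (hi : i ∉ R.faulty) {T : ℝ} {s : State n V}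
    (hs : R.state (R.upTo T) i = some s) (hu : s.decided = none) {d : ℝ}
    (hd : s.timer = some d) : R.clock i T < d := by
  rcases hk : R.upTo T with _ | k
  · rw [hk] at hs
    cases (R.state_zero hi).symm.trans hs
  · have hk' : k < R.upTo T ∧ ¬ k + 1 < R.upTo T := by omega
    rw [hk] at hs
    exact R.exec.punctual k i s d hi hs hu hd T (R.exec.lt_upTo.1 hk'.1)
      (not_le.1 fun h => hk'.2 (R.exec.lt_upTo.2 h))

theorem aborted_or_lt_view {i : Fin n} (hi : i ∉ R.faulty) (hu : R.Undecided i) {k : ℕ}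
    {s : State n V} (hs : R.state k i = some s) :
    ∃ k', R.Aborted k' i s.view ∨ ∃ s', R.state k' i = some s' ∧ s.view < s'.view := by
  by_contra! hno
  have hview {k' s'} (hk : k ≤ k') (hs' : R.state k' i = some s') : s'.view = s.view :=
    le_antisymm ((hno k').2 s' hs') (R.state_le hi hk hs hs').view
  have hsome {k' s'} (hk : k ≤ k') (hs' : R.state k' i = some s') : s'.timer ≠ none := fun h =>
    (hno k').1 (hview hk hs' ▸ (timerInv hi hs').aborted h)
  obtain ⟨d, hd⟩ := Option.ne_none_iff_exists'.1 (hsome le_rfl hs)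
  have hconst {k'} (hk : k ≤ k') : ∃ s', R.state k' i = some s' ∧ s'.timer = some d := by
    induction hk with
    | refl => exact ⟨s, hs, hd⟩
    | @step k' hk ih =>
      obtain ⟨s', hs', hd'⟩ := ih
      obtain ⟨s'', hs'', h⟩ := R.transition hi hs'
      have hk' : k ≤ k' + 1 := Nat.le_succ_of_le hk
      rcases h.timer_eq with h | h | h
      · exact ⟨s'', hs'', h.trans hd'⟩
      · exact absurd h (hsome hk' hs'')
      · exact absurd h (by rw [hview hk hs', hview hk' hs'']; exact lt_irrefl _)
  obtain ⟨T, hk, hT⟩ := R.exists_le_clock i k d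
  obtain ⟨s', hs', hd'⟩ := hconst hk
  exact hT.not_gt (clock_lt_of_timer hi hs' (hu _ _ hs') hd')

theorem lt_view_of_aborted (hu : ∀ i, i ∉ R.faulty → R.Undecided i) {v : ℕ}
    (h : ∀ q, q ∉ R.faulty → ∃ k, R.Aborted k q v) {i : Fin n} (hi : i ∉ R.faulty) :
    ∃ k s, R.state k i = some s ∧ v < s.view := by
  choose! K hK using h
  obtain ⟨T, hT, hk⟩ := R.exec.exists_le_upTo (Finset.univ.sup K)
  obtain ⟨s, hs⟩ := exists_state_upTo hi (hT.trans (le_add_of_nonneg_right R.delay_pos.le))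
  refine ⟨_, s, hs, (abortInv hi hs).advanced v
    (R.card_compl_faulty.trans (Finset.card_le_card fun q hq => ?_))⟩
  have hq := Finset.mem_compl.1 hq
  exact Finset.mem_filter.2 ⟨Finset.mem_univ _, le_highestAbort_of_aborted hi (hu i hi) hq hk hT
    ((hK q hq).mono (Finset.le_sup (Finset.mem_univ q))) hs⟩

theorem exists_view_ge (hu : ∀ i, i ∉ R.faulty → R.Undecided i) (v : ℕ) :
    ∃ k i s, i ∉ R.faulty ∧ R.state k i = some s ∧ v ≤ s.view := by
  have hf := R.three_mul_lt
  have hΔ := R.delay_pos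
  induction v with
  | zero =>
    obtain ⟨i, -, hi⟩ := R.exists_mem_not_faulty (S := Finset.univ) (by simp; omega)
    obtain ⟨s, hs⟩ := exists_state_upTo hi le_rfl
    exact ⟨_, i, s, hi, hs, Nat.zero_le _⟩
  | succ v ih =>
    obtain ⟨k, i, s, hi, hs, hv⟩ := ih
    by_contra! hno
    obtain ⟨T, hT, hk⟩ := R.exec.exists_le_upTo k
    have haborted (q) (hq : q ∉ R.faulty) : ∃ k', R.Aborted k' q v := by
      obtain ⟨sq, hsq⟩ := exists_state_upTo hq (show R.GST ≤ T + Δ + Δ by linarith)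
      have hle := view_le_of_undecided hu hi hk hT hs hq hsq
      have hlt := hno _ _ _ hq hsq
      obtain rfl : sq.view = v := by omega
      obtain ⟨k', h | ⟨s', hs', h⟩⟩ := aborted_or_lt_view hq (hu q hq) hsq
      · exact ⟨k', h⟩
      · exact absurd h (by have := hno _ _ _ hq hs'; omega)
    obtain ⟨k', s', hs', h⟩ := lt_view_of_aborted hu haborted hi
    exact absurd h (by have := hno _ _ _ hi hs'; omega)

/-! ### Joining a view -/

/-- Before step `k`, party `i` has sent the messages of its present view to the parties that have
joined this view, and records a view of `j` only after a request from `j`. -/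
structure JoinInv (R : Run n V f Δ) (i : Fin n) (k : ℕ) (s : State n V) : Prop where
  request : ∀ j, R.Sent k i j (.request s.view)
  join : ∀ m ∈ s.joinMsgs, ∀ j, s.highestRequest j = s.view → R.Sent k i j m
  suggest : ∀ j, s.highestRequest j = s.view → IsPrimary j s.view →
    ∃ k3 v3 r, R.Sent k i j (.suggest k3 v3 r s.view)
  received : ∀ j, 0 < s.highestRequest j → R.Received k i j (.request (s.highestRequest j))

namespace JoinInv

variable {i : Fin n} {k : ℕ} {s : State n V}

theorem mono {k' : ℕ} (h : R.JoinInv i k s) (hk : k ≤ k') : R.JoinInv i k' s where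
  request j := (h.request j).mono hk
  join m hm j hj := (h.join m hm j hj).mono hk
  suggest j hj hp :=
    let ⟨k3, v3, r, h⟩ := h.suggest j hj hp
    ⟨k3, v3, r, h.mono hk⟩
  received j h0 := (h.received j h0).mono hk

theorem frame {s' : State n V} (h : R.JoinInv i k s) (hv : s'.view = s.view)
    (hr : s'.highestRequest = s.highestRequest)
    (hj : ∀ m ∈ s'.joinMsgs, m ∈ s.joinMsgs ∨
      ∀ j, s.highestRequest j = s.view → R.Sent k i j m) : R.JoinInv i k s' := by
  constructor
  · rw [hv]; exact h.request
  · rw [hv, hr]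
    exact fun m hm j he => (hj m hm).elim (fun hm => h.join m hm j he) fun h => h j he
  · rw [hv, hr]; exact h.suggest
  · rw [hr]; exact h.received

theorem of_enterView {now : ℝ} {v : ℕ} (hsent : ∀ j, (enterView Δ now v s).2 j ⊆ R.sent k i j)
    (hr : ∀ j, 0 < s.highestRequest j →
      R.Received (k + 1) i j (.request (s.highestRequest j))) :
    R.JoinInv i (k + 1) (enterView Δ now v s).1 := by
  constructor
  · exact fun j => ⟨k, k.lt_succ_self, hsent j List.mem_cons_self⟩
  · intro m hm j hj
    cases List.mem_singleton.1 hm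
    replace hj : s.highestRequest j = v := hj
    exact ⟨k, k.lt_succ_self, hsent j (by simp [enterView, sendAllUponJoin, hj])⟩
  · intro j hj hp
    replace hj : s.highestRequest j = v := hj
    replace hp : IsPrimary j v := hp
    refine ⟨s.key3, s.key3Val, s.key2, k, k.lt_succ_self, hsent j ?_⟩
    simp [enterView, sendAllUponJoin, suggestMsg, hj, hp]
  · exact hr

theorem of_request {j : Fin n} {v : ℕ} (h : R.JoinInv i k s)
    (he : R.event k = .recv i j (.request v))
    (hsuggest : v = s.view → IsPrimary j v → suggestMsg s ∈ R.sent k i j)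
    (hjoin : v = s.view → s.joinMsgs ⊆ R.sent k i j) :
    R.JoinInv i (k + 1)
      { s with highestRequest := Function.update s.highestRequest j v } := by
  have hjoined (l) (hl : Function.update s.highestRequest j v l = s.view) :
      s.highestRequest l = s.view ∨ (l = j ∧ v = s.view) := by
    rw [Function.update_apply] at hl
    split_ifs at hl with h
    · exact .inr ⟨h, hl⟩
    · exact .inl hl
  have h' := h.mono k.le_succ
  constructor
  · exact h'.request
  · intro m hm l hl
    rcases hjoined l hl with hl | ⟨rfl, hv⟩
    · exact h'.join m hm l hl
    · exact ⟨k, k.lt_succ_self, hjoin hv hm⟩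
  · intro l hl hp
    rcases hjoined l hl with hl | ⟨rfl, rfl⟩
    · exact h'.suggest l hl hp
    · exact ⟨s.key3, s.key3Val, s.key2, k, k.lt_succ_self, hsuggest rfl hp⟩
  · intro l hl
    rcases eq_or_ne l j with rfl | hlj
    · simp only [Function.update_self]
      exact ⟨k, k.lt_succ_self, he⟩
    · simp only [Function.update_of_ne hlj] at hl ⊢
      exact h'.received l hl

end JoinInv

theorem joinInv {i : Fin n} (hi : i ∉ R.faulty) {k : ℕ} {s : State n V}
    (hs : R.state k i = some s) : R.JoinInv i k s := by
  refine R.invariant hi (R.JoinInv i) ?_ ?_ hs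
  · exact fun k _ _ ho => .of_enterView (fun j m hm => ho ▸ hm) fun j h0 => absurd h0 (lt_irrefl _)
  intro k s s' e o _ _ he ho h ih
  have ih' := ih.mono k.le_succ
  have hsent {m₀ : Msg V} (ho : R.sent k i = sendJoined s m₀) (m) (hm : m ∈ s.joinMsgs ++ [m₀]) :
      m ∈ s.joinMsgs ∨ ∀ j, s.highestRequest j = s.view → R.Sent (k + 1) i j m := by
    refine (List.mem_append.1 hm).imp_right fun hm j hj => ⟨k, k.lt_succ_self, ?_⟩
    have : sendJoined s m₀ j ⊆ R.sent k i j := ho ▸ List.Subset.refl _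
    exact this (by rwa [sendJoined, if_pos hj])
  cases h with
  | @request j v =>
    refine ih.of_request he (fun hv hp => ?_) fun hv m hm => ?_
    · simp [ho, hv ▸ hp, hv]
    · simp [ho, hv, hm]
  | abortEnter =>
    exact .of_enterView (fun l m hm => ho ▸ List.mem_append_right _ hm) ih'.received
  | _ => first
    | exact ih'.frame rfl rfl fun m hm => .inl hm
    | exact ih'.frame rfl rfl (hsent ho)

theorem view_of_request {i j : Fin n} (hi : i ∉ R.faulty) (hj : j ∉ R.faulty) {k : ℕ}
    {s : State n V} (hs : R.state k i = some s) (h0 : 0 < s.highestRequest j) :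
    ∃ k' < k, ∃ s', R.state k' j = some s' ∧ s'.view = s.highestRequest j := by
  obtain ⟨k', hk', l, hl, h⟩ := ((joinInv hi hs).received j h0).exists_sent_lt hi hj
  obtain ⟨u, hu, hv⟩ := request_of_sent hj h
  exact ⟨l + 1, by omega, u, hu, hv⟩

end Run

/-! ### Views that start after stabilization -/

theorem exists_lt_isPrimary {n : ℕ} (p : Fin n) (b : ℕ) : ∃ v > b, IsPrimary p v := by
  refine ⟨p + n * (b + 1), ?_, ?_⟩
  · have := Nat.le_mul_of_pos_left (b + 1) p.pos
    omega
  · rw [IsPrimary, Nat.add_mul_mod_self_left, Nat.mod_eq_of_lt p.2]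

namespace Run

variable {n : ℕ} {V : Type*} [DecidableEq V] {f : ℕ} {Δ : ℝ} {R : Run n V f Δ}

/-- View `v ≥ 2` is entered for the first time by a nonfaulty party at time `t₀ ≥ GST`. View `1`
is excluded because it is entered when the parties start. -/
structure Entered (R : Run n V f Δ) (v : ℕ) (t₀ : ℝ) : Prop where
  two_le : 2 ≤ v
  gst : R.GST ≤ t₀
  reached : ∃ i s, i ∉ R.faulty ∧ R.state (R.upTo t₀) i = some s ∧ v ≤ s.view
  first : ∀ k i s, i ∉ R.faulty → R.state (k + 1) i = some s → v ≤ s.view → t₀ ≤ R.time k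

theorem exists_view_le (R : Run n V f Δ) (k : ℕ) :
    ∃ b, ∀ i s, R.state k i = some s → s.view ≤ b := by
  refine ⟨Finset.univ.sup fun i => (R.state k i).elim 0 State.view, fun i s hs => ?_⟩
  have := Finset.le_sup (f := fun i => (R.state k i).elim 0 State.view) (Finset.mem_univ i)
  simpa only [hs, Option.elim_some] using this

theorem exists_entered (hu : ∀ i, i ∉ R.faulty → R.Undecided i) {v : ℕ} (hv : 2 ≤ v)
    (hlt : ∀ i s, R.state (R.upTo R.GST) i = some s → s.view < v) : ∃ t₀, R.Entered v t₀ := by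
  classical
  have hex := exists_view_ge hu v
  obtain ⟨i, s, hi, hs, hvs⟩ := Nat.find_spec hex
  obtain ⟨e, he⟩ : ∃ e, Nat.find hex = e + 1 := Nat.exists_eq_succ_of_ne_zero fun h0 => by
    rw [h0, R.state_zero hi] at hs
    cases hs
  rw [he] at hs
  refine ⟨R.time e, hv, ?_, ?_, ?_⟩
  · by_contra hgst
    obtain ⟨s', hs', hle⟩ :=
      R.exists_state_of_le hi (R.exec.lt_upTo.2 (not_le.1 hgst).le : e + 1 ≤ R.upTo R.GST) hs
    exact (hvs.trans hle.view).not_gt (hlt i s' hs')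
  · obtain ⟨s', hs', hle⟩ :=
      R.exists_state_of_le hi (R.exec.lt_upTo.2 le_rfl : e + 1 ≤ R.upTo (R.time e)) hs
    exact ⟨i, s', hi, hs', hvs.trans hle.view⟩
  · intro k i s hi hs hv
    have := Nat.find_min' hex ⟨i, s, hi, hs, hv⟩
    exact R.exec.time_mono (by omega)

namespace Entered

variable {v : ℕ} {t₀ : ℝ}

theorem le_time_of_abort (h : R.Entered v t₀) {k : ℕ} {q p : Fin n} (hq : q ∉ R.faulty) {y : ℕ}
    (hy : v ≤ y) (hm : .abort y ∈ R.sent k q p) : t₀ + 11 * Δ ≤ R.time k := by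
  have hv := h.two_le
  obtain ⟨k', hk', q', s, d, hq', hs, hd, hnow, hvs⟩ := timeout_of_abort hq (by omega) hm
  obtain ⟨l, hl, s', hs', hv', rfl⟩ := (timerInv hq' hs).entered d hd
  have hfirst := h.first l q' s' hq' hs' (by omega)
  have hsync := R.exec.clock_sync q' _ _ (h.gst.trans hfirst) (R.exec.time_mono hl.le)
  have hmono := R.exec.time_mono hk'
  unfold now clock time at *
  linarith

theorem view_le (h : R.Entered v t₀) {T : ℝ} (hT : T < t₀ + 11 * Δ) {k : ℕ} (hk : k ≤ R.upTo T)
    {i : Fin n} (hi : i ∉ R.faulty) {s : State n V} (hs : R.state k i = some s) :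
    s.view ≤ v := by
  have hv := h.two_le
  by_contra! hlt
  obtain ⟨H, hH, haborted⟩ := aborted_of_lt_view hi hs (by omega) hlt
  obtain ⟨q, hq⟩ := Finset.card_pos.1 (f.succ_pos.trans_le hH)
  obtain ⟨hqf, l, hl, y, hy, hm⟩ := haborted q hq
  have hlate := h.le_time_of_abort hqf hy (hm q)
  exact (hT.trans_le hlate).not_ge (R.exec.lt_upTo.1 (hl.trans_le hk))

theorem stale_of_sent (h : R.Entered v t₀) {T T' : ℝ} (hT : t₀ ≤ T) (hTT' : T + Δ ≤ T')
    (hT' : T' < t₀ + 11 * Δ) {i j : Fin n} (hi : i ∉ R.faulty) (hj : j ∉ R.faulty)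
    (hu : R.Undecided j) {l : ℕ} (hl : l < R.upTo T) {m : Msg V} (hm : m ∈ R.sent l i j)
    {s s' : State n V} (hs : R.state (l + 1) i = some s) (hr : s.highestRequest j = v)
    (hs' : R.state (R.upTo T') j = some s') : Stale j i s' m := by
  have hv := h.two_le
  obtain ⟨k, hlk, hk, he⟩ := R.exec.exists_event_recv hi hj hl (h.gst.trans hT) hm
  obtain ⟨k', hk', u, hu', hv'⟩ := view_of_request hi hj hs (by omega)
  obtain ⟨u', hsu, hstale⟩ := stale_of_event hj hu he
  replace hk : k + 1 ≤ R.upTo T' := hk.trans_le (R.exec.upTo_mono hTT')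
  have hle := R.state_le hj hk hsu hs'
  have hge := (R.state_le hj (by omega) hu' hsu).view
  have hs'v := h.view_le hT' le_rfl hj hs'
  exact hstale.of_le hle (le_antisymm hle.view (by omega))

end Entered

theorem exists_proof_mem {i : Fin n} (hi : i ∉ R.faulty) {k : ℕ} {s : State n V}
    (hs : R.state k i = some s) : ∃ r : KeyRecord V, (.proof r s.view : Msg V) ∈ s.joinMsgs := by
  refine R.invariant hi (fun _ s => ∃ r : KeyRecord V, (.proof r s.view : Msg V) ∈ s.joinMsgs)
    (fun _ _ _ _ => ⟨_, List.mem_singleton.2 rfl⟩) ?_ hs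
  rintro k s s' e o _ _ _ _ h ⟨r, hr⟩
  cases h with
  | abortEnter => exact ⟨_, List.mem_singleton.2 rfl⟩
  | _ => exact ⟨r, by first | exact hr | exact List.mem_append_left _ hr⟩

/-- Nobody ever decides, and view `v`, with the nonfaulty primary `p`, starts at time
`t₀ ≥ GST`. -/
structure Good (R : Run n V f Δ) (v : ℕ) (t₀ : ℝ) (p : Fin n) : Prop extends R.Entered v t₀ where
  undecided : ∀ i, i ∉ R.faulty → R.Undecided i
  nonfaulty : p ∉ R.faulty
  primary : IsPrimary p v

theorem exists_good (hu : ∀ i, i ∉ R.faulty → R.Undecided i) {p : Fin n} (hp : p ∉ R.faulty) :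
    ∃ v t₀, R.Good v t₀ p := by
  obtain ⟨b, hb⟩ := R.exists_view_le (R.upTo R.GST)
  obtain ⟨v, hv, hpv⟩ := exists_lt_isPrimary p (b + 1)
  have hv2 : 2 ≤ v := by omega
  have hbv : b < v := by omega
  obtain ⟨t₀, h⟩ := exists_entered hu hv2 fun i s hs => (hb i s hs).trans_lt hbv
  exact ⟨v, t₀, h, hu, hp, hpv⟩

namespace Good

variable {v : ℕ} {t₀ : ℝ} {p : Fin n}

theorem view_eq (h : R.Good v t₀ p) {T : ℝ} (hT : t₀ + 2 * Δ ≤ T) (hT' : T < t₀ + 11 * Δ)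
    {i : Fin n} (hi : i ∉ R.faulty) {s : State n V} (hs : R.state (R.upTo T) i = some s) :
    s.view = v := by
  obtain ⟨i₀, s₀, hi₀, hs₀, hv₀⟩ := h.reached
  obtain ⟨u, hu⟩ := exists_state_upTo hi (show R.GST ≤ t₀ + Δ + Δ by linarith [h.gst, R.delay_pos])
  have hle := view_le_of_undecided h.undecided hi₀ le_rfl h.gst hs₀ hi hu
  have hmono := R.state_le hi (R.exec.upTo_mono (by linarith)) hu hs
  exact le_antisymm (h.view_le hT' le_rfl hi hs) (hv₀.trans (hle.trans hmono.view))

theorem exists_state (h : R.Good v t₀ p) {T : ℝ} (hT : t₀ + 2 * Δ ≤ T) (hT' : T < t₀ + 11 * Δ)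
    {i : Fin n} (hi : i ∉ R.faulty) : ∃ s, R.state (R.upTo T) i = some s ∧ s.view = v := by
  obtain ⟨s, hs⟩ := exists_state_upTo hi (show R.GST ≤ T by linarith [h.gst, R.delay_pos])
  exact ⟨s, hs, h.view_eq hT hT' hi hs⟩

theorem highestRequest_eq (h : R.Good v t₀ p) {T : ℝ} (hT : t₀ + 3 * Δ ≤ T)
    (hT' : T < t₀ + 11 * Δ) {i q : Fin n} (hi : i ∉ R.faulty) (hq : q ∉ R.faulty)
    {s : State n V} (hs : R.state (R.upTo T) i = some s) : s.highestRequest q = v := by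
  have hΔ := R.delay_pos
  have hv := h.two_le
  have hge : v ≤ s.highestRequest q := by
    obtain ⟨sq, hsq, rfl⟩ := h.exists_state (T := t₀ + 2 * Δ) le_rfl (by linarith) hq
    obtain ⟨l, hl, hm⟩ := (joinInv hq hsq).request i
    obtain ⟨k, -, hk, he⟩ := R.exec.exists_event_recv hq hi hl (by linarith [h.gst]) hm
    obtain ⟨s', hs', hstale⟩ := stale_of_event hi (h.undecided i hi) he
    have hle := R.state_le hi (hk.trans_le (R.exec.upTo_mono (by linarith))) hs' hs
    exact le_trans hstale (hle.request q)
  obtain ⟨k, hk, s', hs', hv'⟩ := view_of_request hi hq hs (by omega)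
  exact le_antisymm (hv' ▸ h.view_le hT' hk.le hq hs') hge

theorem stale_of_mem_joinMsgs (h : R.Good v t₀ p) {T T' : ℝ} (hT : t₀ + 3 * Δ ≤ T)
    (hTT' : T + Δ ≤ T') (hT' : T' < t₀ + 11 * Δ) {i j : Fin n} (hi : i ∉ R.faulty)
    (hj : j ∉ R.faulty) {s s' : State n V} (hs : R.state (R.upTo T) i = some s) {m : Msg V}
    (hm : m ∈ s.joinMsgs) (hs' : R.state (R.upTo T') j = some s') : Stale j i s' m := by
  have hΔ := R.delay_pos
  have hv := h.view_eq (by linarith) (by linarith) hi hs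
  have hr := h.highestRequest_eq hT (by linarith) hi hj hs
  obtain ⟨l, hl, hsent⟩ := (joinInv hi hs).join m hm j (hr.trans hv.symm)
  obtain ⟨u, hu, -, hur, -⟩ := join_of_sent hi hsent (hv ▸ inView_of_mem hi hs _ hm)
  exact h.stale_of_sent (by linarith) hTT' hT' hi hj (h.undecided j hj) hl hsent hu hur hs'

theorem le_card_voteFrom (h : R.Good v t₀ p) {T T' : ℝ} (hT : t₀ + 3 * Δ ≤ T)
    (hTT' : T + Δ ≤ T') (hT' : T' < t₀ + 11 * Δ) {ph : Phase} {val : V}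
    (hvote : ∀ i s, i ∉ R.faulty → R.state (R.upTo T) i = some s → .vote ph val v ∈ s.joinMsgs)
    {j : Fin n} (hj : j ∉ R.faulty) {s : State n V} (hs : R.state (R.upTo T') j = some s) :
    n - f ≤ (s.voteFrom ph val).card := by
  have hΔ := R.delay_pos
  refine R.card_compl_faulty.trans (Finset.card_le_card fun i hi => ?_)
  have hi := Finset.mem_compl.1 hi
  obtain ⟨si, hsi, -⟩ := h.exists_state (T := T) (by linarith) (by linarith) hi
  exact h.stale_of_mem_joinMsgs hT hTT' hT' hi hj hsi (hvote i si hi hsi) hs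
    (h.view_eq (by linarith) hT' hj hs).symm

theorem next_vote (h : R.Good v t₀ p) {T T' : ℝ} (hT : t₀ + 3 * Δ ≤ T)
    (hTT' : T + Δ ≤ T') (hT' : T' < t₀ + 11 * Δ) {ph ph' : Phase} (hn : ph.Next ph') {val : V}
    (hvote : ∀ i s, i ∉ R.faulty → R.state (R.upTo T) i = some s → .vote ph val v ∈ s.joinMsgs)
    (i : Fin n) (s : State n V) (hi : i ∉ R.faulty) (hs : R.state (R.upTo T') i = some s) :
    .vote ph' val v ∈ s.joinMsgs := by
  obtain rfl := h.view_eq (by linarith [R.delay_pos]) hT' hi hs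
  exact (votesMatch hi hs ph ph' val hn).2 (h.le_card_voteFrom hT hTT' hT' hvote hi hs)

theorem exists_proofFrom (h : R.Good v t₀ p) {i j : Fin n} (hi : i ∉ R.faulty)
    (hj : j ∉ R.faulty) {s : State n V} (hs : R.state (R.upTo (t₀ + 5 * Δ)) j = some s) :
    ∃ r, s.proofFrom i = some r := by
  have hΔ := R.delay_pos
  obtain ⟨si, hsi, hvi⟩ := h.exists_state (T := t₀ + 4 * Δ) (by linarith) (by linarith) hi
  obtain ⟨r, hr⟩ := exists_proof_mem hi hsi
  have hv := h.view_eq (by linarith) (by linarith) hj hs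
  exact Option.ne_none_iff_exists'.1 (h.stale_of_mem_joinMsgs (by linarith) (by linarith)
    (by linarith) hi hj hsi hr hs (hvi.trans hv.symm))

theorem exists_suggestFrom (h : R.Good v t₀ p) {i : Fin n} (hi : i ∉ R.faulty)
    {s : State n V} (hs : R.state (R.upTo (t₀ + 4 * Δ)) p = some s) :
    ∃ x, s.suggestFrom i = some x := by
  have hΔ := R.delay_pos
  have hp := h.nonfaulty
  obtain ⟨si, hsi, rfl⟩ := h.exists_state (T := t₀ + 3 * Δ) (by linarith) (by linarith) hi
  have hr := h.highestRequest_eq le_rfl (by linarith) hi hp hsi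
  obtain ⟨k3, v3, r, l, hl, hsent⟩ := (joinInv hi hsi).suggest p hr h.primary
  obtain ⟨u, hu, -, hur, -⟩ := suggest_of_sent hi hsent
  have hv := h.view_eq (by linarith) (by linarith) hp hs
  exact Option.ne_none_iff_exists'.1 (h.stale_of_sent (by linarith) (by linarith) (by linarith)
    hi hp (h.undecided p hp) hl hsent hu hur hs hv.symm (hv.symm ▸ h.primary))

end Good

end Run

/-! ### Proposals of nonfaulty primaries -/

theorem IsPrimary.unique {n : ℕ} {p p' : Fin n} {v : ℕ} (h : IsPrimary p v)
    (h' : IsPrimary p' v) : p = p' :=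
  Fin.ext (h.trans h'.symm)

namespace Run

variable {n : ℕ} {V : Type*} [DecidableEq V] {f : ℕ} {Δ : ℝ} {R : Run n V f Δ}

theorem KeyInv.exists_cast_ne {i : Fin n} {ph : Phase} {k v : ℕ} {r : KeyRecord V}
    (h : R.KeyInv i ph k v r) {key : ℤ} (hpos : 0 < key) {val lv : V} (hne : val ≠ lv)
    (hr : key ≤ r.prev ∨ (key ≤ r.key ∧ val = r.val)) :
    ∃ w : ℕ, key ≤ w ∧ w ≤ r.key ∧ ∃ val' ≠ lv, R.Cast k i (.vote ph val' w) := by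
  have hlt := h.lt
  obtain ⟨w, hw, hc⟩ := h.key (by omega)
  rcases hr with hr | ⟨hr, rfl⟩
  · by_cases hval : r.val = lv
    · obtain ⟨w', hw', val', hne', hc'⟩ := h.prev (by omega)
      exact ⟨w', by omega, by omega, val', hval ▸ hne', hc'⟩
    · exact ⟨w, by omega, hw.ge, _, hval, hc⟩
  · exact ⟨w, by omega, hw.ge, _, hne, hc⟩

section Suggest

variable {i j : Fin n} {k : ℕ} {k3 : ℤ} {v3 : V} {r : KeyRecord V} {v : ℕ}

theorem keyInv_of_suggest (hi : i ∉ R.faulty) (hj : j ∉ R.faulty)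
    (h : R.Received k i j (.suggest k3 v3 r v)) : R.KeyInv j .key2 k v r := by
  obtain ⟨k', hk', s, hs, rfl, -, -, rfl⟩ := suggest_of_received hi hj h
  exact (keysInv hj hs).key2.mono hk'.le le_rfl

theorem key3_of_suggest (hi : i ∉ R.faulty) (hj : j ∉ R.faulty)
    (h : R.Received k i j (.suggest k3 v3 r v)) :
    k3 = 0 ∨ ∃ w ≤ v, k3 = (w : ℤ) ∧ R.Cast k j (.vote .key3 v3 w) := by
  obtain ⟨k', hk', s, hs, rfl, rfl, rfl, -⟩ := suggest_of_received hi hj h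
  rcases (keysInv hj hs).key3 with ⟨h, -⟩ | ⟨w, -, hle, hw, hc⟩
  · exact .inl h
  · exact .inr ⟨w, hle, hw, hc.mono hk'.le⟩

theorem dominates_of_suggest (hi : i ∉ R.faulty) (hj : j ∉ R.faulty)
    (h : R.Received k i j (.suggest k3 v3 r v)) {k' w : ℕ} {val : V}
    (hc : R.Cast k' j (.vote .key2 val w)) (hw : w < v) : Dominates r w val := by
  obtain ⟨l, -, s, hs, rfl, -, -, rfl⟩ := suggest_of_received hi hj h
  obtain ⟨l', hl', hc⟩ := hc.of_view_lt hj (v := w) rfl hs hw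
  exact (votesInv hj hs).key2 val w (hc.mono hl'.le)

theorem le_key3_of_suggest (hi : i ∉ R.faulty) (hj : j ∉ R.faulty)
    (h : R.Received k i j (.suggest k3 v3 r v)) {k' w : ℕ} {val : V}
    (hc : R.Cast k' j (.vote .key3 val w)) (hw : w < v) : (w : ℤ) ≤ k3 := by
  obtain ⟨l, -, s, hs, rfl, rfl, -, -⟩ := suggest_of_received hi hj h
  obtain ⟨l', hl', hc⟩ := hc.of_view_lt hj (v := w) rfl hs hw
  exact (votesInv hj hs).key3 val w (hc.mono hl'.le)

end Suggest

section Primary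

variable {p : Fin n} {v : ℕ}

theorem cast_propose_of_echo (hp : p ∉ R.faulty) (hpv : IsPrimary p v) {i : Fin n}
    (hi : i ∉ R.faulty) {k : ℕ} {val : V} (h : R.Cast k i (.vote .echo val v)) :
    ∃ k' < k, ∃ key, R.Cast k' p (.propose key val v) := by
  obtain ⟨p', key, hp', hr⟩ := propose_of_echo hi h
  obtain rfl := hpv.unique hp'
  obtain ⟨k', hk', hc⟩ := cast_of_received hi hp hr (v := v) rfl
  exact ⟨k', hk', key, hc⟩

theorem cast_propose_of_quorum (hp : p ∉ R.faulty) (hpv : IsPrimary p v) {k : ℕ} {ph : Phase}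
    {val : V} (h : R.Quorum k ph val v) : ∃ k' < k, ∃ key, R.Cast k' p (.propose key val v) := by
  obtain ⟨j, hj, l, hl, hc⟩ := h.echo.exists_voter
  obtain ⟨k', hk', hprop⟩ := cast_propose_of_echo hp hpv hj hc
  exact ⟨k', hk'.trans hl, hprop⟩

theorem cast_propose_of_vote (hp : p ∉ R.faulty) (hpv : IsPrimary p v) {i : Fin n}
    (hi : i ∉ R.faulty) {k : ℕ} {ph : Phase} {val : V} (h : R.Cast k i (.vote ph val v)) :
    ∃ k' < k, ∃ key, R.Cast k' p (.propose key val v) := by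
  cases ph with
  | echo => exact cast_propose_of_echo hp hpv hi h
  | key1 => exact cast_propose_of_quorum hp hpv (quorum_of_cast hi h .echo)
  | key2 => exact cast_propose_of_quorum hp hpv (quorum_of_cast hi h .key1)
  | key3 => exact cast_propose_of_quorum hp hpv (quorum_of_cast hi h .key2)
  | lock => exact cast_propose_of_quorum hp hpv (quorum_of_cast hi h .key3)

end Primary

section Suggestions

variable {p : Fin n} {k : ℕ} {s : State n V}

theorem not_cast_vote_of_not_proposed (hp : p ∉ R.faulty) (hs : R.state k p = some s)
    (hpv : IsPrimary p s.view) (hprop : s.proposed = false) {i : Fin n} (hi : i ∉ R.faulty)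
    {ph : Phase} {val : V} : ¬ R.Cast k i (.vote ph val s.view) := by
  intro h
  obtain ⟨k', hk', key, hc⟩ := cast_propose_of_vote hp hpv hi h
  have := (proposeInv hp hs).proposed.1 ⟨key, val, cast_mem hp hc hk'.le hs rfl⟩
  exact Bool.false_ne_true (hprop.symm.trans this)

theorem key2Proofs_of_not_proposed (hp : p ∉ R.faulty) (hs : R.state k p = some s)
    (hpv : IsPrimary p s.view) (hprop : s.proposed = false) {j : Fin n} (hj : j ∉ R.faulty)
    {kv : ℤ × V} {r : KeyRecord V} (hr : s.suggestFrom j = some (kv, r)) :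
    key2Proofs s j = some r := by
  have hkey := keyInv_of_suggest hp hj ((proposeInv hp hs).received j _ _ r hr)
  refine key2Proofs_eq_some.2 ⟨kv, hr, hkey.lt, hkey.le.lt_of_ne fun he => ?_⟩
  have hpos := view_pos hp hs
  obtain ⟨w, hw, hc⟩ := hkey.key (by omega)
  obtain rfl : w = s.view := by omega
  exact not_cast_vote_of_not_proposed hp hs hpv hprop hj hc

theorem acceptKey_of_cast (hp : p ∉ R.faulty) (hs : R.state k p = some s)
    (hpv : IsPrimary p s.view) (hprop : s.proposed = false)
    (hall : ∀ i, i ∉ R.faulty → ∃ x, s.suggestFrom i = some x) {i : Fin n} (hi : i ∉ R.faulty)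
    {k' w : ℕ} {val : V} (hc : R.Cast k' i (.vote .key3 val w)) (hw : w < s.view) :
    acceptKey f w val (key2Proofs s) := by
  obtain ⟨H, hH, hvote⟩ := (quorum_of_cast hi hc .key2).exists_voters
  refine hH.trans (Finset.card_le_card fun j hj => ?_)
  obtain ⟨hjf, l, -, hcj⟩ := hvote j hj
  obtain ⟨⟨⟨k3, v3⟩, r⟩, hr⟩ := hall j hjf
  have hdom := dominates_of_suggest hp hjf ((proposeInv hp hs).received j k3 v3 r hr) hcj hw
  exact Finset.mem_filter.2 ⟨Finset.mem_univ j, r,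
    key2Proofs_of_not_proposed hp hs hpv hprop hjf hr,
    hdom.2.elim (fun h => .inr ⟨hdom.1, h.symm⟩) .inl⟩

theorem isSome_suggestions (hp : p ∉ R.faulty) (hs : R.state k p = some s)
    (hpv : IsPrimary p s.view) (hprop : s.proposed = false)
    (hall : ∀ i, i ∉ R.faulty → ∃ x, s.suggestFrom i = some x) {i : Fin n} (hi : i ∉ R.faulty) :
    (suggestions f s i).isSome := by
  obtain ⟨⟨⟨k3, v3⟩, r⟩, hr⟩ := hall i hi
  refine Option.isSome_iff_exists.2 ⟨(k3, v3), suggestions_eq_some.2 ⟨⟨r, hr⟩, ?_⟩⟩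
  rcases key3_of_suggest hp hi ((proposeInv hp hs).received i k3 v3 r hr) with h | ⟨w, hw, rfl, hc⟩
  · exact .inl h
  · have hlt : w < s.view := hw.lt_of_ne fun he =>
      not_cast_vote_of_not_proposed hp hs hpv hprop hi (he ▸ hc)
    exact .inr ⟨Int.ofNat_lt.2 hlt, acceptKey_of_cast hp hs hpv hprop hall hi hc hlt⟩

end Suggestions

section Openable

variable {p : Fin n} {v k : ℕ} {key : ℤ} {val : V} {s : State n V}

theorem Proposal.le_key (h : R.Proposal k p v key val s) (hp : p ∉ R.faulty) {k' w : ℕ} {lv : V}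
    (hq : R.Quorum k' .key3 lv w) (hw : w < v) : (w : ℤ) ≤ key := by
  obtain ⟨H, hH, hvote⟩ := hq.exists_voters
  set A := Finset.univ.filter fun l => (suggestions f s l).isSome
  obtain ⟨j, hj⟩ : (A ∩ H).Nonempty := by
    have hsum := Finset.card_union_add_card_inter A H
    have hunion : (A ∪ H).card ≤ n := card_finset_fin_le _
    have hA : n - f ≤ A.card := h.card
    exact Finset.card_pos.1 (by omega)
  obtain ⟨hjA, hjH⟩ := Finset.mem_inter.1 hj
  obtain ⟨⟨k3, v3⟩, hsug⟩ := Option.isSome_iff_exists.1 (Finset.mem_filter.1 hjA).2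
  obtain ⟨⟨r, hr⟩, -⟩ := suggestions_eq_some.1 hsug
  obtain ⟨hjf, l, -, hc⟩ := hvote j hjH
  exact (le_key3_of_suggest hp hjf (h.received j k3 v3 r hr) hc hw).trans (h.le j _ hsug)

theorem Proposal.exists_cast_key2 (h : R.Proposal k p v key val s) (hp : p ∉ R.faulty)
    (hpos : 0 < key) {lv : V} (hne : val ≠ lv) :
    key < v ∧ ∃ j, j ∉ R.faulty ∧ ∃ w : ℕ, key ≤ w ∧ w < v ∧ ∃ val' ≠ lv,
      R.Cast k j (.vote .key2 val' w) := by
  obtain ⟨l, hl⟩ := h.mem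
  obtain ⟨-, hacc⟩ := suggestions_eq_some.1 hl
  rw [h.view] at hacc
  obtain ⟨hlt, hacc⟩ := hacc.resolve_left hpos.ne'
  obtain ⟨j, hj, hjf⟩ := R.exists_mem_not_faulty hacc
  obtain ⟨r, hr, hor⟩ := (Finset.mem_filter.1 hj).2
  obtain ⟨⟨k3, v3⟩, hx, -, hrv⟩ := key2Proofs_eq_some.1 hr
  rw [h.view] at hrv
  obtain ⟨w, hkw, hwr, hc⟩ :=
    (keyInv_of_suggest hp hjf (h.received j k3 v3 r hx)).exists_cast_ne hpos hne hor
  exact ⟨hlt, j, hjf, w, hkw, by omega, hc⟩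

theorem Quorum.exists_openers {k' w : ℕ} {val' lv : V} (hq : R.Quorum k' .key1 val' w)
    (hw : w < v) (hne : val' ≠ lv) {l : ℤ} (hl : l ≤ w) {i : Fin n} (hi : i ∉ R.faulty) :
    ∃ H : Finset (Fin n), f + 1 ≤ H.card ∧ ∀ j ∈ H, j ∉ R.faulty ∧
      ∀ k r, R.Received k i j (.proof r v) →
        r.prev < r.key ∧ r.key < v ∧ (l ≤ r.prev ∨ (l ≤ r.key ∧ r.val ≠ lv)) := by
  obtain ⟨H, hH, hvote⟩ := hq.exists_voters
  refine ⟨H, hH, fun j hj => ⟨(hvote j hj).1, fun k r hr => ?_⟩⟩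
  obtain ⟨hjf, l', -, hc⟩ := hvote j hj
  have hproof := proofInv_of_received hi hjf hr (max k l') (le_max_left _ _)
  obtain ⟨hle, hor⟩ := hproof.dominates val' w hw (hc.mono (le_max_right _ _))
  refine ⟨hproof.keyInv.lt, hproof.lt, ?_⟩
  rcases hor with rfl | hor
  · exact .inr ⟨hl.trans hle, hne⟩
  · exact .inl (hl.trans hor)

/-- The `key2` report that made the primary accept its proposal certifies a `key1` quorum, at a
view no earlier than the lock, for a value different from the locked one. -/
theorem lock_openable (hp : p ∉ R.faulty) (hpv : IsPrimary p v) {i : Fin n} (hi : i ∉ R.faulty)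
    {l : ℤ} {lv : V} (hcon : R.Considered k i v key val l lv) (hl : l ≠ 0) (hne : val ≠ lv) :
    l ≤ key ∧ key < v ∧ ∃ H : Finset (Fin n), f + 1 ≤ H.card ∧ ∀ j ∈ H, j ∉ R.faulty ∧
      ∀ k' r, R.Received k' i j (.proof r v) →
        r.prev < r.key ∧ r.key < v ∧ (l ≤ r.prev ∨ (l ≤ r.key ∧ r.val ≠ lv)) := by
  obtain ⟨k₀, -, s₀, p', hs₀, rfl, rfl, rfl, hp', hrec⟩ := hcon
  obtain rfl := hpv.unique hp'
  obtain ⟨k₁, -, hprop⟩ := cast_of_received hi hp hrec (v := s₀.view) rfl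
  obtain ⟨s₁, hs₁⟩ := proposal_of_cast hp hprop
  obtain ⟨w, hw0, hwle, hw, hc⟩ := (keysInv hi hs₀).lock.resolve_left hl
  have hquorum := quorum_of_cast hi hc .key3
  have hlt : w < s₀.view := hwle.lt_of_ne fun he => by
    subst he
    obtain ⟨_, -, _, hprop'⟩ := cast_propose_of_quorum hp hpv hquorum
    exact hne (propose_unique hp hprop hprop').2
  have hle : s₀.lock ≤ key := hw.trans_le (hs₁.le_key hp hquorum hlt)
  obtain ⟨hkey, j, hj, w', hkw, hwv, val', hval', hc'⟩ :=
    hs₁.exists_cast_key2 hp (by omega) hne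
  exact ⟨hle, hkey,
    (quorum_of_cast hj hc' .key1).exists_openers hwv hval' (hle.trans hkw) hi⟩

end Openable

/-! ### Termination -/

namespace Good

variable {v : ℕ} {t₀ : ℝ} {p : Fin n}

theorem exists_propose (h : R.Good v t₀ p) {s : State n V}
    (hs : R.state (R.upTo (t₀ + 4 * Δ)) p = some s) :
    ∃ key val, .propose key val v ∈ s.joinMsgs := by
  have hΔ := R.delay_pos
  have hp := h.nonfaulty
  obtain rfl := h.view_eq (by linarith) (by linarith) hp hs
  have hinv := proposeInv hp hs
  rw [hinv.proposed]
  by_contra hprop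
  rw [Bool.not_eq_true] at hprop
  refine (hinv.waiting hprop).not_ge (R.card_compl_faulty.trans (Finset.card_le_card ?_))
  intro i hi
  exact Finset.mem_filter.2 ⟨Finset.mem_univ i, isSome_suggestions hp hs h.primary hprop
    (fun i hi => h.exists_suggestFrom hi hs) (Finset.mem_compl.1 hi)⟩

theorem not_waiting (h : R.Good v t₀ p) {i : Fin n} (hi : i ∉ R.faulty) {s : State n V}
    (hs : R.state (R.upTo (t₀ + 5 * Δ)) i = some s) {val : V} {l : ℤ} {lv : V} :
    s.pending ≠ some (val, l, lv) := by
  intro hpend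
  have hΔ := R.delay_pos
  obtain rfl := h.view_eq (by linarith) (by linarith) hi hs
  have hinv := echoInv hi hs
  obtain ⟨-, hopen, key, hcon, hl, hne, -⟩ := hinv.waiting val l lv hpend
  obtain ⟨-, -, H, hH, hproofs⟩ := lock_openable h.nonfaulty h.primary hi hcon hl hne
  refine hopen (hH.trans (Finset.card_le_card fun j hj => ?_))
  obtain ⟨hjf, hj⟩ := hproofs j hj
  obtain ⟨r, hr⟩ := h.exists_proofFrom hjf hi hs
  obtain ⟨hprev, hkey, hor⟩ := hj _ r (hinv.received j r hr)
  exact Finset.mem_filter.2 ⟨Finset.mem_univ j, r, proofs_eq_some.2 ⟨hr, hprev, hkey⟩, hor⟩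

theorem exists_echo (h : R.Good v t₀ p) : ∃ val, ∀ i s, i ∉ R.faulty →
    R.state (R.upTo (t₀ + 5 * Δ)) i = some s → .vote .echo val v ∈ s.joinMsgs := by
  have hΔ := R.delay_pos
  have hp := h.nonfaulty
  obtain ⟨sp, hsp, hvp⟩ := h.exists_state (T := t₀ + 4 * Δ) (by linarith) (by linarith) hp
  obtain ⟨key, val, hprop⟩ := h.exists_propose hsp
  refine ⟨val, fun i s hi hs => ?_⟩
  obtain rfl := h.view_eq (by linarith) (by linarith) hi hs
  have hseen : s.proposalSeen = true := h.stale_of_mem_joinMsgs (by linarith) (by linarith)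
    (by linarith) hp hi hsp hprop hs rfl h.primary
  rcases (echoInv hi hs).answered hseen with ⟨val', hm⟩ | ⟨val', l, lv, hpend⟩ |
      ⟨key', val', l, lv, hcon, hl, hne, hrej⟩
  · obtain ⟨k', -, key', hc⟩ := cast_propose_of_echo hp h.primary hi ⟨_, le_rfl, s, hs, hm⟩
    obtain ⟨-, rfl⟩ := propose_unique hp ⟨_, le_rfl, sp, hsp, hprop⟩ hc
    exact hm
  · exact absurd hpend (h.not_waiting hi hs)
  · obtain ⟨hle, hlt, -⟩ := lock_openable hp h.primary hi hcon hl hne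
    exact absurd ⟨hle, hlt⟩ hrej

/-- The message delays add up to `10 * Δ`, less than the timeout of `11 * Δ`. -/
theorem exists_doneSent (h : R.Good v t₀ p) {i : Fin n} (hi : i ∉ R.faulty) :
    ∃ k s, R.state k i = some s ∧ s.doneSent = true := by
  have hΔ := R.delay_pos
  obtain ⟨val, hecho⟩ := h.exists_echo
  have hkey1 := h.next_vote (T' := t₀ + 6 * Δ) (by linarith) (by linarith) (by linarith) .echo
    hecho
  have hkey2 := h.next_vote (T' := t₀ + 7 * Δ) (by linarith) (by linarith) (by linarith) .key1
    hkey1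
  have hkey3 := h.next_vote (T' := t₀ + 8 * Δ) (by linarith) (by linarith) (by linarith) .key2
    hkey2
  have hlock := h.next_vote (T' := t₀ + 9 * Δ) (by linarith) (by linarith) (by linarith) .key3
    hkey3
  obtain ⟨s, hs, -⟩ := h.exists_state (T := t₀ + 10 * Δ) (by linarith) (by linarith) hi
  exact ⟨_, s, hs, (doneInv hi hs).lock val
    (h.le_card_voteFrom (by linarith) (by linarith) (by linarith) hlock hi hs)⟩

end Good

theorem done_mem_sent {i j : Fin n} (hi : i ∉ R.faulty) {k : ℕ} {val : V}
    (hm : .done val ∈ R.sent k i j) (q : Fin n) : .done val ∈ R.sent k i q := by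
  generalize h : Msg.done val = m at hm
  cases sentBy_of_mem hi hm with
  | join hs hj hm => subst h; exact (inView_of_mem hi hs _ hm).elim
  | lock hs hc ho | done hs hc ho => cases h; exact ho q
  | _ => cases h

theorem exists_sent_of_doneSent {i : Fin n} (hi : i ∉ R.faulty) {k : ℕ} {s : State n V}
    (hs : R.state k i = some s) :
    s.doneSent = true → ∃ val, ∀ j, R.exec.Sent k i j (.done val) := by
  refine R.invariant hi
    (fun k s => s.doneSent = true → ∃ val, ∀ j, R.exec.Sent k i j (.done val))
    (fun _ _ _ _ h => (Bool.false_ne_true h).elim) ?_ hs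
  intro k s s' e o _ _ _ ho h ih
  have old (h : s.doneSent = true) : ∃ val, ∀ j, R.exec.Sent (k + 1) i j (.done val) := by
    obtain ⟨val, h⟩ := ih h
    exact ⟨val, fun j => (h j).mono k.le_succ⟩
  have new (val : V) (hval : o = sendAll (.done val)) :
      ∃ val, ∀ j, R.exec.Sent (k + 1) i j (.done val) := by
    have hmem (j : Fin n) : .done val ∈ R.sent k i j :=
      ho.trans hval ▸ List.mem_singleton.2 rfl
    exact ⟨val, fun j => ⟨k, k.lt_succ_self, hmem j⟩⟩
  cases h with
  | done h hd ho' =>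
    intro hb
    rcases ho' with ⟨-, -, -, ho'⟩ | ⟨-, he, -⟩
    · exact new _ ho'
    · exact old (he.symm.trans hb)
  | quorumLock h hc ho' =>
    intro _
    rcases ho' with ⟨-, ho'⟩ | ⟨he, -⟩
    · exact new _ ho'
    · exact old he
  | _ => exact old

theorem mem_doneFrom_of_sent {i q : Fin n} (hi : i ∉ R.faulty) (hu : R.Undecided i)
    (hq : q ∉ R.faulty) {k : ℕ} {val : V} {T : ℝ} (hk : k ≤ R.upTo T) (hT : R.GST ≤ T)
    (h : R.exec.Sent k q i (.done val)) {s : State n V}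
    (hs : R.state (R.upTo (T + Δ)) i = some s) : q ∈ s.doneFrom val := by
  obtain ⟨l, hl, h⟩ := h
  obtain ⟨k', -, hk', he⟩ := R.exec.exists_event_recv hq hi (hl.trans_le hk) hT h
  obtain ⟨s', hs', hstale⟩ := stale_of_event hi hu he
  exact (R.state_le hi hk' hs' hs).doneFrom val hstale

theorem exists_common_done
    (h : ∀ i, i ∉ R.faulty → ∃ k s, R.state k i = some s ∧ s.doneSent = true) {q : Fin n}
    (hq : q ∉ R.faulty) :
    ∃ val, ∀ i, i ∉ R.faulty → ∃ k, R.exec.Sent k i q (.done val) := by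
  have hsent : ∀ i, i ∉ R.faulty → ∃ k val, R.exec.Sent k i q (.done val) := fun i hi => by
    obtain ⟨k, s, hs, hd⟩ := h i hi
    obtain ⟨val, hval⟩ := exists_sent_of_doneSent hi hs hd
    exact ⟨k, val, hval q⟩
  obtain ⟨_, val, _, -, hm⟩ := hsent q hq
  obtain ⟨_, _, hquorum⟩ := quorum_of_done hq hm
  refine ⟨val, fun i hi => ?_⟩
  obtain ⟨k, val', l, hl, hm'⟩ := hsent i hi
  obtain ⟨_, _, hquorum'⟩ := quorum_of_done hi hm'
  obtain rfl := lock_quorum_unique hquorum hquorum'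
  exact ⟨k, l, hl, hm'⟩

theorem not_undecided_of_doneSent
    (h : ∀ i, i ∉ R.faulty → ∃ k s, R.state k i = some s ∧ s.doneSent = true) {q : Fin n}
    (hq : q ∉ R.faulty) : ¬ R.Undecided q := by
  intro hu
  obtain ⟨val, hsent⟩ := exists_common_done h hq
  choose! F hF using hsent
  obtain ⟨T, hT, hk⟩ := R.exec.exists_le_upTo (Finset.univ.sup F)
  obtain ⟨s, hs⟩ := exists_state_upTo hq (hT.trans (le_add_of_nonneg_right R.delay_pos.le))
  refine (doneInv hq hs).decide val (R.card_compl_faulty.trans (Finset.card_le_card ?_)) (hu _ s hs)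
  intro i hi
  have hi := Finset.mem_compl.1 hi
  exact mem_doneFrom_of_sent hq hu hi ((Finset.le_sup (Finset.mem_univ i)).trans hk) hT (hF i hi) hs

theorem exists_decided_of_not_undecided {i : Fin n} (h : ¬ R.Undecided i) :
    ∃ k s val, R.state k i = some s ∧ s.decided = some val := by
  unfold Undecided at h
  push Not at h
  obtain ⟨k, s, hs, hne⟩ := h
  obtain ⟨val, hval⟩ := Option.ne_none_iff_exists'.1 hne
  exact ⟨k, s, val, hs, hval⟩

/-- The `n - f` parties that a decision is based on include `f + 1` nonfaulty ones, whose `done`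
messages reach everybody and are amplified. -/
theorem exists_doneSent_of_decided {i : Fin n} (hi : i ∉ R.faulty) {k : ℕ} {s : State n V}
    (hs : R.state k i = some s) {val : V} (hd : s.decided = some val) {q : Fin n}
    (hq : q ∉ R.faulty) : ∃ k s, R.state k q = some s ∧ s.doneSent = true := by
  by_cases hu : R.Undecided q
  · obtain ⟨T, hT, hk⟩ := R.exec.exists_le_upTo k
    obtain ⟨sq, hsq⟩ := exists_state_upTo hq (hT.trans (le_add_of_nonneg_right R.delay_pos.le))
    refine ⟨_, sq, hsq, (doneInv hq hsq).amplify val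
      ((R.card_sdiff_faulty ((doneInv hi hs).decided val hd)).trans (Finset.card_le_card ?_))⟩
    intro j hj
    obtain ⟨hj, hjf⟩ := Finset.mem_sdiff.1 hj
    obtain ⟨k', hk', l, hl, hm⟩ :=
      (received_of_mem_doneFrom hi hs j val hj).exists_sent_lt hi hjf
    exact mem_doneFrom_of_sent hq hu hjf hk hT ⟨l, by omega, done_mem_sent hjf hm q⟩ hsq
  · obtain ⟨k', s', val', hs', hd'⟩ := exists_decided_of_not_undecided hu
    have hlt := R.three_mul_lt
    have hinv := doneInv hq hs'
    have hcard := hinv.decided val' hd'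
    exact ⟨k', s', hs', hinv.amplify val' (by omega)⟩

theorem exists_decided (R : Run n V f Δ) {q : Fin n} (hq : q ∉ R.faulty) :
    ∃ k s val, R.state k q = some s ∧ s.decided = some val := by
  refine exists_decided_of_not_undecided ?_
  by_cases hall : ∀ i, i ∉ R.faulty → R.Undecided i
  · obtain ⟨v, t₀, hgood⟩ := exists_good hall hq
    exact not_undecided_of_doneSent (fun i hi => hgood.exists_doneSent hi) hq
  · push Not at hall
    obtain ⟨i, hi, hi'⟩ := hall
    obtain ⟨k, s, val, hs, hd⟩ := exists_decided_of_not_undecided hi'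
    exact not_undecided_of_doneSent (fun p hp => exists_doneSent_of_decided hi hs hd hp) hq

end Run

end ITHS

theorem mainTheorem1 {V : Type*} [DecidableEq V] (n f : ℕ) (hf : 3 * f < n) (Δ : ℝ) (hΔ : 0 < Δ) :
    PartialSync.IsByzantineAgreement (ITHS.protocol n f Δ V) f Δ := by
  intro faulty hfaulty input E
  let R : ITHS.Run n V f Δ := ⟨hf, hΔ, faulty, hfaulty, input, E⟩
  refine ⟨fun i hi => ?termination, fun i j v w hi hj hv hw => ?correctness,
    fun h0 v hin i w hw => ?validity⟩
  case termination =>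
    obtain ⟨k, s, val, hs, hd⟩ := R.exists_decided (q := i) hi
    exact ⟨val, k, s, hs, hd⟩
  case correctness =>
    obtain ⟨k, s, hs, hd⟩ := hv
    obtain ⟨k', s', hs', hd'⟩ := hw
    obtain ⟨_, _, hq⟩ := ITHS.Run.quorum_of_decided (R := R) hi hs hd
    obtain ⟨_, _, hq'⟩ := ITHS.Run.quorum_of_decided (R := R) hj hs' hd'
    exact ITHS.Run.lock_quorum_unique hq hq'
  case validity =>
    obtain ⟨k, s, hs, hd⟩ := hw
    exact ITHS.Run.decided_eq (R := R) h0 hin hs hd
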